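/- **Setting.** Composition of 1-cells is written $g\circ f$ or, in diagrammatic order, as indicated; juxtaposition denotes the tensor product of objects and whiskering with identities, e.g. $f1=f\otimes B$, $1g=A\otimes g$. A *Gray monoid* $\mathcal V$ is a monoid for the Gray tensor product of (strict) 2-categories: a 2-category with a strictly associative and unital tensor product of objects (unit $\mathbb 1$), strict 2-functors $A\otimes-$ and $-\otimes B$ strictly compatible with associativity and units, and invertible interchangers $\Sigma_{f,g}\colon (f\otimes B')\circ(A\otimes g)\Rightarrow(A'\otimes g)\circ(f\otimes B)$ for $f\colon A\to A'$, $g\colon B\to B'$, which are identities when $f$ or $g$ is an identity, satisfy $1\Sigma_{f,g}=\Sigma_{1f,g}$, $\Sigma_{f1,g}=\Sigma_{f,1g}$, $\Sigma_{f,g}1=\Sigma_{f,g1}$, are natural in 2-cells and compatible with composition of 1-cells. A *braided Gray monoid* has in addition a pseudonatural equivalence $\beta_{A,B}\colon A\otimes B\to B\otimes A$ (between the 2-functors $\otimes$ and $\otimes\circ\sigma$ on the Gray tensor square of $\mathcal V$, $\sigma$ the symmetry) and invertible modifications $$R_{A,B,C}\colon\beta_{A,BC}\Rightarrow(1_B\beta_{A,C})\circ(\beta_{A,B}1_C),\qquad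 S_{A,B,C}\colon\beta_{AB,C}\Rightarrow(\beta_{A,C}1_B)\circ(1_A\beta_{B,C})$$ satisfying, for all objects, the four braiding axioms (equalities of composite 2-cells; whiskering by identity 1-cells and vertical composition are understood, and in each case the composite has the displayed source and target): * (BA1) $(1_BR_{A,C,D})\cdot R_{A,B,CD}=(R_{A,B,C}1_D)\cdot R_{A,BC,D}$, from $\beta_{A,BCD}$ to $(11\beta_{A,D})(1\beta_{A,C}1)(\beta_{A,B}11)$. * (BA2) $(S_{A,B,D}1_C)\cdot S_{AB,C,D}=(1_AS_{B,C,D})\cdot S_{A,BC,D}$, from $\beta_{ABC,D}$ to $(\beta_{A,D}11)(1\beta_{B,D}1)(11\beta_{C,D})$. * (BA3) $(1_AR_{B,C,D}^{-1})\cdot(R_{A,C,D}^{-1}1_B)\cdot\Sigma^{-1}_{\beta_{A,C},\beta_{B,D}}\cdot(1_CS_{A,B,D})\cdot(S_{A,B,C}1_D)=S_{A,B,CD}\cdot R_{AB,C,D}^{-1}$, from $(1_C\beta_{AB,D})(\beta_{AB,C}1_D)$ to $(\beta_{A,CD}1_B)(1_A\beta_{B,CD})$. * (BA4) $R_{A,C,B}\cdot\beta_{1,\beta_{B,C}}\cdot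 R_{A,B,C}^{-1}=S_{A,B,C}\cdot\beta_{\beta_{A,B},1}\cdot S_{B,A,C}^{-1}$, from $(\beta_{B,C}1)(1\beta_{A,C})(\beta_{A,B}1)$ to $(1\beta_{A,B})(\beta_{A,C}1)(1\beta_{B,C})$, where $\beta_{1,\beta_{B,C}}\colon(\beta_{B,C}1)\circ\beta_{A,BC}\cong\beta_{A,CB}\circ(1\beta_{B,C})$ and $\beta_{\beta_{A,B},1}\colon\beta_{BA,C}\circ(\beta_{A,B}1)\cong(1\beta_{A,B})\circ\beta_{AB,C}$ are the pseudonaturality 2-cells of $\beta$. It is a *semi-strict braided monoidal bicategory* if moreover $\beta_{A,\mathbb 1}$ and $\beta_{\mathbb 1,A}$ are identities, and $R_{A,B,C}$ and $S_{A,B,C}$ are identity 2-cells whenever one of $A,B,C$ is $\mathbb 1$. *The data of a $\mathcal V$-bicategory* $\mathcal C$ consist of objects $c,d,\dots$, hom-objects $\mathcal C(c,d)\in\mathcal V$, compositions $m\colon\mathcal C(d,e)\otimes\mathcal C(c,d)\to\mathcal C(c,e)$, units $u\colon\mathbb 1\to\mathcal C(c,c)$, and invertible 2-cells $\alpha\colon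 m\circ(m1)\Rightarrow m\circ(1m)$, $\lambda\colon m\circ(u1)\Rightarrow 1$, $\rho\colon m\circ(1u)\Rightarrow1$. They form a *$\mathcal V$-bicategory* if * (IC) $\bigl(m\circ(1\lambda)\bigr)\cdot\bigl(\alpha\circ(1u1)\bigr)=m\circ(\rho1)$ as 2-cells $m\circ(m1)\circ(1u1)\Rightarrow m$; * (AC) $\bigl(m\circ1\alpha\bigr)\cdot\bigl(\alpha\circ(1m1)\bigr)\cdot\bigl(m\circ\alpha1\bigr)=\bigl(\alpha\circ(11m)\bigr)\cdot\bigl(m\circ\Sigma_{m,m}^{-1}\bigr)\cdot\bigl(\alpha\circ(m11)\bigr)$ as 2-cells $m\circ(m1)\circ(m11)\Rightarrow m\circ(1m)\circ(11m)$. **Theorem.** Let $\mathcal V$ be a semi-strict braided monoidal bicategory and let $\mathcal B,\mathcal C$ be $\mathcal V$-bicategories. Then the following data $\mathcal B\otimes\mathcal C$ form a $\mathcal V$-bicategory, i.e. they satisfy (IC) and (AC): * objects are pairs $(b,c)$, and $(\mathcal B\otimes\mathcal C)((b,c),(b',c'))=\mathcal B(b,b')\otimes\mathcal C(c,c')$;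 * composition is $\underline m=(m\otimes m)\circ(1\beta1)\colon \mathcal B(b',b'')\mathcal C(c',c'')\mathcal B(b,b')\mathcal C(c,c')\to\mathcal B(b,b'')\mathcal C(c,c'')$, and the unit is $\underline u=u\otimes u\colon\mathbb 1=\mathbb 1\otimes\mathbb 1\to\mathcal B(b,b)\otimes\mathcal C(c,c)$, where $f\otimes g$ stands for $(A'\otimes g)\circ(f\otimes B)$; * the associator $\underline\alpha\colon\underline m\circ(\underline m\,\underline 1)\Rightarrow\underline m\circ(\underline 1\,\underline m)$ (with $\underline1=11$) is the composite of the following whiskered 2-cells: the crossing $(1\beta1)\circ(mm\underline1)\cong(m1\otimes m1)\circ(\underline1\beta1)$ built from the pseudonaturality of $\beta$ at $m$ and an interchanger; $\alpha\otimes\alpha$, pre- and post-composed with the interchangers identifying $(m\otimes m)\circ(m1\otimes m1)$ with $(m\circ m1)\otimes(m\circ m1)$ and $(m\circ 1m)\otimes(m\circ 1m)$ with $(m\otimes m)\circ(1m\otimes1m)$; the composite of $\underline1S1$, the interchanger of two braidings, and $1R^{-1}\underline1$, from $(\underline1\beta1)\circ(1\beta1\underline1)$ to $(1\beta\underline1)\circ(\underline11\beta1)$;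 and the crossing $(1m\otimes1m)\circ(1\beta\underline1)\cong(1\beta1)\circ(\underline1mm)$ built from the pseudonaturality of $\beta$ at $m$ and an interchanger; * the left unitor $\underline\lambda\colon\underline m\circ(\underline u\,\underline1)\Rightarrow\underline 1$ is the composite of the crossing $(1\beta1)\circ(uu\underline1)\cong(u1\otimes u1)\circ(1\beta_{\mathbb 1,-}1)$, the interchanger identifying $(m\otimes m)\circ(u1\otimes u1)$ with $(m\circ u1)\otimes(m\circ u1)$, $\lambda\otimes\lambda$, and the identity $\beta_{\mathbb 1,-}=1$; the right unitor $\underline\rho$ is defined in the same way from $\underline1uu$, $\beta_{-,\mathbb 1}=1$ and $\rho\otimes\rho$. -/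

import Mathlib

open CategoryTheory Bicategory

universe w v u u₁ u₂

/-!
Strict 2-categories are Mathlib's bicategories satisfying `Bicategory.Strict`. Composition of
1-cells is written in diagrammatic order. In a strict 2-category every associativity or unit
coherence 1-cell or 2-cell is of the form `eqToHom`; an equality `η ≍ θ` of 2-cells between equal
(but not syntactically identical) 1-cells is a heterogeneous equality.
-/

section TwoCells

variable {V : Type u} [Bicategory.{w, v} V]

/-- The composite of two 2-cells `η : f ⟶ g` and `θ : g' ⟶ h`, where `g = g'`. -/
def vcomp {X Y : V} {f g g' h : X ⟶ Y} (η : f ⟶ g) (θ : g' ⟶ h)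
    (e : g = g' := by simp) : f ⟶ h :=
  η ≫ eqToHom e ≫ θ

infixr:75 " ⊚ " => vcomp

/-- The composite of two invertible 2-cells `η : f ≅ g` and `θ : g' ≅ h`, where `g = g'`. -/
def vcompIso {X Y : V} {f g g' h : X ⟶ Y} (η : f ≅ g) (θ : g' ≅ h)
    (e : g = g' := by simp) : f ≅ h :=
  η ≪≫ eqToIso e ≪≫ θ

infixr:75 " ⊚ᵢ " => vcompIso

/-- An invertible 2-cell `η : f ≅ g` seen as a 2-cell `f' ≅ g'`, where `f' = f` and `g = g'`. -/
def castIso {X Y : V} {f f' g g' : X ⟶ Y} (η : f ≅ g) (e : f' = f := by simp)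
    (e' : g = g' := by simp) : f' ≅ g' :=
  eqToIso e ≪≫ η ≪≫ eqToIso e'

/-- The whiskering of a 2-cell by 1-cells on both sides. -/
def whisker {W X Y Z : V} (p : W ⟶ X) {f g : X ⟶ Y} (η : f ⟶ g) (q : Y ⟶ Z) :
    p ≫ f ≫ q ⟶ p ≫ g ≫ q :=
  p ◁ (η ▷ q)

/-- The whiskering of an invertible 2-cell by 1-cells on both sides. -/
def whiskerIso {W X Y Z : V} (p : W ⟶ X) {f g : X ⟶ Y} (η : f ≅ g) (q : Y ⟶ Z) :
    p ≫ f ≫ q ≅ p ≫ g ≫ q :=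
  whiskerLeftIso p (whiskerRightIso η q)

end TwoCells

/-- A Gray monoid: a strict 2-category `V` with a monoid structure for the Gray tensor product.
Explicitly: an associative and unital tensor product of objects, strict 2-functors `A ⊗ -` and
`- ⊗ B`, compatible with associativity and units, and interchangers
`Σ_{f,g} : (f ⊗ B') ∘ (A ⊗ g) ≅ (A' ⊗ g) ∘ (f ⊗ B)`. -/
class GrayMonoid (V : Type u) [Bicategory.{w, v} V] [Bicategory.Strict V] where
  /-- tensor product of objects -/
  tensorObj : V → V → V
  /-- the unit object -/
  unitObj : V
  /-- `A ⊗ g` for a 1-cell `g` -/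
  tensorLeft (A : V) {B B' : V} (g : B ⟶ B') : tensorObj A B ⟶ tensorObj A B'
  /-- `f ⊗ B` for a 1-cell `f` -/
  tensorRight {A A' : V} (f : A ⟶ A') (B : V) : tensorObj A B ⟶ tensorObj A' B
  /-- `A ⊗ θ` for a 2-cell `θ` -/
  tensorLeft₂ (A : V) {B B' : V} {g g' : B ⟶ B'} (θ : g ⟶ g') :
    tensorLeft A g ⟶ tensorLeft A g'
  /-- `η ⊗ B` for a 2-cell `η` -/
  tensorRight₂ {A A' : V} {f f' : A ⟶ A'} (η : f ⟶ f') (B : V) :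
    tensorRight f B ⟶ tensorRight f' B
  -- `A ⊗ -` is a strict 2-functor
  tensorLeft_id (A B : V) : tensorLeft A (𝟙 B) = 𝟙 (tensorObj A B)
  tensorLeft_comp (A : V) {B B' B'' : V} (g : B ⟶ B') (g' : B' ⟶ B'') :
    tensorLeft A (g ≫ g') = tensorLeft A g ≫ tensorLeft A g'
  tensorLeft₂_id (A : V) {B B' : V} (g : B ⟶ B') : tensorLeft₂ A (𝟙 g) = 𝟙 (tensorLeft A g)
  tensorLeft₂_comp (A : V) {B B' : V} {g g' g'' : B ⟶ B'} (θ : g ⟶ g') (θ' : g' ⟶ g'') :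
    tensorLeft₂ A (θ ≫ θ') = tensorLeft₂ A θ ≫ tensorLeft₂ A θ'
  tensorLeft₂_whiskerLeft (A : V) {B B' B'' : V} (g : B ⟶ B') {h h' : B' ⟶ B''} (θ : h ⟶ h') :
    tensorLeft₂ A (g ◁ θ) ≍ tensorLeft A g ◁ tensorLeft₂ A θ
  tensorLeft₂_whiskerRight (A : V) {B B' B'' : V} {g g' : B ⟶ B'} (θ : g ⟶ g') (h : B' ⟶ B'') :
    tensorLeft₂ A (θ ▷ h) ≍ tensorLeft₂ A θ ▷ tensorLeft A h
  -- `- ⊗ B` is a strict 2-functor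
  tensorRight_id (A B : V) : tensorRight (𝟙 A) B = 𝟙 (tensorObj A B)
  tensorRight_comp {A A' A'' : V} (f : A ⟶ A') (f' : A' ⟶ A'') (B : V) :
    tensorRight (f ≫ f') B = tensorRight f B ≫ tensorRight f' B
  tensorRight₂_id {A A' : V} (f : A ⟶ A') (B : V) : tensorRight₂ (𝟙 f) B = 𝟙 (tensorRight f B)
  tensorRight₂_comp {A A' : V} {f f' f'' : A ⟶ A'} (η : f ⟶ f') (η' : f' ⟶ f'') (B : V) :
    tensorRight₂ (η ≫ η') B = tensorRight₂ η B ≫ tensorRight₂ η' B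
  tensorRight₂_whiskerLeft {A A' A'' : V} (f : A ⟶ A') {h h' : A' ⟶ A''} (η : h ⟶ h') (B : V) :
    tensorRight₂ (f ◁ η) B ≍ tensorRight f B ◁ tensorRight₂ η B
  tensorRight₂_whiskerRight {A A' A'' : V} {f f' : A ⟶ A'} (η : f ⟶ f') (h : A' ⟶ A'') (B : V) :
    tensorRight₂ (η ▷ h) B ≍ tensorRight₂ η B ▷ tensorRight h B
  -- strict associativity
  tensor_assoc (A B C : V) : tensorObj (tensorObj A B) C = tensorObj A (tensorObj B C)
  tensorLeft_tensorLeft (A B : V) {C C' : V} (h : C ⟶ C') :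
    tensorLeft (tensorObj A B) h ≍ tensorLeft A (tensorLeft B h)
  tensorRight_tensorLeft (A : V) {B B' : V} (g : B ⟶ B') (C : V) :
    tensorRight (tensorLeft A g) C ≍ tensorLeft A (tensorRight g C)
  tensorRight_tensorRight {A A' : V} (f : A ⟶ A') (B C : V) :
    tensorRight f (tensorObj B C) ≍ tensorRight (tensorRight f B) C
  tensorLeft₂_tensorLeft₂ (A B : V) {C C' : V} {h h' : C ⟶ C'} (θ : h ⟶ h') :
    tensorLeft₂ (tensorObj A B) θ ≍ tensorLeft₂ A (tensorLeft₂ B θ)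
  tensorRight₂_tensorLeft₂ (A : V) {B B' : V} {g g' : B ⟶ B'} (θ : g ⟶ g') (C : V) :
    tensorRight₂ (tensorLeft₂ A θ) C ≍ tensorLeft₂ A (tensorRight₂ θ C)
  tensorRight₂_tensorRight₂ {A A' : V} {f f' : A ⟶ A'} (η : f ⟶ f') (B C : V) :
    tensorRight₂ η (tensorObj B C) ≍ tensorRight₂ (tensorRight₂ η B) C
  -- strict unitality
  unit_tensor (A : V) : tensorObj unitObj A = A
  tensor_unit (A : V) : tensorObj A unitObj = A
  unit_tensorLeft {A A' : V} (f : A ⟶ A') : tensorLeft unitObj f ≍ f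
  tensorRight_unit {A A' : V} (f : A ⟶ A') : tensorRight f unitObj ≍ f
  unit_tensorLeft₂ {A A' : V} {f f' : A ⟶ A'} (η : f ⟶ f') : tensorLeft₂ unitObj η ≍ η
  tensorRight₂_unit {A A' : V} {f f' : A ⟶ A'} (η : f ⟶ f') : tensorRight₂ η unitObj ≍ η
  /-- the interchanger `Σ_{f,g}` -/
  interchanger {A A' B B' : V} (f : A ⟶ A') (g : B ⟶ B') :
    tensorLeft A g ≫ tensorRight f B' ≅ tensorRight f B ≫ tensorLeft A' g
  -- interchangers of identities are identities
  interchanger_id_left (A : V) {B B' : V} (g : B ⟶ B') :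
    (interchanger (𝟙 A) g).hom ≍ 𝟙 (tensorLeft A g)
  interchanger_id_right {A A' : V} (f : A ⟶ A') (B : V) :
    (interchanger f (𝟙 B)).hom ≍ 𝟙 (tensorRight f B)
  -- compatibility of interchangers with the tensor product of objects
  tensorLeft₂_interchanger (A : V) {B B' C C' : V} (f : B ⟶ B') (g : C ⟶ C') :
    tensorLeft₂ A (interchanger f g).hom ≍ (interchanger (tensorLeft A f) g).hom
  interchanger_tensor {A A' C C' : V} (f : A ⟶ A') (B : V) (g : C ⟶ C') :
    (interchanger (tensorRight f B) g).hom ≍ (interchanger f (tensorLeft B g)).hom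
  tensorRight₂_interchanger {A A' B B' : V} (f : A ⟶ A') (g : B ⟶ B') (C : V) :
    tensorRight₂ (interchanger f g).hom C ≍ (interchanger f (tensorRight g C)).hom
  -- naturality of interchangers with respect to 2-cells
  interchanger_naturality_left {A A' B B' : V} {f f' : A ⟶ A'} (η : f ⟶ f') (g : B ⟶ B') :
    tensorLeft A g ◁ tensorRight₂ η B' ≫ (interchanger f' g).hom =
      (interchanger f g).hom ≫ tensorRight₂ η B ▷ tensorLeft A' g
  interchanger_naturality_right {A A' B B' : V} (f : A ⟶ A') {g g' : B ⟶ B'} (θ : g ⟶ g') :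
    tensorLeft₂ A θ ▷ tensorRight f B' ≫ (interchanger f g').hom =
      (interchanger f g).hom ≫ tensorRight f B ◁ tensorLeft₂ A' θ
  -- compatibility of interchangers with composition of 1-cells
  interchanger_comp_left {A A' A'' B B' : V} (f : A ⟶ A') (f' : A' ⟶ A'') (g : B ⟶ B') :
    (interchanger (f ≫ f') g).hom ≍
      (α_ _ _ _).inv ≫ (interchanger f g).hom ▷ tensorRight f' B' ≫ (α_ _ _ _).hom ≫
        tensorRight f B ◁ (interchanger f' g).hom
  interchanger_comp_right {A A' B B' B'' : V} (f : A ⟶ A') (g : B ⟶ B') (g' : B' ⟶ B'') :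
    (interchanger f (g ≫ g')).hom ≍
      tensorLeft A g ◁ (interchanger f g').hom ≫ (α_ _ _ _).inv ≫
        (interchanger f g).hom ▷ tensorLeft A' g' ≫ (α_ _ _ _).hom

infixr:83 " ⊗ᵍ " => GrayMonoid.tensorObj
infixr:82 " ◃ " => GrayMonoid.tensorLeft
infixl:82 " ▹ " => GrayMonoid.tensorRight
infixr:82 " ◃₂ " => GrayMonoid.tensorLeft₂
infixl:82 " ▹₂ " => GrayMonoid.tensorRight₂
notation "𝕀" => GrayMonoid.unitObj

namespace GrayMonoid

variable {V : Type u} [Bicategory.{w, v} V] [Bicategory.Strict V] [GrayMonoid V]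

/-- The identity 1-cell between two objects that are equal by strict associativity and unitality
of the tensor product. -/
abbrev cst (X Y : V) (h : X = Y := by
    simp [GrayMonoid.tensor_assoc, GrayMonoid.unit_tensor, GrayMonoid.tensor_unit]) : X ⟶ Y :=
  eqToHom h

/-- `A ⊗ η` for an invertible 2-cell `η`. -/
@[simps]
def tensorLeftIso (A : V) {B B' : V} {g g' : B ⟶ B'} (θ : g ≅ g') : A ◃ g ≅ A ◃ g' where
  hom := A ◃₂ θ.hom
  inv := A ◃₂ θ.inv
  hom_inv_id := by rw [← tensorLeft₂_comp, θ.hom_inv_id, tensorLeft₂_id]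
  inv_hom_id := by rw [← tensorLeft₂_comp, θ.inv_hom_id, tensorLeft₂_id]

/-- `η ⊗ B` for an invertible 2-cell `η`. -/
@[simps]
def tensorRightIso {A A' : V} {f f' : A ⟶ A'} (η : f ≅ f') (B : V) : f ▹ B ≅ f' ▹ B where
  hom := η.hom ▹₂ B
  inv := η.inv ▹₂ B
  hom_inv_id := by rw [← tensorRight₂_comp, η.hom_inv_id, tensorRight₂_id]
  inv_hom_id := by rw [← tensorRight₂_comp, η.inv_hom_id, tensorRight₂_id]

theorem tensorLeft_eqToHom (A : V) {B B' : V} (h : B = B') :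
    A ◃ (eqToHom h) = eqToHom (by rw [h]) := by
  subst h; simp [tensorLeft_id]

theorem tensorRight_eqToHom {A A' : V} (h : A = A') (B : V) :
    (eqToHom h) ▹ B = eqToHom (by rw [h]) := by
  subst h; simp [tensorRight_id]

theorem tensorLeft_tensorObj (A B : V) {C C' : V} (h : C ⟶ C') :
    (A ⊗ᵍ B) ◃ h = eqToHom (tensor_assoc A B C) ≫ A ◃ B ◃ h ≫
      eqToHom (tensor_assoc A B C').symm :=
  (conj_eqToHom_iff_heq _ _ _ (tensor_assoc A B C')).2 (tensorLeft_tensorLeft A B h)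

theorem tensorRight_tensorLeft' (A : V) {B B' : V} (g : B ⟶ B') (C : V) :
    (A ◃ g) ▹ C = eqToHom (tensor_assoc A B C) ≫ A ◃ (g ▹ C) ≫
      eqToHom (tensor_assoc A B' C).symm :=
  (conj_eqToHom_iff_heq _ _ _ (tensor_assoc A B' C)).2 (tensorRight_tensorLeft A g C)

theorem tensorRight_tensorObj {A A' : V} (f : A ⟶ A') (B C : V) :
    f ▹ (B ⊗ᵍ C) = eqToHom (tensor_assoc A B C).symm ≫ f ▹ B ▹ C ≫
      eqToHom (tensor_assoc A' B C) :=
  (conj_eqToHom_iff_heq _ _ _ (tensor_assoc A' B C).symm).2 (tensorRight_tensorRight f B C)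

theorem unit_tensorLeft' {A A' : V} (f : A ⟶ A') :
    𝕀 ◃ f = eqToHom (unit_tensor A) ≫ f ≫ eqToHom (unit_tensor A').symm :=
  (conj_eqToHom_iff_heq _ _ _ (unit_tensor A')).2 (unit_tensorLeft f)

theorem tensorRight_unit' {A A' : V} (f : A ⟶ A') :
    f ▹ 𝕀 = eqToHom (tensor_unit A) ≫ f ≫ eqToHom (tensor_unit A').symm :=
  (conj_eqToHom_iff_heq _ _ _ (tensor_unit A')).2 (tensorRight_unit f)

attribute [local simp] tensorLeft_id tensorLeft_comp tensorRight_id tensorRight_comp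
  tensorLeft_eqToHom tensorRight_eqToHom tensorLeft_tensorObj tensorRight_tensorLeft'
  tensorRight_tensorObj unit_tensorLeft' tensorRight_unit'

/-- The tensor product `f ⊗ g` of 1-cells, taken to be `(A' ⊗ g) ∘ (f ⊗ B)`. -/
def tensorHom {A A' B B' : V} (f : A ⟶ A') (g : B ⟶ B') : A ⊗ᵍ B ⟶ A' ⊗ᵍ B' :=
  f ▹ B ≫ A' ◃ g

infixr:82 " ⊗₁ " => GrayMonoid.tensorHom

attribute [local simp] tensorHom

/-- The tensor product of invertible 2-cells. -/
def tensorIso {A A' B B' : V} {f f' : A ⟶ A'} {g g' : B ⟶ B'} (η : f ≅ f') (θ : g ≅ g') :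
    f ⊗₁ g ≅ f' ⊗₁ g' :=
  whiskerRightIso (tensorRightIso η B) (A' ◃ g) ≪≫ whiskerLeftIso (f' ▹ B) (tensorLeftIso A' θ)

/-- The canonical invertible 2-cell `(f' ⊗ g') ∘ (f ⊗ g) ≅ (f' ∘ f) ⊗ (g' ∘ g)` given by an
interchanger. -/
def tensorHomComp {A A' A'' B B' B'' : V} (f : A ⟶ A') (f' : A' ⟶ A'') (g : B ⟶ B')
    (g' : B' ⟶ B'') : (f ⊗₁ g) ≫ (f' ⊗₁ g') ≅ (f ≫ f') ⊗₁ (g ≫ g') :=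
  castIso (whiskerIso (f ▹ B) (interchanger f' g) (A'' ◃ g'))

end GrayMonoid

section Braided

open GrayMonoid

attribute [local simp] tensorLeft_id tensorLeft_comp tensorRight_id tensorRight_comp
  tensorLeft_eqToHom tensorRight_eqToHom tensorLeft_tensorObj tensorRight_tensorLeft'
  tensorRight_tensorObj unit_tensorLeft' tensorRight_unit' tensorHom

/-- A braided Gray monoid: a Gray monoid with a pseudonatural equivalence `β` from the tensor
product to the opposite tensor product, and two invertible modifications `R` and `S`,
satisfying the four braiding axioms. Pseudonatural transformations and modifications on Gray
tensor products are given on the generating cells of these 2-categories, namely cells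
tensored with objects, and interchangers. -/
class BraidedGrayMonoid (V : Type u) [Bicategory.{w, v} V] [Bicategory.Strict V]
    [GrayMonoid V] where
  /-- the braiding `β_{A,B}` -/
  β (A B : V) : A ⊗ᵍ B ⟶ B ⊗ᵍ A
  β_equivalence (A B : V) : ∃ e : Bicategory.Equivalence (A ⊗ᵍ B) (B ⊗ᵍ A), e.hom = β A B
  /-- pseudonaturality of `β` at the 1-cell `f ⊗ B` -/
  βl {A A' : V} (f : A ⟶ A') (B : V) : f ▹ B ≫ β A' B ≅ β A B ≫ B ◃ f
  /-- pseudonaturality of `β` at the 1-cell `A ⊗ g` -/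
  βr (A : V) {B B' : V} (g : B ⟶ B') : A ◃ g ≫ β A B' ≅ β A B ≫ g ▹ A
  -- the axioms of a pseudonatural transformation
  βl_naturality {A A' : V} {f f' : A ⟶ A'} (η : f ⟶ f') (B : V) :
    (η ▹₂ B) ▷ β A' B ≫ (βl f' B).hom = (βl f B).hom ≫ β A B ◁ (B ◃₂ η)
  βr_naturality (A : V) {B B' : V} {g g' : B ⟶ B'} (θ : g ⟶ g') :
    (A ◃₂ θ) ▷ β A B' ≫ (βr A g').hom = (βr A g).hom ≫ β A B ◁ (θ ▹₂ A)
  βl_id (A B : V) : (βl (𝟙 A) B).hom ≍ 𝟙 (β A B)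
  βr_id (A B : V) : (βr A (𝟙 B)).hom ≍ 𝟙 (β A B)
  βl_comp {A A' A'' : V} (f : A ⟶ A') (f' : A' ⟶ A'') (B : V) :
    (βl (f ≫ f') B).hom ≍
      (f ▹ B ◁ (βl f' B).hom) ⊚ ((βl f B).hom ▷ (B ◃ f'))
  βr_comp (A : V) {B B' B'' : V} (g : B ⟶ B') (g' : B' ⟶ B'') :
    (βr A (g ≫ g')).hom ≍
      (A ◃ g ◁ (βr A g').hom) ⊚ ((βr A g).hom ▷ (g' ▹ A))
  β_interchanger {A A' B B' : V} (f : A ⟶ A') (g : B ⟶ B') :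
    (A ◃ g ◁ (βl f B').hom) ⊚ ((βr A g).hom ▷ (B' ◃ f)) ⊚ (β A B ◁ (interchanger g f).inv) ≍
      ((interchanger f g).hom ▷ β A' B') ⊚ (f ▹ B ◁ (βr A' g).hom) ⊚ ((βl f B).hom ▷ (g ▹ A'))
  /-- the modification `R` -/
  R (A B C : V) : β A (B ⊗ᵍ C) ≅
    cst (A ⊗ᵍ B ⊗ᵍ C) ((A ⊗ᵍ B) ⊗ᵍ C) ≫ β A B ▹ C ≫ cst ((B ⊗ᵍ A) ⊗ᵍ C) (B ⊗ᵍ A ⊗ᵍ C) ≫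
      B ◃ β A C ≫ cst (B ⊗ᵍ C ⊗ᵍ A) ((B ⊗ᵍ C) ⊗ᵍ A)
  /-- the modification `S` -/
  S (A B C : V) : β (A ⊗ᵍ B) C ≅
    cst ((A ⊗ᵍ B) ⊗ᵍ C) (A ⊗ᵍ B ⊗ᵍ C) ≫ A ◃ β B C ≫ cst (A ⊗ᵍ C ⊗ᵍ B) ((A ⊗ᵍ C) ⊗ᵍ B) ≫
      β A C ▹ B ≫ cst ((C ⊗ᵍ A) ⊗ᵍ B) (C ⊗ᵍ A ⊗ᵍ B)
  -- the modification axiom for `R`, in each of the three variables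
  R_naturality₁ {A A' : V} (f : A ⟶ A') (B C : V) :
    (βl f (B ⊗ᵍ C)).hom ⊚ ((R A B C).hom ▷ ((B ⊗ᵍ C) ◃ f)) ≍
      (f ▹ (B ⊗ᵍ C) ◁ (R A' B C).hom) ⊚
      whisker (cst (A ⊗ᵍ B ⊗ᵍ C) ((A ⊗ᵍ B) ⊗ᵍ C)) ((βl f B).hom ▹₂ C)
        (cst ((B ⊗ᵍ A') ⊗ᵍ C) (B ⊗ᵍ A' ⊗ᵍ C) ≫ B ◃ β A' C ≫
          cst (B ⊗ᵍ C ⊗ᵍ A') ((B ⊗ᵍ C) ⊗ᵍ A')) ⊚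
      whisker (cst (A ⊗ᵍ B ⊗ᵍ C) ((A ⊗ᵍ B) ⊗ᵍ C) ≫ β A B ▹ C ≫
          cst ((B ⊗ᵍ A) ⊗ᵍ C) (B ⊗ᵍ A ⊗ᵍ C)) (B ◃₂ (βl f C).hom)
        (cst (B ⊗ᵍ C ⊗ᵍ A') ((B ⊗ᵍ C) ⊗ᵍ A'))
  R_naturality₂ (A : V) {B B' : V} (g : B ⟶ B') (C : V) :
    (βr A (g ▹ C)).hom ⊚ ((R A B C).hom ▷ (g ▹ C ▹ A)) ≍
      (A ◃ (g ▹ C) ◁ (R A B' C).hom) ⊚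
      whisker (cst (A ⊗ᵍ B ⊗ᵍ C) ((A ⊗ᵍ B) ⊗ᵍ C)) ((βr A g).hom ▹₂ C)
        (cst ((B' ⊗ᵍ A) ⊗ᵍ C) (B' ⊗ᵍ A ⊗ᵍ C) ≫ B' ◃ β A C ≫
          cst (B' ⊗ᵍ C ⊗ᵍ A) ((B' ⊗ᵍ C) ⊗ᵍ A)) ⊚
      whisker (cst (A ⊗ᵍ B ⊗ᵍ C) ((A ⊗ᵍ B) ⊗ᵍ C) ≫ β A B ▹ C ≫
          cst ((B ⊗ᵍ A) ⊗ᵍ C) (B ⊗ᵍ A ⊗ᵍ C)) (interchanger g (β A C)).inv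
        (cst (B' ⊗ᵍ C ⊗ᵍ A) ((B' ⊗ᵍ C) ⊗ᵍ A))
  R_naturality₃ (A B : V) {C C' : V} (h : C ⟶ C') :
    (βr A (B ◃ h)).hom ⊚ ((R A B C).hom ▷ ((B ◃ h) ▹ A)) ≍
      (A ◃ B ◃ h ◁ (R A B C').hom) ⊚
      whisker (cst (A ⊗ᵍ B ⊗ᵍ C) ((A ⊗ᵍ B) ⊗ᵍ C)) (interchanger (β A B) h).hom
        (cst ((B ⊗ᵍ A) ⊗ᵍ C') (B ⊗ᵍ A ⊗ᵍ C') ≫ B ◃ β A C' ≫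
          cst (B ⊗ᵍ C' ⊗ᵍ A) ((B ⊗ᵍ C') ⊗ᵍ A)) ⊚
      whisker (cst (A ⊗ᵍ B ⊗ᵍ C) ((A ⊗ᵍ B) ⊗ᵍ C) ≫ β A B ▹ C ≫
          cst ((B ⊗ᵍ A) ⊗ᵍ C) (B ⊗ᵍ A ⊗ᵍ C)) (B ◃₂ (βr A h).hom)
        (cst (B ⊗ᵍ C' ⊗ᵍ A) ((B ⊗ᵍ C') ⊗ᵍ A))
  -- the modification axiom for `S`, in each of the three variables
  S_naturality₁ {A A' : V} (f : A ⟶ A') (B C : V) :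
    (βl (f ▹ B) C).hom ⊚ ((S A B C).hom ▷ (C ◃ (f ▹ B))) ≍
      (f ▹ B ▹ C ◁ (S A' B C).hom) ⊚
      whisker (cst ((A ⊗ᵍ B) ⊗ᵍ C) (A ⊗ᵍ B ⊗ᵍ C)) (interchanger f (β B C)).inv
        (cst (A' ⊗ᵍ C ⊗ᵍ B) ((A' ⊗ᵍ C) ⊗ᵍ B) ≫ β A' C ▹ B ≫
          cst ((C ⊗ᵍ A') ⊗ᵍ B) (C ⊗ᵍ A' ⊗ᵍ B)) ⊚
      whisker (cst ((A ⊗ᵍ B) ⊗ᵍ C) (A ⊗ᵍ B ⊗ᵍ C) ≫ A ◃ β B C ≫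
          cst (A ⊗ᵍ C ⊗ᵍ B) ((A ⊗ᵍ C) ⊗ᵍ B)) ((βl f C).hom ▹₂ B)
        (cst ((C ⊗ᵍ A') ⊗ᵍ B) (C ⊗ᵍ A' ⊗ᵍ B))
  S_naturality₂ (A : V) {B B' : V} (g : B ⟶ B') (C : V) :
    (βl (A ◃ g) C).hom ⊚ ((S A B C).hom ▷ (C ◃ A ◃ g)) ≍
      ((A ◃ g) ▹ C ◁ (S A B' C).hom) ⊚
      whisker (cst ((A ⊗ᵍ B) ⊗ᵍ C) (A ⊗ᵍ B ⊗ᵍ C)) (A ◃₂ (βl g C).hom)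
        (cst (A ⊗ᵍ C ⊗ᵍ B') ((A ⊗ᵍ C) ⊗ᵍ B') ≫ β A C ▹ B' ≫
          cst ((C ⊗ᵍ A) ⊗ᵍ B') (C ⊗ᵍ A ⊗ᵍ B')) ⊚
      whisker (cst ((A ⊗ᵍ B) ⊗ᵍ C) (A ⊗ᵍ B ⊗ᵍ C) ≫ A ◃ β B C ≫
          cst (A ⊗ᵍ C ⊗ᵍ B) ((A ⊗ᵍ C) ⊗ᵍ B)) (interchanger (β A C) g).hom
        (cst ((C ⊗ᵍ A) ⊗ᵍ B') (C ⊗ᵍ A ⊗ᵍ B'))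
  S_naturality₃ (A B : V) {C C' : V} (h : C ⟶ C') :
    (βr (A ⊗ᵍ B) h).hom ⊚ ((S A B C).hom ▷ (h ▹ (A ⊗ᵍ B))) ≍
      ((A ⊗ᵍ B) ◃ h ◁ (S A B C').hom) ⊚
      whisker (cst ((A ⊗ᵍ B) ⊗ᵍ C) (A ⊗ᵍ B ⊗ᵍ C)) (A ◃₂ (βr B h).hom)
        (cst (A ⊗ᵍ C' ⊗ᵍ B) ((A ⊗ᵍ C') ⊗ᵍ B) ≫ β A C' ▹ B ≫
          cst ((C' ⊗ᵍ A) ⊗ᵍ B) (C' ⊗ᵍ A ⊗ᵍ B)) ⊚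
      whisker (cst ((A ⊗ᵍ B) ⊗ᵍ C) (A ⊗ᵍ B ⊗ᵍ C) ≫ A ◃ β B C ≫
          cst (A ⊗ᵍ C ⊗ᵍ B) ((A ⊗ᵍ C) ⊗ᵍ B)) ((βr A h).hom ▹₂ B)
        (cst ((C' ⊗ᵍ A) ⊗ᵍ B) (C' ⊗ᵍ A ⊗ᵍ B))
  -- the four braiding axioms
  BA1 (A B C D : V) :
    (R A B (C ⊗ᵍ D)).hom ⊚
      whisker (cst (A ⊗ᵍ B ⊗ᵍ C ⊗ᵍ D) ((A ⊗ᵍ B) ⊗ᵍ C ⊗ᵍ D) ≫ β A B ▹ (C ⊗ᵍ D) ≫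
          cst ((B ⊗ᵍ A) ⊗ᵍ C ⊗ᵍ D) (B ⊗ᵍ A ⊗ᵍ C ⊗ᵍ D)) (B ◃₂ (R A C D).hom)
        (cst (B ⊗ᵍ (C ⊗ᵍ D) ⊗ᵍ A) ((B ⊗ᵍ C ⊗ᵍ D) ⊗ᵍ A)) ≍
    (R A (B ⊗ᵍ C) D).hom ⊚
      whisker (cst (A ⊗ᵍ (B ⊗ᵍ C) ⊗ᵍ D) ((A ⊗ᵍ B ⊗ᵍ C) ⊗ᵍ D)) ((R A B C).hom ▹₂ D)
        (cst (((B ⊗ᵍ C) ⊗ᵍ A) ⊗ᵍ D) ((B ⊗ᵍ C) ⊗ᵍ A ⊗ᵍ D) ≫ (B ⊗ᵍ C) ◃ β A D ≫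
          cst ((B ⊗ᵍ C) ⊗ᵍ D ⊗ᵍ A) (((B ⊗ᵍ C) ⊗ᵍ D) ⊗ᵍ A))
  BA2 (A B C D : V) :
    (S (A ⊗ᵍ B) C D).hom ⊚
      whisker (cst (((A ⊗ᵍ B) ⊗ᵍ C) ⊗ᵍ D) ((A ⊗ᵍ B) ⊗ᵍ C ⊗ᵍ D) ≫ (A ⊗ᵍ B) ◃ β C D ≫
          cst ((A ⊗ᵍ B) ⊗ᵍ D ⊗ᵍ C) (((A ⊗ᵍ B) ⊗ᵍ D) ⊗ᵍ C)) ((S A B D).hom ▹₂ C)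
        (cst ((D ⊗ᵍ A ⊗ᵍ B) ⊗ᵍ C) (D ⊗ᵍ (A ⊗ᵍ B) ⊗ᵍ C)) ≍
    (S A (B ⊗ᵍ C) D).hom ⊚
      whisker (cst ((A ⊗ᵍ B ⊗ᵍ C) ⊗ᵍ D) (A ⊗ᵍ (B ⊗ᵍ C) ⊗ᵍ D)) (A ◃₂ (S B C D).hom)
        (cst (A ⊗ᵍ D ⊗ᵍ B ⊗ᵍ C) ((A ⊗ᵍ D) ⊗ᵍ B ⊗ᵍ C) ≫ β A D ▹ (B ⊗ᵍ C) ≫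
          cst ((D ⊗ᵍ A) ⊗ᵍ B ⊗ᵍ C) (D ⊗ᵍ A ⊗ᵍ B ⊗ᵍ C))
  BA3 (A B C D : V) :
    whisker (cst ((A ⊗ᵍ B) ⊗ᵍ C ⊗ᵍ D) (((A ⊗ᵍ B) ⊗ᵍ C) ⊗ᵍ D)) ((S A B C).hom ▹₂ D)
        (cst ((C ⊗ᵍ A ⊗ᵍ B) ⊗ᵍ D) (C ⊗ᵍ (A ⊗ᵍ B) ⊗ᵍ D) ≫ C ◃ β (A ⊗ᵍ B) D ≫
          cst (C ⊗ᵍ D ⊗ᵍ A ⊗ᵍ B) ((C ⊗ᵍ D) ⊗ᵍ A ⊗ᵍ B)) ⊚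
      whisker (cst ((A ⊗ᵍ B) ⊗ᵍ C ⊗ᵍ D) ((A ⊗ᵍ B ⊗ᵍ C) ⊗ᵍ D) ≫ (A ◃ β B C) ▹ D ≫
          cst ((A ⊗ᵍ C ⊗ᵍ B) ⊗ᵍ D) ((A ⊗ᵍ C) ⊗ᵍ B ⊗ᵍ D) ≫ β A C ▹ (B ⊗ᵍ D) ≫
          cst ((C ⊗ᵍ A) ⊗ᵍ B ⊗ᵍ D) (C ⊗ᵍ (A ⊗ᵍ B) ⊗ᵍ D)) (C ◃₂ (S A B D).hom)
        (cst (C ⊗ᵍ D ⊗ᵍ A ⊗ᵍ B) ((C ⊗ᵍ D) ⊗ᵍ A ⊗ᵍ B)) ⊚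
      whisker (cst ((A ⊗ᵍ B) ⊗ᵍ C ⊗ᵍ D) ((A ⊗ᵍ B ⊗ᵍ C) ⊗ᵍ D) ≫ (A ◃ β B C) ▹ D ≫
          cst ((A ⊗ᵍ C ⊗ᵍ B) ⊗ᵍ D) ((A ⊗ᵍ C) ⊗ᵍ B ⊗ᵍ D))
        (interchanger (β A C) (β B D)).inv
        (cst ((C ⊗ᵍ A) ⊗ᵍ D ⊗ᵍ B) (C ⊗ᵍ (A ⊗ᵍ D) ⊗ᵍ B) ≫ C ◃ (β A D ▹ B) ≫
          cst (C ⊗ᵍ (D ⊗ᵍ A) ⊗ᵍ B) ((C ⊗ᵍ D) ⊗ᵍ A ⊗ᵍ B)) ⊚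
      whisker (cst ((A ⊗ᵍ B) ⊗ᵍ C ⊗ᵍ D) ((A ⊗ᵍ B ⊗ᵍ C) ⊗ᵍ D) ≫ (A ◃ β B C) ▹ D ≫
          cst ((A ⊗ᵍ C ⊗ᵍ B) ⊗ᵍ D) ((A ⊗ᵍ C) ⊗ᵍ B ⊗ᵍ D) ≫ (A ⊗ᵍ C) ◃ β B D ≫
          cst ((A ⊗ᵍ C) ⊗ᵍ D ⊗ᵍ B) ((A ⊗ᵍ C ⊗ᵍ D) ⊗ᵍ B)) ((R A C D).inv ▹₂ B)
        (cst (((C ⊗ᵍ D) ⊗ᵍ A) ⊗ᵍ B) ((C ⊗ᵍ D) ⊗ᵍ A ⊗ᵍ B)) ⊚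
      whisker (cst ((A ⊗ᵍ B) ⊗ᵍ C ⊗ᵍ D) (A ⊗ᵍ B ⊗ᵍ C ⊗ᵍ D)) (A ◃₂ (R B C D).inv)
        (cst (A ⊗ᵍ (C ⊗ᵍ D) ⊗ᵍ B) ((A ⊗ᵍ C ⊗ᵍ D) ⊗ᵍ B) ≫ β A (C ⊗ᵍ D) ▹ B ≫
          cst (((C ⊗ᵍ D) ⊗ᵍ A) ⊗ᵍ B) ((C ⊗ᵍ D) ⊗ᵍ A ⊗ᵍ B)) ≍
    (R (A ⊗ᵍ B) C D).inv ≫ (S A B (C ⊗ᵍ D)).hom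
  BA4 (A B C : V) :
    whisker (𝟙 _) (R A B C).inv (β B C ▹ A) ⊚
      (βr A (β B C)).inv ⊚
      whisker (A ◃ β B C) (R A C B).hom (𝟙 _) ≍
    whisker (β A B ▹ C) (S B A C).inv (𝟙 _) ⊚
      (βl (β A B) C).hom ⊚
      whisker (𝟙 _) (S A B C).hom (C ◃ β A B)

open BraidedGrayMonoid

/-- A semi-strict braided monoidal bicategory: a braided Gray monoid whose braiding and whose
modifications `R` and `S` are identities as soon as one of the objects is the unit. -/
class SemistrictBraided (V : Type u) [Bicategory.{w, v} V] [Bicategory.Strict V]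
    [GrayMonoid V] [BraidedGrayMonoid V] : Prop where
  β_unit (A : V) : β A 𝕀 = cst (A ⊗ᵍ 𝕀) (𝕀 ⊗ᵍ A)
  unit_β (A : V) : β 𝕀 A = cst (𝕀 ⊗ᵍ A) (A ⊗ᵍ 𝕀)
  R_unit₃ (A B : V) : (R A B 𝕀).hom ≍ 𝟙 (β A B)
  R_unit₂ (A B : V) : (R A 𝕀 B).hom ≍ 𝟙 (β A B)
  S_unit₁ (A B : V) : (S 𝕀 A B).hom ≍ 𝟙 (β A B)
  S_unit₂ (A B : V) : (S A 𝕀 B).hom ≍ 𝟙 (β A B)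
  R_unit₁ (A B : V) : (R 𝕀 A B).hom ≍ 𝟙 (𝟙 (A ⊗ᵍ B))
  S_unit₃ (A B : V) : (S A B 𝕀).hom ≍ 𝟙 (𝟙 (A ⊗ᵍ B))

end Braided

/-- The data of a `V`-bicategory, for `V` a Gray monoid. -/
structure VBicategoryData (V : Type u) [Bicategory.{w, v} V] [Bicategory.Strict V]
    [GrayMonoid V] where
  /-- objects -/
  Obj : Type u₁
  /-- hom-objects -/
  Hom : Obj → Obj → V
  /-- composition `m` -/
  m (c d e : Obj) : Hom d e ⊗ᵍ Hom c d ⟶ Hom c e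
  /-- units `u` -/
  u (c : Obj) : 𝕀 ⟶ Hom c c
  /-- associator `α : m ∘ (m ⊗ 1) ≅ m ∘ (1 ⊗ m)` -/
  α (c d e f : Obj) : m d e f ▹ Hom c d ≫ m c d f ≅
    GrayMonoid.cst ((Hom e f ⊗ᵍ Hom d e) ⊗ᵍ Hom c d) (Hom e f ⊗ᵍ Hom d e ⊗ᵍ Hom c d) ≫
      Hom e f ◃ m c d e ≫ m c e f
  /-- left unitor `λ : m ∘ (u ⊗ 1) ≅ 1` -/
  l (c d : Obj) : u d ▹ Hom c d ≫ m c d d ≅ GrayMonoid.cst (𝕀 ⊗ᵍ Hom c d) (Hom c d)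
  /-- right unitor `ρ : m ∘ (1 ⊗ u) ≅ 1` -/
  r (c d : Obj) : Hom c d ◃ u c ≫ m c c d ≅ GrayMonoid.cst (Hom c d ⊗ᵍ 𝕀) (Hom c d)

section VBicategory

open GrayMonoid BraidedGrayMonoid

attribute [local simp] tensorLeft_id tensorLeft_comp tensorRight_id tensorRight_comp
  tensorLeft_eqToHom tensorRight_eqToHom tensorLeft_tensorObj tensorRight_tensorLeft'
  tensorRight_tensorObj unit_tensorLeft' tensorRight_unit' tensorHom

variable {V : Type u} [Bicategory.{w, v} V] [Bicategory.Strict V] [GrayMonoid V]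

/-- Identity and associativity coherence: the data `D` form a `V`-bicategory. -/
structure IsVBicategory (D : VBicategoryData.{w, v, u, u₁} V) : Prop where
  /-- identity coherence:
  `(m ∘ (1 ⊗ λ)) · (α ∘ (1 ⊗ u ⊗ 1)) = m ∘ (ρ ⊗ 1)` as 2-cells
  `m ∘ (m ⊗ 1) ∘ (1 ⊗ u ⊗ 1) ⟶ m` -/
  identity_coherence (a b c : D.Obj) :
    whisker ((D.Hom b c ◃ D.u b) ▹ D.Hom a b) (D.α a b b c).hom (𝟙 _) ⊚
      whisker (cst ((D.Hom b c ⊗ᵍ 𝕀) ⊗ᵍ D.Hom a b) (D.Hom b c ⊗ᵍ 𝕀 ⊗ᵍ D.Hom a b))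
        (D.Hom b c ◃₂ (D.l a b).hom) (D.m a b c) ≍
    ((D.r b c).hom ▹₂ D.Hom a b) ▷ D.m a b c
  /-- associativity coherence: equality of the two composite 2-cells
  `m ∘ (m ⊗ 1) ∘ (m ⊗ 1 ⊗ 1) ⟶ m ∘ (1 ⊗ m) ∘ (1 ⊗ 1 ⊗ m)` -/
  associativity_coherence (a b c d e : D.Obj) :
    ((D.α b c d e).hom ▹₂ D.Hom a b) ▷ D.m a b e ⊚
      whisker (cst (((D.Hom d e ⊗ᵍ D.Hom c d) ⊗ᵍ D.Hom b c) ⊗ᵍ D.Hom a b)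
          ((D.Hom d e ⊗ᵍ D.Hom c d ⊗ᵍ D.Hom b c) ⊗ᵍ D.Hom a b) ≫
          (D.Hom d e ◃ D.m b c d) ▹ D.Hom a b) (D.α a b d e).hom (𝟙 _) ⊚
      whisker (cst (((D.Hom d e ⊗ᵍ D.Hom c d) ⊗ᵍ D.Hom b c) ⊗ᵍ D.Hom a b)
          (D.Hom d e ⊗ᵍ (D.Hom c d ⊗ᵍ D.Hom b c) ⊗ᵍ D.Hom a b))
        (D.Hom d e ◃₂ (D.α a b c d).hom) (D.m a d e) ≍
    whisker (D.m c d e ▹ D.Hom b c ▹ D.Hom a b) (D.α a b c e).hom (𝟙 _) ⊚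
      whisker (cst (((D.Hom d e ⊗ᵍ D.Hom c d) ⊗ᵍ D.Hom b c) ⊗ᵍ D.Hom a b)
          ((D.Hom d e ⊗ᵍ D.Hom c d) ⊗ᵍ D.Hom b c ⊗ᵍ D.Hom a b))
        (interchanger (D.m c d e) (D.m a b c)).inv (D.m a c e) ⊚
      whisker (cst (((D.Hom d e ⊗ᵍ D.Hom c d) ⊗ᵍ D.Hom b c) ⊗ᵍ D.Hom a b)
          ((D.Hom d e ⊗ᵍ D.Hom c d) ⊗ᵍ D.Hom b c ⊗ᵍ D.Hom a b) ≫
          (D.Hom d e ⊗ᵍ D.Hom c d) ◃ D.m a b c) (D.α a c d e).hom (𝟙 _)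

variable [BraidedGrayMonoid V]

/-- The 1-cell `1 ⊗ β ⊗ 1 : A ⊗ D ⊗ B ⊗ C ⟶ A ⊗ B ⊗ D ⊗ C`. -/
def mid (A D B C : V) : (A ⊗ᵍ D) ⊗ᵍ (B ⊗ᵍ C) ⟶ (A ⊗ᵍ B) ⊗ᵍ (D ⊗ᵍ C) :=
  cst ((A ⊗ᵍ D) ⊗ᵍ (B ⊗ᵍ C)) (A ⊗ᵍ (D ⊗ᵍ B) ⊗ᵍ C) ≫ A ◃ (β D B ▹ C) ≫
    cst (A ⊗ᵍ (B ⊗ᵍ D) ⊗ᵍ C) ((A ⊗ᵍ B) ⊗ᵍ (D ⊗ᵍ C))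

attribute [local simp] mid

/-- The crossing `(1 ⊗ β ⊗ 1) ∘ (f ⊗ g ⊗ 1 ⊗ 1) ≅ (f ⊗ 1 ⊗ g ⊗ 1) ∘ (1 ⊗ β ⊗ 1)`, given by the
pseudonaturality of `β` at `g` and by the interchanger of `f` and `β`. -/
def midLeft {A A' D D' : V} (f : A ⟶ A') (g : D ⟶ D') (B C : V) :
    (f ⊗₁ g) ▹ (B ⊗ᵍ C) ≫ mid A' D' B C ≅ mid A D B C ≫ (f ▹ B) ⊗₁ (g ▹ C) :=
  castIso (
    whiskerIso (f ▹ D ▹ (B ⊗ᵍ C) ≫ cst ((A' ⊗ᵍ D) ⊗ᵍ (B ⊗ᵍ C)) (A' ⊗ᵍ (D ⊗ᵍ B) ⊗ᵍ C))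
      (tensorLeftIso A' (tensorRightIso (βl g B) C))
      (cst (A' ⊗ᵍ (B ⊗ᵍ D') ⊗ᵍ C) ((A' ⊗ᵍ B) ⊗ᵍ (D' ⊗ᵍ C))) ⊚ᵢ
    whiskerIso (cst ((A ⊗ᵍ D) ⊗ᵍ (B ⊗ᵍ C)) (A ⊗ᵍ (D ⊗ᵍ B) ⊗ᵍ C))
      (interchanger f (β D B ▹ C)).symm
      (A' ◃ ((B ◃ g) ▹ C) ≫ cst (A' ⊗ᵍ (B ⊗ᵍ D') ⊗ᵍ C) ((A' ⊗ᵍ B) ⊗ᵍ (D' ⊗ᵍ C))))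

/-- The crossing `(1 ⊗ β ⊗ 1) ∘ (1 ⊗ 1 ⊗ f ⊗ g) ≅ (1 ⊗ f ⊗ 1 ⊗ g) ∘ (1 ⊗ β ⊗ 1)`, given by the
interchanger of `β` and `g` and by the pseudonaturality of `β` at `f`. -/
def midRight (A D : V) {B B' C C' : V} (f : B ⟶ B') (g : C ⟶ C') :
    (A ⊗ᵍ D) ◃ (f ⊗₁ g) ≫ mid A D B' C' ≅ mid A D B C ≫ (A ◃ f) ⊗₁ (D ◃ g) :=
  castIso (
    whiskerIso (cst ((A ⊗ᵍ D) ⊗ᵍ (B ⊗ᵍ C)) (A ⊗ᵍ (D ⊗ᵍ B) ⊗ᵍ C) ≫ A ◃ ((D ◃ f) ▹ C))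
      (tensorLeftIso A (interchanger (β D B') g))
      (cst (A ⊗ᵍ (B' ⊗ᵍ D) ⊗ᵍ C') ((A ⊗ᵍ B') ⊗ᵍ (D ⊗ᵍ C'))) ⊚ᵢ
    whiskerIso (cst ((A ⊗ᵍ D) ⊗ᵍ (B ⊗ᵍ C)) (A ⊗ᵍ (D ⊗ᵍ B) ⊗ᵍ C))
      (tensorLeftIso A (tensorRightIso (βr D f) C))
      (A ◃ (B' ⊗ᵍ D) ◃ g ≫ cst (A ⊗ᵍ (B' ⊗ᵍ D) ⊗ᵍ C') ((A ⊗ᵍ B') ⊗ᵍ (D ⊗ᵍ C'))))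

/-- The 2-cell built from `1 ⊗ 1 ⊗ S ⊗ 1`, the interchanger of two braidings, and
`1 ⊗ R⁻¹ ⊗ 1 ⊗ 1`, relating the two ways of bringing `A₃ D₃ A₂ D₂ A₁ D₁` into the order
`A₃ A₂ A₁ D₃ D₂ D₁`. -/
def midAssoc (A₃ D₃ A₂ D₂ A₁ D₁ : V) :
    mid A₃ D₃ A₂ D₂ ▹ (A₁ ⊗ᵍ D₁) ≫ mid (A₃ ⊗ᵍ A₂) (D₃ ⊗ᵍ D₂) A₁ D₁ ≅
      cst (((A₃ ⊗ᵍ D₃) ⊗ᵍ (A₂ ⊗ᵍ D₂)) ⊗ᵍ (A₁ ⊗ᵍ D₁))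
          ((A₃ ⊗ᵍ D₃) ⊗ᵍ ((A₂ ⊗ᵍ D₂) ⊗ᵍ (A₁ ⊗ᵍ D₁))) ≫
        (A₃ ⊗ᵍ D₃) ◃ mid A₂ D₂ A₁ D₁ ≫ mid A₃ D₃ (A₂ ⊗ᵍ A₁) (D₂ ⊗ᵍ D₁) ≫
        cst ((A₃ ⊗ᵍ (A₂ ⊗ᵍ A₁)) ⊗ᵍ (D₃ ⊗ᵍ (D₂ ⊗ᵍ D₁)))
          (((A₃ ⊗ᵍ A₂) ⊗ᵍ A₁) ⊗ᵍ ((D₃ ⊗ᵍ D₂) ⊗ᵍ D₁)) :=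
  castIso (
    whiskerIso (mid A₃ D₃ A₂ D₂ ▹ (A₁ ⊗ᵍ D₁) ≫
        cst (((A₃ ⊗ᵍ A₂) ⊗ᵍ (D₃ ⊗ᵍ D₂)) ⊗ᵍ (A₁ ⊗ᵍ D₁))
          ((A₃ ⊗ᵍ A₂) ⊗ᵍ ((D₃ ⊗ᵍ D₂) ⊗ᵍ A₁) ⊗ᵍ D₁))
      (tensorLeftIso (A₃ ⊗ᵍ A₂) (tensorRightIso (S D₃ D₂ A₁) D₁))
      (cst ((A₃ ⊗ᵍ A₂) ⊗ᵍ (A₁ ⊗ᵍ D₃ ⊗ᵍ D₂) ⊗ᵍ D₁)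
        (((A₃ ⊗ᵍ A₂) ⊗ᵍ A₁) ⊗ᵍ ((D₃ ⊗ᵍ D₂) ⊗ᵍ D₁))) ⊚ᵢ
    whiskerIso (cst (((A₃ ⊗ᵍ D₃) ⊗ᵍ (A₂ ⊗ᵍ D₂)) ⊗ᵍ (A₁ ⊗ᵍ D₁))
        (A₃ ⊗ᵍ ((D₃ ⊗ᵍ A₂) ⊗ᵍ (D₂ ⊗ᵍ A₁)) ⊗ᵍ D₁))
      (tensorLeftIso A₃ (tensorRightIso (interchanger (β D₃ A₂) (β D₂ A₁)).symm D₁))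
      (cst (A₃ ⊗ᵍ ((A₂ ⊗ᵍ D₃) ⊗ᵍ (A₁ ⊗ᵍ D₂)) ⊗ᵍ D₁)
          ((A₃ ⊗ᵍ A₂) ⊗ᵍ (((D₃ ⊗ᵍ A₁) ⊗ᵍ D₂) ⊗ᵍ D₁)) ≫
        (A₃ ⊗ᵍ A₂) ◃ (β D₃ A₁ ▹ D₂ ▹ D₁) ≫
        cst ((A₃ ⊗ᵍ A₂) ⊗ᵍ (((A₁ ⊗ᵍ D₃) ⊗ᵍ D₂) ⊗ᵍ D₁))
          (((A₃ ⊗ᵍ A₂) ⊗ᵍ A₁) ⊗ᵍ ((D₃ ⊗ᵍ D₂) ⊗ᵍ D₁))) ⊚ᵢ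
    whiskerIso (cst (((A₃ ⊗ᵍ D₃) ⊗ᵍ (A₂ ⊗ᵍ D₂)) ⊗ᵍ (A₁ ⊗ᵍ D₁))
          (A₃ ⊗ᵍ ((D₃ ⊗ᵍ A₂) ⊗ᵍ (D₂ ⊗ᵍ A₁)) ⊗ᵍ D₁) ≫
        A₃ ◃ (((D₃ ⊗ᵍ A₂) ◃ β D₂ A₁) ▹ D₁) ≫
        cst (A₃ ⊗ᵍ ((D₃ ⊗ᵍ A₂) ⊗ᵍ (A₁ ⊗ᵍ D₂)) ⊗ᵍ D₁)
          (A₃ ⊗ᵍ (D₃ ⊗ᵍ A₂ ⊗ᵍ A₁) ⊗ᵍ (D₂ ⊗ᵍ D₁)))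
      (tensorLeftIso A₃ (tensorRightIso (R D₃ A₂ A₁).symm (D₂ ⊗ᵍ D₁)))
      (cst (A₃ ⊗ᵍ ((A₂ ⊗ᵍ A₁) ⊗ᵍ D₃) ⊗ᵍ (D₂ ⊗ᵍ D₁))
          (((A₃ ⊗ᵍ A₂) ⊗ᵍ A₁) ⊗ᵍ ((D₃ ⊗ᵍ D₂) ⊗ᵍ D₁))))

/-- The composition of a tensor product: for `m : A₂ ⊗ A₁ ⟶ A` and `n : D₂ ⊗ D₁ ⟶ D`, the 1-cell
`(m ⊗ n) ∘ (1 ⊗ β ⊗ 1) : A₂ ⊗ D₂ ⊗ A₁ ⊗ D₁ ⟶ A ⊗ D`. -/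
def compTensor {A₂ A₁ A D₂ D₁ D : V} (m : A₂ ⊗ᵍ A₁ ⟶ A) (n : D₂ ⊗ᵍ D₁ ⟶ D) :
    (A₂ ⊗ᵍ D₂) ⊗ᵍ (A₁ ⊗ᵍ D₁) ⟶ A ⊗ᵍ D :=
  mid A₂ D₂ A₁ D₁ ≫ m ⊗₁ n

/-- The unit of a tensor product: `u ⊗ v : 𝕀 = 𝕀 ⊗ 𝕀 ⟶ A ⊗ D`. -/
def unitTensor {A D : V} (u : 𝕀 ⟶ A) (v : 𝕀 ⟶ D) : 𝕀 ⟶ A ⊗ᵍ D :=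
  cst 𝕀 (𝕀 ⊗ᵍ 𝕀) ≫ u ⊗₁ v

attribute [local simp] compTensor unitTensor

/-- The associator of a tensor product. With `m̲` denoting tensor product compositions, it is the
composite 2-cell from `m̲ ∘ (m̲ ⊗ 1)` to `m̲ ∘ (1 ⊗ m̲)` of: the crossing of `m ⊗ n ⊗ 1 ⊗ 1` and
`1 ⊗ β ⊗ 1`; `α ⊗ γ`; the cells `S`, `R⁻¹` with an interchanger between them; and the inverse
crossing of `1 ⊗ β ⊗ 1` and `1 ⊗ 1 ⊗ m ⊗ n`. -/
def assocTensor {A₃ A₂ A₁ A₃₂ A₂₁ A D₃ D₂ D₁ D₃₂ D₂₁ D : V}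
    {m₃₂ : A₃ ⊗ᵍ A₂ ⟶ A₃₂} {m : A₃₂ ⊗ᵍ A₁ ⟶ A} {m₂₁ : A₂ ⊗ᵍ A₁ ⟶ A₂₁} {m' : A₃ ⊗ᵍ A₂₁ ⟶ A}
    {n₃₂ : D₃ ⊗ᵍ D₂ ⟶ D₃₂} {n : D₃₂ ⊗ᵍ D₁ ⟶ D} {n₂₁ : D₂ ⊗ᵍ D₁ ⟶ D₂₁} {n' : D₃ ⊗ᵍ D₂₁ ⟶ D}
    (α : m₃₂ ▹ A₁ ≫ m ≅ cst ((A₃ ⊗ᵍ A₂) ⊗ᵍ A₁) (A₃ ⊗ᵍ A₂ ⊗ᵍ A₁) ≫ A₃ ◃ m₂₁ ≫ m')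
    (γ : n₃₂ ▹ D₁ ≫ n ≅ cst ((D₃ ⊗ᵍ D₂) ⊗ᵍ D₁) (D₃ ⊗ᵍ D₂ ⊗ᵍ D₁) ≫ D₃ ◃ n₂₁ ≫ n') :
    compTensor m₃₂ n₃₂ ▹ (A₁ ⊗ᵍ D₁) ≫ compTensor m n ≅
      cst (((A₃ ⊗ᵍ D₃) ⊗ᵍ (A₂ ⊗ᵍ D₂)) ⊗ᵍ (A₁ ⊗ᵍ D₁))
          ((A₃ ⊗ᵍ D₃) ⊗ᵍ (A₂ ⊗ᵍ D₂) ⊗ᵍ (A₁ ⊗ᵍ D₁)) ≫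
        (A₃ ⊗ᵍ D₃) ◃ compTensor m₂₁ n₂₁ ≫ compTensor m' n' :=
  castIso (
    whiskerIso (mid A₃ D₃ A₂ D₂ ▹ (A₁ ⊗ᵍ D₁)) (midLeft m₃₂ n₃₂ A₁ D₁) (m ⊗₁ n) ⊚ᵢ
    whiskerIso (mid A₃ D₃ A₂ D₂ ▹ (A₁ ⊗ᵍ D₁) ≫ mid (A₃ ⊗ᵍ A₂) (D₃ ⊗ᵍ D₂) A₁ D₁)
      (tensorHomComp (m₃₂ ▹ A₁) m (n₃₂ ▹ D₁) n ≪≫ tensorIso α γ) (𝟙 (A ⊗ᵍ D)) ⊚ᵢ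
    whiskerIso (𝟙 (((A₃ ⊗ᵍ D₃) ⊗ᵍ (A₂ ⊗ᵍ D₂)) ⊗ᵍ (A₁ ⊗ᵍ D₁))) (midAssoc A₃ D₃ A₂ D₂ A₁ D₁)
      ((cst ((A₃ ⊗ᵍ A₂) ⊗ᵍ A₁) (A₃ ⊗ᵍ A₂ ⊗ᵍ A₁) ≫ A₃ ◃ m₂₁ ≫ m') ⊗₁
        (cst ((D₃ ⊗ᵍ D₂) ⊗ᵍ D₁) (D₃ ⊗ᵍ D₂ ⊗ᵍ D₁) ≫ D₃ ◃ n₂₁ ≫ n')) ⊚ᵢ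
    whiskerIso (cst (((A₃ ⊗ᵍ D₃) ⊗ᵍ (A₂ ⊗ᵍ D₂)) ⊗ᵍ (A₁ ⊗ᵍ D₁))
          ((A₃ ⊗ᵍ D₃) ⊗ᵍ (A₂ ⊗ᵍ D₂) ⊗ᵍ (A₁ ⊗ᵍ D₁)) ≫
        (A₃ ⊗ᵍ D₃) ◃ mid A₂ D₂ A₁ D₁ ≫ mid A₃ D₃ (A₂ ⊗ᵍ A₁) (D₂ ⊗ᵍ D₁))
      (tensorHomComp (A₃ ◃ m₂₁) m' (D₃ ◃ n₂₁) n').symm (𝟙 (A ⊗ᵍ D)) ⊚ᵢ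
    whiskerIso (cst (((A₃ ⊗ᵍ D₃) ⊗ᵍ (A₂ ⊗ᵍ D₂)) ⊗ᵍ (A₁ ⊗ᵍ D₁))
          ((A₃ ⊗ᵍ D₃) ⊗ᵍ (A₂ ⊗ᵍ D₂) ⊗ᵍ (A₁ ⊗ᵍ D₁)) ≫
        (A₃ ⊗ᵍ D₃) ◃ mid A₂ D₂ A₁ D₁)
      (midRight A₃ D₃ m₂₁ n₂₁).symm (m' ⊗₁ n'))

variable [SemistrictBraided V]

open SemistrictBraided in
attribute [local simp] β_unit unit_β

/-- The left unitor of a tensor product: the crossing of `u ⊗ v ⊗ 1 ⊗ 1` and `1 ⊗ β ⊗ 1`, followed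
by `l ⊗ k` and by the identity 2-cell that removes the braiding with the unit object. -/
def leftUnitorTensor {A A' D D' : V} {u : 𝕀 ⟶ A'} {m : A' ⊗ᵍ A ⟶ A} {v : 𝕀 ⟶ D'}
    {n : D' ⊗ᵍ D ⟶ D} (l : u ▹ A ≫ m ≅ cst (𝕀 ⊗ᵍ A) A) (k : v ▹ D ≫ n ≅ cst (𝕀 ⊗ᵍ D) D) :
    unitTensor u v ▹ (A ⊗ᵍ D) ≫ compTensor m n ≅ cst (𝕀 ⊗ᵍ A ⊗ᵍ D) (A ⊗ᵍ D) :=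
  castIso (
    whiskerIso (cst (𝕀 ⊗ᵍ A ⊗ᵍ D) ((𝕀 ⊗ᵍ 𝕀) ⊗ᵍ A ⊗ᵍ D)) (midLeft u v A D) (m ⊗₁ n) ⊚ᵢ
    whiskerIso (cst (𝕀 ⊗ᵍ A ⊗ᵍ D) ((𝕀 ⊗ᵍ 𝕀) ⊗ᵍ A ⊗ᵍ D) ≫ mid 𝕀 𝕀 A D)
      (tensorHomComp (u ▹ A) m (v ▹ D) n ≪≫ tensorIso l k) (𝟙 (A ⊗ᵍ D)))

/-- The right unitor of a tensor product: the crossing of `1 ⊗ 1 ⊗ u ⊗ v` and `1 ⊗ β ⊗ 1`, followed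
by `r ⊗ k` and by the identity 2-cell that removes the braiding with the unit object. -/
def rightUnitorTensor {A A' D D' : V} {u : 𝕀 ⟶ A'} {m : A ⊗ᵍ A' ⟶ A} {v : 𝕀 ⟶ D'}
    {n : D ⊗ᵍ D' ⟶ D} (r : A ◃ u ≫ m ≅ cst (A ⊗ᵍ 𝕀) A) (k : D ◃ v ≫ n ≅ cst (D ⊗ᵍ 𝕀) D) :
    (A ⊗ᵍ D) ◃ unitTensor u v ≫ compTensor m n ≅ cst ((A ⊗ᵍ D) ⊗ᵍ 𝕀) (A ⊗ᵍ D) :=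
  castIso (
    whiskerIso (cst ((A ⊗ᵍ D) ⊗ᵍ 𝕀) ((A ⊗ᵍ D) ⊗ᵍ (𝕀 ⊗ᵍ 𝕀))) (midRight A D u v) (m ⊗₁ n) ⊚ᵢ
    whiskerIso (cst ((A ⊗ᵍ D) ⊗ᵍ 𝕀) ((A ⊗ᵍ D) ⊗ᵍ (𝕀 ⊗ᵍ 𝕀)) ≫ mid A D 𝕀 𝕀)
      (tensorHomComp (A ◃ u) m (D ◃ v) n ≪≫ tensorIso r k) (𝟙 (A ⊗ᵍ D)))

/-- The tensor product `B ⊗ C` of the data of two `V`-bicategories. -/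
def VBicategoryData.tensor (B : VBicategoryData.{w, v, u, u₁} V)
    (C : VBicategoryData.{w, v, u, u₂} V) : VBicategoryData.{w, v, u, max u₁ u₂} V where
  Obj := B.Obj × C.Obj
  Hom x y := B.Hom x.1 y.1 ⊗ᵍ C.Hom x.2 y.2
  m x y z := compTensor (B.m x.1 y.1 z.1) (C.m x.2 y.2 z.2)
  u x := unitTensor (B.u x.1) (C.u x.2)
  α x y z t := assocTensor (B.α x.1 y.1 z.1 t.1) (C.α x.2 y.2 z.2 t.2)
  l x y := leftUnitorTensor (B.l x.1 y.1) (C.l x.2 y.2)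
  r x y := rightUnitorTensor (B.r x.1 y.1) (C.r x.2 y.2)

end VBicategory

/-!
A semi-strict braided monoidal bicategory is replaced by a model in which the tensor product of
objects and the composition and whiskering of 1-cells are associative and unital by definition:
objects are operators `A ⊗ -` and 1-cells are precomposition operators. The coherence conditions
of a tensor product of `V`-bicategories are proved in the model, and the predicates `Rep1` and
`Rep2` relate cells of the model to cells of `V`.
-/

/-! Write `χ = 1β1` for the middle exchange and `T` for the tensor product of two 1-cells. A
composition in `B ⊗ C` is an exchange followed by a `T`, so the iterated compositions in (IC) and
(AC) interleave exchanges with `T`s. Pseudonaturality of `β`, together with interchangers, gives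
crossings `chl` and `chr` that carry a `T` past an exchange. After enough crossings every iterated
composition consists of exchanges only, followed by `T`s only.

In this sorted form the associator `al` splits into two independent cells. One is `om`, made of `S`,
an interchanger of braidings and `R⁻¹`; it acts on the exchanges. The other is `Th`, made of `α ⊗ α`
and the interchangers around it; it acts on the `T`s. The splitting is proved for each of the five
associators of the pentagon in `al_moveRL`, `al_moveLR`, `al_moveRR`, `al_movePairL` and
`al_moveRR'`; it rests on `om` being natural (`om_nat₁`, `om_nat₂`, `om_nat₃`). The interchanger of
two compositions splits in the same manner (`movePairL_movePairR`), by compatibility of the left and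
right crossings (`chl_chr`).

Cells acting on disjoint parts of a 1-cell commute, so (AC) for `B ⊗ C` separates into two
equations. The equation between exchanges, `om_cocycle`, involves braidings only and follows from
BA1, BA2 and BA3. The equation between `T`s, `Th_hexagon`, is (AC) in `B` and in `C`, one tensor
factor at a time.

(IC) is treated alike in `al_triangle`: the `T`s contribute (IC) of the two factors (`Th_triangle`),
and the comparison `om` is taken with the unit object as middle pair, where semi-strictness makes it
an identity.

These computations would be buried under coherence equalities if made in `V` itself. They are made
in a model whose objects and 1-cells are operators, so that associativity, unitality and
functoriality of tensoring 1-cells with objects hold by definition. `Rep2.heq_iff` carries the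
axioms of `V` into the model and the conclusion back. -/

section StrictModel

set_option linter.unusedSectionVars false

open GrayMonoid

/-! ### Objects and 1-cells of the strict model. -/

section

/-- An object of the strict model: a left multiplication operator `A ⊗ -`. -/
structure Ob (V : Type u) [Bicategory.{w, v} V] [Bicategory.Strict V] [GrayMonoid V] where
  fn : V → V
  fn_eq : ∀ X, fn X = fn 𝕀 ⊗ᵍ X

variable {V : Type u} [Bicategory.{w, v} V] [Bicategory.Strict V] [GrayMonoid V]

namespace Ob

/-- The underlying object. -/
def obj (P : Ob V) : V := P.fn 𝕀

/-- Operators multiply by composition, so `(P * Q) * S` and `P * (Q * S)`, or `1 * P` and `P`, agree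
by definition. This is the gain over the objects of `V`. -/
instance : Mul (Ob V) :=
  ⟨fun P Q => ⟨fun X => P.fn (Q.fn X), fun X => by
    rw [P.fn_eq, Q.fn_eq, P.fn_eq (Q.fn 𝕀), tensor_assoc]⟩⟩

instance : One (Ob V) := ⟨⟨fun X => X, fun X => (unit_tensor X).symm⟩⟩

theorem obj_mul (P Q : Ob V) : (P * Q).obj = P.obj ⊗ᵍ Q.obj := P.fn_eq (Q.fn 𝕀)

theorem obj_one : (1 : Ob V).obj = 𝕀 := rfl

/-- The operator `A ⊗ -`. -/
def of (A : V) : Ob V := ⟨fun X => A ⊗ᵍ X, fun X => by rw [tensor_unit]⟩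

theorem obj_of (A : V) : (of A).obj = A := tensor_unit A

theorem obj_mul₃ (R P S : Ob V) : (R * (P * S)).obj = R.obj ⊗ᵍ (P.obj ⊗ᵍ S.obj) := by
  rw [obj_mul, obj_mul]

end Ob

theorem tensorLeft_heq {A A' B B' C C' : V} {f : B ⟶ C} {f' : B' ⟶ C'} (hA : A = A')
    (hB : B = B') (hC : C = C') (hf : f ≍ f') : A ◃ f ≍ A' ◃ f' := by
  subst hA hB hC; obtain rfl := eq_of_heq hf; rfl

theorem tensorRight_heq {A A' B B' C C' : V} {f : B ⟶ C} {f' : B' ⟶ C'} (hA : A = A')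
    (hB : B = B') (hC : C = C') (hf : f ≍ f') : f ▹ A ≍ f' ▹ A' := by
  subst hA hB hC; obtain rfl := eq_of_heq hf; rfl

theorem comp_heq {A A' B B' C C' : V} {f : A ⟶ B} {g : B ⟶ C} {f' : A' ⟶ B'} {g' : B' ⟶ C'}
    (hA : A = A') (hB : B = B') (hC : C = C') (hf : f ≍ f') (hg : g ≍ g') :
    f ≫ g ≍ f' ≫ g' := by
  subst hA hB hC; obtain rfl := eq_of_heq hf; obtain rfl := eq_of_heq hg; rfl

theorem eqToHom_heq {A B C : V} (h : A = B) (hC : A = C) : eqToHom h ≍ 𝟙 C := by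
  subst h hC; rfl

/-- The 1-cell `R ⊗ f ⊗ S` between operators. -/
def layer (R S : Ob V) {P Q : Ob V} (f : P.obj ⟶ Q.obj) : (R * (P * S)).obj ⟶ (R * (Q * S)).obj :=
  eqToHom (Ob.obj_mul₃ R P S) ≫ R.obj ◃ (f ▹ S.obj) ≫ eqToHom (Ob.obj_mul₃ R Q S).symm

theorem conj_heq {A B A' B' : V} (hA : A' = A) (hB : B = B') (f : A ⟶ B) :
    eqToHom hA ≫ f ≫ eqToHom hB ≍ f := by
  subst hA hB; simp

theorem layer_heq (R S : Ob V) {P Q : Ob V} (f : P.obj ⟶ Q.obj) :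
    layer R S f ≍ R.obj ◃ (f ▹ S.obj) := conj_heq _ _ _

theorem layer_comp (R S : Ob V) {P Q T : Ob V} (f : P.obj ⟶ Q.obj) (g : Q.obj ⟶ T.obj) :
    layer R S (f ≫ g) = layer R S f ≫ layer R S g := by
  simp [layer, tensorLeft_comp, tensorRight_comp]

theorem layer_id (R S P : Ob V) : layer R S (𝟙 P.obj) = 𝟙 _ := by
  simp [layer, tensorLeft_id, tensorRight_id]

/-- Strict associativity of tensoring 1-cells in `V` is spent here once, so that in `Hom1.lay`
nested tensoring is mere reindexing. -/
theorem layer_layer (R S R' S' : Ob V) {P Q : Ob V} (f : P.obj ⟶ Q.obj) :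
    layer (P := R' * (P * S')) (Q := R' * (Q * S')) R S (layer R' S' f) =
      layer (R * R') (S' * S) f := by
  refine eq_of_heq ((layer_heq _ _ _).trans (HEq.trans ?_ (layer_heq _ _ _).symm))
  refine (tensorLeft_heq rfl ?_ ?_ (tensorRight_heq rfl ?_ ?_ (layer_heq _ _ _))).trans ?_
  · rw [Ob.obj_mul₃]
  · rw [Ob.obj_mul₃]
  · rw [Ob.obj_mul₃]
  · rw [Ob.obj_mul₃]
  refine (tensorLeft_heq rfl ?_ ?_ (tensorRight_tensorLeft _ _ _)).trans ?_
  · rw [tensor_assoc]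
  · rw [tensor_assoc]
  refine (tensorLeft_tensorLeft _ _ _).symm.trans ?_
  refine tensorLeft_heq (Ob.obj_mul _ _).symm ?_ ?_ ?_
  · rw [Ob.obj_mul, tensor_assoc]
  · rw [Ob.obj_mul, tensor_assoc]
  exact (tensorRight_tensorRight _ _ _).symm.trans
    (tensorRight_heq (Ob.obj_mul _ _).symm rfl rfl HEq.rfl)

theorem layer_one {P Q : Ob V} (f : P.obj ⟶ Q.obj) : layer 1 1 f = f := by
  refine eq_of_heq ((layer_heq _ _ _).trans ((unit_tensorLeft _).trans (tensorRight_unit _)))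

/-- A 1-cell of the strict model: a precomposition operator. -/
@[ext]
structure Hom1 (P Q : Ob V) where
  -- The flanking objects belong to the data so that `R ⊗ f ⊗ S` is a reindexing of `f` and commutes
  -- with composition by definition.
  fn : ∀ (R S : Ob V) {Z : V}, ((R * (Q * S)).obj ⟶ Z) → ((R * (P * S)).obj ⟶ Z)
  -- No new 1-cells arise: an operator is determined by its value at the identity with trivial
  -- flanks.
  fn_eq : ∀ (R S : Ob V) {Z : V} (k : (R * (Q * S)).obj ⟶ Z),
    fn R S k = layer R S (P := P) (Q := Q) (fn 1 1 (𝟙 _)) ≫ k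

namespace Hom1

/-- The underlying 1-cell. -/
def eval {P Q : Ob V} (f : Hom1 P Q) : P.obj ⟶ Q.obj := f.fn 1 1 (𝟙 _)

theorem fn_eq' {P Q : Ob V} (f : Hom1 P Q) (R S : Ob V) {Z : V} (k : (R * (Q * S)).obj ⟶ Z) :
    f.fn R S k = layer R S f.eval ≫ k := f.fn_eq R S k

/-- The 1-cell of the strict model given by a 1-cell. -/
def mk' {P Q : Ob V} (f : P.obj ⟶ Q.obj) : Hom1 P Q :=
  ⟨fun R S _ k => layer R S f ≫ k, fun R S Z k => by rw [Category.comp_id, layer_one]⟩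

theorem eval_mk' {P Q : Ob V} (f : P.obj ⟶ Q.obj) : (mk' f).eval = f := by
  change layer 1 1 f ≫ 𝟙 _ = f
  rw [Category.comp_id, layer_one]

/-- Identity 1-cells. -/
@[reducible]
def one (P : Ob V) : Hom1 P P :=
  ⟨fun _ _ _ k => k, fun R S _ k =>
    ((Category.id_comp k).symm.trans (congrArg (· ≫ k) (layer_id R S P).symm))⟩

/-- Composition of 1-cells, in diagrammatic order. -/
@[reducible] def comp {P Q T : Ob V} (f : Hom1 P Q) (g : Hom1 Q T) : Hom1 P T :=
  ⟨fun R S _ k => f.fn R S (g.fn R S k), fun R S Z k => by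
    rw [f.fn_eq' R S, g.fn_eq' R S, f.fn_eq' 1 1, g.fn_eq' 1 1, Category.comp_id, layer_one,
      layer_one, layer_comp, Category.assoc]⟩

/-- The 1-cell `R ⊗ f ⊗ S`. -/
@[reducible] def lay (R : Ob V) {P Q : Ob V} (f : Hom1 P Q) (S : Ob V) :
    Hom1 (R * (P * S)) (R * (Q * S)) :=
  ⟨fun R' S' _ k => f.fn (R' * R) (S * S') k, fun R' S' Z k => by
    refine (f.fn_eq' _ _ _).trans (congrArg (· ≫ k) ?_)
    refine (layer_layer R' S' R S f.eval).symm.trans ?_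
    congr 1
    refine Eq.trans ?_ (f.fn_eq' _ _ _).symm
    exact (Category.comp_id _).symm⟩

end Hom1

infixr:70 " ⨾ " => Hom1.comp

namespace Hom1

theorem eval_comp {P Q T : Ob V} (f : Hom1 P Q) (g : Hom1 Q T) :
    (f ⨾ g).eval = f.eval ≫ g.eval := by
  refine (f.fn_eq' 1 1 _).trans ?_
  rw [layer_one]; rfl

theorem eval_lay (R S : Ob V) {P Q : Ob V} (f : Hom1 P Q) :
    (lay R f S).eval = layer R S f.eval :=
  (f.fn_eq' _ _ _).trans (Category.comp_id _)

/-- The 2-cells are those of `V`; only objects and 1-cells are strictified. -/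
instance (P Q : Ob V) : Category (Hom1 P Q) where
  Hom f g := f.eval ⟶ g.eval
  id f := 𝟙 f.eval
  comp η θ := η ≫ θ
  id_comp η := Category.id_comp (obj := P.obj ⟶ Q.obj) η
  comp_id η := Category.comp_id (obj := P.obj ⟶ Q.obj) η
  assoc η θ ι := Category.assoc (obj := P.obj ⟶ Q.obj) η θ ι

end Hom1

end

/-! ### Comparison of cells of the model with cells of `V`. -/

section

section Heq

variable {C : Type u} [Category.{v} C]

theorem conj_heq' {a b a' b' : C} (ha : a' = a) (hb : b = b') (f : a ⟶ b) :
    eqToHom ha ≫ f ≫ eqToHom hb ≍ f := by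
  subst ha hb; simp

theorem vcomp_heq {V : Type u} [Bicategory.{w, v} V] {X Y X' Y' : V} {f g h : X ⟶ Y}
    {f' g' h' : X' ⟶ Y'} {η : f ⟶ g} {θ : g ⟶ h} {η' : f' ⟶ g'} {θ' : g' ⟶ h'}
    (hX : X = X') (hY : Y = Y') (hf : f ≍ f') (hg : g ≍ g') (hh : h ≍ h') (hη : η ≍ η')
    (hθ : θ ≍ θ') : η ≫ θ ≍ η' ≫ θ' := by
  subst hX hY
  obtain rfl := eq_of_heq hf; obtain rfl := eq_of_heq hg; obtain rfl := eq_of_heq hh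
  obtain rfl := eq_of_heq hη; obtain rfl := eq_of_heq hθ; rfl

theorem id₂_heq {V : Type u} [Bicategory.{w, v} V] {X Y X' Y' : V} {f : X ⟶ Y} {f' : X' ⟶ Y'}
    (hX : X = X') (hY : Y = Y') (hf : f ≍ f') : 𝟙 f ≍ 𝟙 f' := by
  subst hX hY; obtain rfl := eq_of_heq hf; rfl

theorem whisker_heq {V : Type u} [Bicategory.{w, v} V] {W X Y Z W' X' Y' Z' : V}
    {p : W ⟶ X} {p' : W' ⟶ X'} {f g : X ⟶ Y} {f' g' : X' ⟶ Y'} {q : Y ⟶ Z} {q' : Y' ⟶ Z'}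
    {η : f ⟶ g} {η' : f' ⟶ g'} (hW : W = W') (hX : X = X') (hY : Y = Y') (hZ : Z = Z')
    (hp : p ≍ p') (hf : f ≍ f') (hg : g ≍ g') (hη : η ≍ η') (hq : q ≍ q') :
    whisker p η q ≍ whisker p' η' q' := by
  subst hW hX hY hZ
  obtain rfl := eq_of_heq hf; obtain rfl := eq_of_heq hg; obtain rfl := eq_of_heq hp
  obtain rfl := eq_of_heq hη; obtain rfl := eq_of_heq hq; rfl

variable {V : Type u} [Bicategory.{w, v} V] [Bicategory.Strict V]

theorem id_whiskerLeft_heq {X Y : V} {f g : X ⟶ Y} (η : f ⟶ g) : 𝟙 X ◁ η ≍ η := by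
  rw [id_whiskerLeft, Strict.leftUnitor_eqToIso, Strict.leftUnitor_eqToIso]
  exact conj_heq' (by simp) (by simp) _

theorem whiskerRight_id_heq {X Y : V} {f g : X ⟶ Y} (η : f ⟶ g) : η ▷ 𝟙 Y ≍ η := by
  rw [whiskerRight_id, Strict.rightUnitor_eqToIso, Strict.rightUnitor_eqToIso]
  exact conj_heq' (by simp) (by simp) _

theorem comp_whiskerLeft_heq {W X Y Z : V} (a : W ⟶ X) (b : X ⟶ Y) {f g : Y ⟶ Z} (η : f ⟶ g) :
    (a ≫ b) ◁ η ≍ a ◁ b ◁ η := by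
  rw [comp_whiskerLeft, Strict.associator_eqToIso, Strict.associator_eqToIso]
  exact conj_heq' (by simp) (by simp) _

theorem whiskerRight_comp_heq {W X Y Z : V} (a : X ⟶ Y) (b : Y ⟶ Z) {f g : W ⟶ X} (η : f ⟶ g) :
    η ▷ (a ≫ b) ≍ (η ▷ a) ▷ b := by
  rw [whiskerRight_comp, Strict.associator_eqToIso, Strict.associator_eqToIso]
  exact conj_heq' (by simp) (by simp) _

theorem whisker_assoc_heq {W X Y Z : V} (a : W ⟶ X) {f g : X ⟶ Y} (η : f ⟶ g) (b : Y ⟶ Z) :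
    (a ◁ η) ▷ b ≍ a ◁ (η ▷ b) := by
  rw [whisker_assoc, Strict.associator_eqToIso, Strict.associator_eqToIso]
  exact conj_heq' (by simp) (by simp) _

theorem whiskerLeft_heq {X Y Z X' Y' Z' : V} {p : X ⟶ Y} {p' : X' ⟶ Y'} {f g : Y ⟶ Z}
    {f' g' : Y' ⟶ Z'} {η : f ⟶ g} {η' : f' ⟶ g'} (hX : X = X') (hY : Y = Y') (hZ : Z = Z')
    (hp : p ≍ p') (hf : f ≍ f') (hg : g ≍ g') (hη : η ≍ η') : p ◁ η ≍ p' ◁ η' := by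
  subst hX hY hZ
  obtain rfl := eq_of_heq hf; obtain rfl := eq_of_heq hg; obtain rfl := eq_of_heq hp
  obtain rfl := eq_of_heq hη; rfl

/-- Nested whiskerings differ from a single one by associators, which are `eqToHom`s in a strict
2-category and so are absorbed by heterogeneous equality. -/
theorem whisker_whisker_heq {W X Y Z W' Z' : V} (p' : W' ⟶ W) (p : W ⟶ X) {f g : X ⟶ Y}
    (η : f ⟶ g) (q : Y ⟶ Z) (q' : Z ⟶ Z') :
    whisker p' (whisker p η q) q' ≍ whisker (p' ≫ p) η (q ≫ q') := by
  refine HEq.trans ?_ (comp_whiskerLeft_heq _ _ _).symm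
  refine whiskerLeft_heq rfl rfl rfl HEq.rfl (by simp) (by simp) ?_
  refine (whisker_assoc_heq _ _ _).trans ?_
  exact whiskerLeft_heq rfl rfl rfl HEq.rfl (by simp) (by simp)
    (whiskerRight_comp_heq _ _ _).symm

end Heq

theorem tensorLeft₂_heq {V : Type u} [Bicategory.{w, v} V] [Bicategory.Strict V] [GrayMonoid V]
    {A A' B B' C C' : V} {f g : B ⟶ C} {f' g' : B' ⟶ C'} {η : f ⟶ g} {η' : f' ⟶ g'} (hA : A = A')
    (hB : B = B') (hC : C = C') (hf : f ≍ f') (hg : g ≍ g') (hη : η ≍ η') :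
    A ◃₂ η ≍ A' ◃₂ η' := by
  subst hA hB hC; obtain rfl := eq_of_heq hf; obtain rfl := eq_of_heq hg
  obtain rfl := eq_of_heq hη; rfl

theorem tensorRight₂_heq {V : Type u} [Bicategory.{w, v} V] [Bicategory.Strict V] [GrayMonoid V]
    {A A' B B' C C' : V} {f g : B ⟶ C} {f' g' : B' ⟶ C'} {η : f ⟶ g} {η' : f' ⟶ g'} (hA : A = A')
    (hB : B = B') (hC : C = C') (hf : f ≍ f') (hg : g ≍ g') (hη : η ≍ η') :
    η ▹₂ A ≍ η' ▹₂ A' := by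
  subst hA hB hC; obtain rfl := eq_of_heq hf; obtain rfl := eq_of_heq hg
  obtain rfl := eq_of_heq hη; rfl

theorem interchanger_heq {V : Type u} [Bicategory.{w, v} V] [Bicategory.Strict V] [GrayMonoid V]
    {A₁ A₂ B₁ B₂ A₁' A₂' B₁' B₂' : V} {f : A₁ ⟶ A₂} {g : B₁ ⟶ B₂} {f' : A₁' ⟶ A₂'} {g' : B₁' ⟶ B₂'}
    (h₁ : A₁ = A₁') (h₂ : A₂ = A₂') (h₃ : B₁ = B₁') (h₄ : B₂ = B₂') (hf : f ≍ f') (hg : g ≍ g') :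
    (interchanger f g).hom ≍ (interchanger f' g').hom := by
  subst h₁ h₂ h₃ h₄; obtain rfl := eq_of_heq hf; obtain rfl := eq_of_heq hg; rfl

variable {V : Type u} [Bicategory.{w, v} V] [Bicategory.Strict V] [GrayMonoid V]

/-- `p` is the 1-cell underlying `F`, up to equality of objects. -/
structure Rep1 {A B : V} {P Q : Ob V} (p : A ⟶ B) (F : Hom1 P Q) : Prop where
  src : A = P.obj
  tgt : B = Q.obj
  heq : p ≍ F.eval

/-- `x` is the 2-cell underlying `y`, up to equality of 1-cells. -/
structure Rep2 {A B : V} {P Q : Ob V} {p q : A ⟶ B} {F G : Hom1 P Q} (x : p ⟶ q) (y : F ⟶ G) :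
    Prop where
  dom : Rep1 p F
  cod : Rep1 q G
  heq : x ≍ (show F.eval ⟶ G.eval from y)

/-- The bridge between `V` and the model. Through `eq_of_rep` it imports the axioms of `V` as
genuine equalities; through `isVBicategory_iff` it translates coherence in both directions. -/
theorem Rep2.heq_iff {A B A' B' : V} {P Q : Ob V} {p q : A ⟶ B} {p' q' : A' ⟶ B'} {F G : Hom1 P Q}
    {x : p ⟶ q} {x' : p' ⟶ q'} {y y' : F ⟶ G} (h : Rep2 x y) (h' : Rep2 x' y') :
    x ≍ x' ↔ y = y' :=
  ⟨fun e => eq_of_heq (h.heq.symm.trans (e.trans h'.heq)),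
    fun e => h.heq.trans (by rw [e]; exact h'.heq.symm)⟩

/-- The 2-cell of the strict model with a given underlying 2-cell. -/
def isoOf {A B : V} {P Q : Ob V} {p q : A ⟶ B} {F G : Hom1 P Q} (hp : Rep1 p F) (hq : Rep1 q G)
    (x : p ≅ q) : F ≅ G where
  hom := cast (by obtain ⟨rfl, rfl, h⟩ := hp; obtain rfl := eq_of_heq h
                  obtain rfl := eq_of_heq hq.heq; rfl) x.hom
  inv := cast (by obtain ⟨rfl, rfl, h⟩ := hp; obtain rfl := eq_of_heq h
                  obtain rfl := eq_of_heq hq.heq; rfl) x.inv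
  hom_inv_id := by
    obtain ⟨rfl, rfl, h⟩ := hp; obtain rfl := eq_of_heq h
    obtain rfl := eq_of_heq hq.heq
    exact x.hom_inv_id
  inv_hom_id := by
    obtain ⟨rfl, rfl, h⟩ := hp; obtain rfl := eq_of_heq h
    obtain rfl := eq_of_heq hq.heq
    exact x.inv_hom_id

theorem rep_isoOf_hom {A B : V} {P Q : Ob V} {p q : A ⟶ B} {F G : Hom1 P Q} (hp : Rep1 p F)
    (hq : Rep1 q G) (x : p ≅ q) : Rep2 x.hom (isoOf hp hq x).hom := ⟨hp, hq, (cast_heq _ _).symm⟩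

/-- The 2-cell of the strict model with a given underlying 2-cell. -/
def homOf {A B : V} {P Q : Ob V} {p q : A ⟶ B} {F G : Hom1 P Q} (hp : Rep1 p F) (hq : Rep1 q G)
    (x : p ⟶ q) : F ⟶ G :=
  cast (by obtain ⟨rfl, rfl, h⟩ := hp; obtain rfl := eq_of_heq h
           obtain rfl := eq_of_heq hq.heq; rfl) x

theorem rep_homOf {A B : V} {P Q : Ob V} {p q : A ⟶ B} {F G : Hom1 P Q} (hp : Rep1 p F)
    (hq : Rep1 q G) (x : p ⟶ q) : Rep2 x (homOf hp hq x) := ⟨hp, hq, (cast_heq _ _).symm⟩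

theorem rep_self₁ {P Q : Ob V} (F : Hom1 P Q) : Rep1 F.eval F := ⟨rfl, rfl, HEq.rfl⟩

theorem rep_self₂ {P Q : Ob V} {F G : Hom1 P Q} (y : F ⟶ G) :
    Rep2 (p := F.eval) (q := G.eval) y y := ⟨rep_self₁ _, rep_self₁ _, HEq.rfl⟩

namespace Rep1

variable {A B C : V} {P Q T : Ob V} {p : A ⟶ B} {q : B ⟶ C} {F : Hom1 P Q} {G : Hom1 Q T}

theorem comp (hp : Rep1 p F) (hq : Rep1 q G) : Rep1 (p ≫ q) (F ⨾ G) :=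
  ⟨hp.src, hq.tgt, (comp_heq hp.src hp.tgt hq.tgt hp.heq hq.heq).trans
    (heq_of_eq (Hom1.eval_comp F G).symm)⟩

theorem cst (P : Ob V) (h : A = B) (hA : A = P.obj) : Rep1 (eqToHom h) (Hom1.one P) :=
  ⟨hA, h ▸ hA, eqToHom_heq h hA⟩

theorem id (P : Ob V) (hA : A = P.obj) : Rep1 (𝟙 A) (Hom1.one P) := cst P rfl hA

theorem tensor (R S : Ob V) {D E : V} (hR : D = R.obj) (hS : E = S.obj) (hp : Rep1 p F) :
    Rep1 (D ◃ (p ▹ E)) (F.lay R S) := by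
  refine ⟨?_, ?_, ?_⟩
  · rw [hR, hS, hp.src, Ob.obj_mul₃]
  · rw [hR, hS, hp.tgt, Ob.obj_mul₃]
  · rw [Hom1.eval_lay]
    refine HEq.trans ?_ (layer_heq _ _ _).symm
    exact tensorLeft_heq hR (by rw [hp.src, hS]) (by rw [hp.tgt, hS])
      (tensorRight_heq hS hp.src hp.tgt hp.heq)

theorem left (R : Ob V) {D : V} (hR : D = R.obj) (hp : Rep1 p F) : Rep1 (D ◃ p) (F.lay R 1) := by
  have h := tensor R 1 hR (Ob.obj_one (V := V)).symm hp
  refine ⟨by rw [← h.src, tensor_unit], by rw [← h.tgt, tensor_unit], ?_⟩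
  exact (tensorLeft_heq rfl (tensor_unit _).symm (tensor_unit _).symm
    (tensorRight_unit p).symm).trans h.heq

theorem right (R : Ob V) {D : V} (hR : D = R.obj) (hp : Rep1 p F) : Rep1 (p ▹ D) (F.lay 1 R) := by
  have h := tensor 1 R (Ob.obj_one (V := V)).symm hR hp
  exact ⟨by rw [← h.src, unit_tensor], by rw [← h.tgt, unit_tensor],
    (unit_tensorLeft _).symm.trans h.heq⟩

end Rep1

namespace Hom1

/-- Whiskering by 1-cells on both sides. -/
def wh {P Q T U : Ob V} (a : Hom1 P Q) {f g : Hom1 Q T} (η : f ⟶ g) (b : Hom1 T U) :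
    a ⨾ f ⨾ b ⟶ a ⨾ g ⨾ b :=
  homOf ((rep_self₁ a).comp ((rep_self₁ f).comp (rep_self₁ b)))
    ((rep_self₁ a).comp ((rep_self₁ g).comp (rep_self₁ b))) (whisker a.eval η b.eval)

/-- The tensor product of a 2-cell with objects on both sides. -/
def ten (R : Ob V) {P Q : Ob V} {f g : Hom1 P Q} (η : f ⟶ g) (S : Ob V) : lay R f S ⟶ lay R g S :=
  homOf ((rep_self₁ f).tensor R S rfl rfl) ((rep_self₁ g).tensor R S rfl rfl)
    (R.obj ◃₂ (η ▹₂ S.obj))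

end Hom1

open Hom1

namespace Rep2

theorem wh {W X Y Z : V} {P Q T U : Ob V} {p : W ⟶ X} {f g : X ⟶ Y} {q : Y ⟶ Z} {η : f ⟶ g}
    {a : Hom1 P Q} {F G : Hom1 Q T} {b : Hom1 T U} {y : F ⟶ G} (hp : Rep1 p a) (hη : Rep2 η y)
    (hq : Rep1 q b) : Rep2 (whisker p η q) (wh a y b) :=
  ⟨hp.comp (hη.dom.comp hq), hp.comp (hη.cod.comp hq),
    (whisker_heq hp.src hp.tgt hq.src hq.tgt hp.heq hη.dom.heq hη.cod.heq hη.heq hq.heq).trans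
      (rep_homOf _ _ _).heq⟩

variable {A B : V} {P Q : Ob V} {p q : A ⟶ B} {F G : Hom1 P Q} {x : p ⟶ q} {y : F ⟶ G}

theorem tensor (R S : Ob V) {D E : V} (hR : D = R.obj) (hS : E = S.obj) (h : Rep2 x y) :
    Rep2 (D ◃₂ (x ▹₂ E)) (ten R y S) := by
  refine ⟨h.dom.tensor R S hR hS, h.cod.tensor R S hR hS, HEq.trans ?_ (rep_homOf _ _ _).heq⟩
  have h₁ := h.dom.src
  have h₂ := h.dom.tgt
  exact tensorLeft₂_heq hR (by rw [h₁, hS]) (by rw [h₂, hS])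
    (tensorRight_heq hS h₁ h₂ h.dom.heq) (tensorRight_heq hS h₁ h₂ h.cod.heq)
    (tensorRight₂_heq hS h₁ h₂ h.dom.heq h.cod.heq h.heq)

theorem left (R : Ob V) {D : V} (hR : D = R.obj) (h : Rep2 x y) : Rep2 (D ◃₂ x) (ten R y 1) := by
  have h' := tensor R 1 hR (Ob.obj_one (V := V)).symm h
  refine ⟨h.dom.left R hR, h.cod.left R hR, ?_⟩
  exact (tensorLeft₂_heq rfl (tensor_unit _).symm (tensor_unit _).symm
    (tensorRight_unit p).symm (tensorRight_unit q).symm (tensorRight₂_unit x).symm).trans h'.heq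

theorem right (R : Ob V) {D : V} (hR : D = R.obj) (h : Rep2 x y) : Rep2 (x ▹₂ D) (ten 1 y R) := by
  have h' := tensor 1 R (Ob.obj_one (V := V)).symm hR h
  exact ⟨h.dom.right R hR, h.cod.right R hR, (unit_tensorLeft₂ _).symm.trans h'.heq⟩

theorem id {P Q : Ob V} {p : A ⟶ B} {F : Hom1 P Q} (h : Rep1 p F) : Rep2 (𝟙 p) (𝟙 F) :=
  ⟨h, h, id₂_heq h.src h.tgt h.heq⟩

theorem comp {r : A ⟶ B} {H : Hom1 P Q} {x' : q ⟶ r} {y' : G ⟶ H} (h : Rep2 x y)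
    (h' : Rep2 x' y') : Rep2 (x ≫ x') (y ≫ y') :=
  ⟨h.dom, h'.cod, vcomp_heq h.dom.src h.dom.tgt h.dom.heq h.cod.heq h'.cod.heq h.heq h'.heq⟩

/-- The two middle 1-cells have the same counterpart `G`, so the `eqToHom` inside `vcomp` leaves no
trace in the model. -/
theorem vcomp {q' r : A ⟶ B} {H : Hom1 P Q} {x' : q' ⟶ r} {y' : G ⟶ H} {e : q = q'}
    (h : Rep2 x y) (h' : Rep2 x' y') : Rep2 (vcomp x x' e) (y ≫ y') := by
  subst e
  have := h.comp h'
  rwa [← Category.id_comp x'] at this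

theorem whiskerLeft {C : V} {T : Ob V} {c : C ⟶ A} {a : Hom1 T P} (hc : Rep1 c a) (h : Rep2 x y) :
    Rep2 (c ◁ x) (Hom1.wh a y (one Q)) := by
  have h' := wh hc h (Rep1.id _ h.dom.tgt)
  refine ⟨hc.comp h.dom, hc.comp h.cod, HEq.trans ?_ h'.heq⟩
  exact whiskerLeft_heq rfl rfl rfl HEq.rfl (by simp) (by simp) (whiskerRight_id_heq x).symm

theorem whiskerRight {C : V} {T : Ob V} {c : B ⟶ C} {a : Hom1 Q T} (h : Rep2 x y) (hc : Rep1 c a) :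
    Rep2 (x ▷ c) (Hom1.wh (one P) y a) := by
  have h' := wh (Rep1.id _ h.dom.src) h hc
  exact ⟨h.dom.comp hc, h.cod.comp hc, (id_whiskerLeft_heq _).symm.trans h'.heq⟩

theorem cast {p' q' : A ⟶ B} {x : p ≅ q} {y : F ⟶ G} {e : p' = p} {e' : q = q'} (h : Rep2 x.hom y) :
    Rep2 (castIso x e e').hom y := by
  subst e e'
  simpa [castIso] using h

theorem inv {x : p ≅ q} {y : F ≅ G} (h : Rep2 x.hom y.hom) : Rep2 x.inv y.inv := by
  obtain ⟨⟨rfl, rfl, h₁⟩, ⟨_, _, h₂⟩, h⟩ := h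
  obtain rfl := eq_of_heq h₁; obtain rfl := eq_of_heq h₂
  refine ⟨⟨rfl, rfl, HEq.rfl⟩, ⟨rfl, rfl, HEq.rfl⟩, heq_of_eq ?_⟩
  let y' : F.eval ≅ G.eval := ⟨y.hom, y.inv, y.hom_inv_id, y.inv_hom_id⟩
  have h' : x = y' := Iso.ext (eq_of_heq h)
  rw [h']

end Rep2

end

/-! ### Whiskering, tensoring and interchangers in the model. -/

section

variable {V : Type u} [Bicategory.{w, v} V] [Bicategory.Strict V] [GrayMonoid V]

namespace Hom1

theorem eq_of_rep {A B A' B' : V} {P Q : Ob V} {p q : A ⟶ B} {p' q' : A' ⟶ B'} {F G : Hom1 P Q}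
    {x : p ⟶ q} {x' : p' ⟶ q'} {y y' : F ⟶ G} (h : Rep2 x y) (h' : Rep2 x' y') (e : x ≍ x') :
    y = y' := (h.heq_iff h').1 e

section

variable {P Q T U X Y : Ob V}

@[simp] theorem wh_id (a : Hom1 P Q) (f : Hom1 Q T) (b : Hom1 T U) :
    wh a (𝟙 f) b = 𝟙 (a ⨾ f ⨾ b) := by
  have ha := rep_self₁ a
  have hb := rep_self₁ b
  have hf := rep_self₁ f
  refine eq_of_rep (Rep2.wh ha (Rep2.id hf) hb) (Rep2.id (ha.comp (hf.comp hb)))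
    (heq_of_eq (by simp [whisker]))

@[simp] theorem wh_comp (a : Hom1 P Q) {f g h : Hom1 Q T} (η : f ⟶ g) (θ : g ⟶ h) (b : Hom1 T U) :
    wh a (η ≫ θ) b = wh a η b ≫ wh a θ b := by
  have ha := rep_self₁ a
  have hb := rep_self₁ b
  have hη := rep_self₂ η
  have hθ := rep_self₂ θ
  exact eq_of_rep (Rep2.wh ha (hη.comp hθ) hb) ((Rep2.wh ha hη hb).comp (Rep2.wh ha hθ hb))
    (heq_of_eq (by simp [whisker]))

@[simp] theorem wh_wh (a : Hom1 X P) (a' : Hom1 P Q) {f g : Hom1 Q T} (η : f ⟶ g) (b' : Hom1 T U)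
    (b : Hom1 U Y) : wh a (wh a' η b') b = wh (a ⨾ a') η (b' ⨾ b) := by
  have ha := rep_self₁ a
  have hb := rep_self₁ b
  have ha' := rep_self₁ a'
  have hb' := rep_self₁ b'
  have hη := rep_self₂ η
  exact eq_of_rep (Rep2.wh ha (Rep2.wh ha' hη hb') hb) (Rep2.wh (ha.comp ha') hη (hb'.comp hb))
    (whisker_whisker_heq _ _ _ _ _)

theorem xch₀ {f g : Hom1 P Q} {h k : Hom1 Q T} (η : f ⟶ g) (θ : h ⟶ k) :
    wh (one P) η h ≫ wh g θ (one T) = wh f θ (one T) ≫ wh (one P) η k := by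
  have hη := rep_self₂ η
  have hθ := rep_self₂ θ
  exact eq_of_rep ((hη.whiskerRight hθ.dom).comp (Rep2.whiskerLeft hη.cod hθ))
    ((Rep2.whiskerLeft hη.dom hθ).comp (hη.whiskerRight hθ.cod))
    (heq_of_eq (whisker_exchange _ _).symm)

/-- The exchange law for 2-cells acting on disjoint parts of a 1-cell. -/
theorem xch (a : Hom1 X P) {f g : Hom1 P Q} (η : f ⟶ g) (b : Hom1 Q T) {h k : Hom1 T U}
    (θ : h ⟶ k) (c : Hom1 U Y) :
    wh a η (b ⨾ h ⨾ c) ≫ wh (a ⨾ g ⨾ b) θ c = wh (a ⨾ f ⨾ b) θ c ≫ wh a η (b ⨾ k ⨾ c) := by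
  -- Absorbing the gap `b` into the whiskering of `η` makes the two cells adjacent, which is the
  -- ordinary interchange law.
  have := xch₀ (wh a η b) (wh (one T) θ c)
  rw [wh_wh, wh_wh, wh_wh, wh_wh] at this
  exact this

@[simp] theorem ten_id (R S : Ob V) (f : Hom1 P Q) : ten R (𝟙 f) S = 𝟙 (lay R f S) := by
  have hf := rep_self₁ f
  exact eq_of_rep ((Rep2.id hf).tensor _ _ rfl rfl) (Rep2.id (hf.tensor _ _ rfl rfl))
    (heq_of_eq (by rw [tensorRight₂_id, tensorLeft₂_id]))

@[simp] theorem ten_comp (R S : Ob V) {f g h : Hom1 P Q} (η : f ⟶ g) (θ : g ⟶ h) :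
    ten R (η ≫ θ) S = ten R η S ≫ ten R θ S := by
  have hη := rep_self₂ η
  have hθ := rep_self₂ θ
  exact eq_of_rep ((hη.comp hθ).tensor _ _ rfl rfl)
    ((hη.tensor _ _ rfl rfl).comp (hθ.tensor _ _ rfl rfl))
    (heq_of_eq (by rw [tensorRight₂_comp, tensorLeft₂_comp]))

theorem tensorLeft₂_whisker {A W X Y Z : V} (p : W ⟶ X) {f g : X ⟶ Y} (η : f ⟶ g) (q : Y ⟶ Z) :
    A ◃₂ (whisker p η q) ≍ whisker (A ◃ p) (A ◃₂ η) (A ◃ q) :=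
  (tensorLeft₂_whiskerLeft _ _ _).trans (whiskerLeft_heq rfl rfl rfl HEq.rfl
    (by rw [tensorLeft_comp]) (by rw [tensorLeft_comp]) (tensorLeft₂_whiskerRight _ _ _))

theorem tensorRight₂_whisker {A W X Y Z : V} (p : W ⟶ X) {f g : X ⟶ Y} (η : f ⟶ g) (q : Y ⟶ Z) :
    (whisker p η q) ▹₂ A ≍ whisker (p ▹ A) (η ▹₂ A) (q ▹ A) :=
  (tensorRight₂_whiskerLeft _ _ _).trans (whiskerLeft_heq rfl rfl rfl HEq.rfl
    (by rw [tensorRight_comp]) (by rw [tensorRight_comp]) (tensorRight₂_whiskerRight _ _ _))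

@[simp] theorem ten_wh (R S : Ob V) (a : Hom1 X P) {f g : Hom1 P Q} (η : f ⟶ g) (b : Hom1 Q Y) :
    ten R (wh a η b) S = wh (lay R a S) (ten R η S) (lay R b S) := by
  have ha := rep_self₁ a
  have hb := rep_self₁ b
  have hη := rep_self₂ η
  refine eq_of_rep ((Rep2.wh ha hη hb).tensor _ _ rfl rfl)
    (Rep2.wh (ha.tensor _ _ rfl rfl) (hη.tensor _ _ rfl rfl) (hb.tensor _ _ rfl rfl)) ?_
  exact (tensorLeft₂_heq rfl rfl rfl (by simp only [tensorRight_comp]; rfl)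
    (by simp only [tensorRight_comp]; rfl)
    (tensorRight₂_whisker _ _ _)).trans (tensorLeft₂_whisker _ _ _)

@[simp] theorem ten_ten (R S R' S' : Ob V) {f g : Hom1 P Q} (η : f ⟶ g) :
    ten R (ten R' η S') S = ten (R * R') η (S' * S) := by
  have hη := rep_self₂ η
  refine eq_of_rep ((hη.tensor _ _ rfl rfl).tensor _ _ rfl rfl)
    (hη.tensor _ _ (Ob.obj_mul R R').symm (Ob.obj_mul S' S).symm) ?_
  refine (tensorLeft₂_heq rfl ?_ ?_ (tensorRight_tensorLeft _ _ _)
    (tensorRight_tensorLeft _ _ _) (tensorRight₂_tensorLeft₂ _ _ _)).trans ?_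
  · rw [tensor_assoc]
  · rw [tensor_assoc]
  refine (tensorLeft₂_tensorLeft₂ _ _ _).symm.trans ?_
  refine tensorLeft₂_heq rfl ?_ ?_ ?_ ?_ (tensorRight₂_tensorRight₂ _ _ _).symm
  · rw [tensor_assoc]
  · rw [tensor_assoc]
  · exact (tensorRight_tensorRight _ _ _).symm
  · exact (tensorRight_tensorRight _ _ _).symm

end

/-- The interchanger. -/
def sig {P P' Q Q' : Ob V} (f : Hom1 P P') (g : Hom1 Q Q') :
    lay P g 1 ⨾ lay 1 f Q' ≅ lay 1 f Q ⨾ lay P' g 1 :=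
  isoOf (((rep_self₁ g).left _ rfl).comp ((rep_self₁ f).right _ rfl))
    (((rep_self₁ f).right _ rfl).comp ((rep_self₁ g).left _ rfl)) (interchanger f.eval g.eval)

theorem _root_.Rep2.sig {A A' B B' : V} {P P' Q Q' : Ob V} {p : A ⟶ A'} {q : B ⟶ B'}
    {f : Hom1 P P'} {g : Hom1 Q Q'} (hp : Rep1 p f) (hq : Rep1 q g) :
    Rep2 (interchanger p q).hom (sig f g).hom :=
  ⟨(hq.left _ hp.src).comp (hp.right _ hq.tgt), (hp.right _ hq.src).comp (hq.left _ hp.tgt),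
    (interchanger_heq hp.src hp.tgt hq.src hq.tgt hp.heq hq.heq).trans (rep_isoOf_hom _ _ _).heq⟩

section

variable {P P' P'' Q Q' Q'' R S : Ob V}

theorem sig_one_left (P : Ob V) (g : Hom1 Q Q') : (sig (one P) g).hom = 𝟙 (lay P g 1) :=
  eq_of_rep (Rep2.sig (rep_self₁ _) (rep_self₁ g)) (Rep2.id ((rep_self₁ g).left _ rfl))
    (interchanger_id_left _ _)

theorem sig_one_right (f : Hom1 P P') (Q : Ob V) : (sig f (one Q)).hom = 𝟙 (lay 1 f Q) :=
  eq_of_rep (Rep2.sig (rep_self₁ f) (rep_self₁ _)) (Rep2.id ((rep_self₁ f).right _ rfl))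
    (interchanger_id_right _ _)

theorem ten_sig_left (R : Ob V) (f : Hom1 P P') (g : Hom1 Q Q') :
    ten R (sig f g).hom 1 = (sig (lay R f 1) g).hom :=
  eq_of_rep (Rep2.left _ rfl (Rep2.sig (rep_self₁ f) (rep_self₁ g)))
    (Rep2.sig ((rep_self₁ f).left _ rfl) (rep_self₁ g)) (tensorLeft₂_interchanger _ _ _)

theorem ten_sig_right (f : Hom1 P P') (g : Hom1 Q Q') (S : Ob V) :
    ten 1 (sig f g).hom S = (sig f (lay 1 g S)).hom :=
  eq_of_rep (Rep2.right _ rfl (Rep2.sig (rep_self₁ f) (rep_self₁ g)))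
    (Rep2.sig (rep_self₁ f) ((rep_self₁ g).right _ rfl)) (tensorRight₂_interchanger _ _ _)

/-- Tensoring on the left affects only the left member of an interchanger, tensoring on the right
only the right member. -/
theorem ten_sig (R : Ob V) (f : Hom1 P P') (g : Hom1 Q Q') (S : Ob V) :
    ten R (sig f g).hom S = (sig (lay R f 1) (lay 1 g S)).hom := by
  rw [← ten_sig_right, ← ten_sig_left]
  exact (ten_ten 1 S R 1 _).symm

/-- An idle object between two 1-cells may be attributed to either of them. -/
theorem sig_mid (f : Hom1 P P') (R : Ob V) (g : Hom1 Q Q') :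
    (sig (lay 1 f R) g).hom = (sig f (lay R g 1)).hom :=
  eq_of_rep (Rep2.sig ((rep_self₁ f).right _ rfl) (rep_self₁ g))
    (Rep2.sig (rep_self₁ f) ((rep_self₁ g).left _ rfl)) (interchanger_tensor _ _ _)

theorem sig_nat_left {f f' : Hom1 P P'} (η : f ⟶ f') (g : Hom1 Q Q') :
    wh (lay P g 1) (ten 1 η Q') (one _) ≫ (sig f' g).hom =
      (sig f g).hom ≫ wh (one _) (ten 1 η Q) (lay P' g 1) := by
  have hη := rep_self₂ η
  have hg := rep_self₁ g
  exact eq_of_rep ((Rep2.whiskerLeft (hg.left P rfl) (hη.right Q' rfl)).comp (Rep2.sig hη.cod hg))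
    ((Rep2.sig hη.dom hg).comp ((hη.right Q rfl).whiskerRight (hg.left P' rfl)))
    (heq_of_eq (interchanger_naturality_left _ _))

theorem sig_nat_right (f : Hom1 P P') {g g' : Hom1 Q Q'} (θ : g ⟶ g') :
    wh (one _) (ten P θ 1) (lay 1 f Q') ≫ (sig f g').hom =
      (sig f g).hom ≫ wh (lay 1 f Q) (ten P' θ 1) (one _) := by
  have hθ := rep_self₂ θ
  have hf := rep_self₁ f
  exact eq_of_rep (((hθ.left P rfl).whiskerRight (hf.right Q' rfl)).comp (Rep2.sig hf hθ.cod))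
    ((Rep2.sig hf hθ.dom).comp (Rep2.whiskerLeft (hf.right Q rfl) (hθ.left P' rfl)))
    (heq_of_eq (interchanger_naturality_right _ _))

theorem sig_comp_left (f : Hom1 P P') (f' : Hom1 P' P'') (g : Hom1 Q Q') :
    (sig (f ⨾ f') g).hom = wh (one _) (sig f g).hom (lay 1 f' Q') ≫
      wh (lay 1 f Q) (sig f' g).hom (one _) := by
  have hf := rep_self₁ f
  have hf' := rep_self₁ f'
  have hg := rep_self₁ g
  refine eq_of_rep (Rep2.sig (hf.comp hf') hg)
    (Rep2.vcomp (e := by simp) ((Rep2.sig hf hg).whiskerRight (hf'.right _ rfl))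
      (Rep2.whiskerLeft (hf.right _ rfl) (Rep2.sig hf' hg))) ?_
  refine (interchanger_comp_left _ _ _).trans ?_
  simp only [vcomp, Strict.associator_eqToIso, eqToIso.hom, eqToIso.inv]
  exact eqToHom_comp_heq _ _

theorem sig_comp_right (f : Hom1 P P') (g : Hom1 Q Q') (g' : Hom1 Q' Q'') :
    (sig f (g ⨾ g')).hom = wh (lay P g 1) (sig f g').hom (one _) ≫
      wh (one _) (sig f g).hom (lay P' g' 1) := by
  have hf := rep_self₁ f
  have hg' := rep_self₁ g'
  have hg := rep_self₁ g
  refine eq_of_rep (Rep2.sig hf (hg.comp hg'))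
    (Rep2.vcomp (e := by simp) (Rep2.whiskerLeft (hg.left _ rfl) (Rep2.sig hf hg'))
      ((Rep2.sig hf hg).whiskerRight (hg'.left _ rfl))) ?_
  refine (interchanger_comp_right _ _ _).trans ?_
  simp only [vcomp, Strict.associator_eqToIso, eqToIso.hom, eqToIso.inv]
  exact vcomp_heq rfl rfl HEq.rfl HEq.rfl (by simp) HEq.rfl (vcomp_heq rfl rfl HEq.rfl HEq.rfl
    (by simp) HEq.rfl (comp_eqToHom_heq _ _))

end

end Hom1

end

/-! ### The braiding and the modifications `R` and `S` in the model. -/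

open BraidedGrayMonoid Hom1

section

variable {V : Type u} [Bicategory.{w, v} V] [Bicategory.Strict V] [GrayMonoid V]

namespace Ob

theorem tensor_eq {A B : V} {P Q : Ob V} (hA : A = P.obj) (hB : B = Q.obj) :
    A ⊗ᵍ B = (P * Q).obj := by rw [hA, hB, obj_mul]

theorem tensor_eq₃ {A B C : V} {P Q R : Ob V} (hA : A = P.obj) (hB : B = Q.obj) (hC : C = R.obj) :
    (A ⊗ᵍ B) ⊗ᵍ C = (P * (Q * R)).obj := by rw [hA, hB, hC, tensor_assoc, obj_mul₃]

end Ob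

namespace Rep1

variable {A B D : V} {P Q : Ob V} {p : A ⟶ B} {F : Hom1 P Q}

theorem cst_comp (h : D = A) (hp : Rep1 p F) : Rep1 (eqToHom h ≫ p) F := by
  subst h; simpa using hp

theorem comp_cst (h : B = D) (hp : Rep1 p F) : Rep1 (p ≫ eqToHom h) F := by
  subst h; simpa using hp

end Rep1

theorem Rep1.mk' {A B : V} {P Q : Ob V} (p : A ⟶ B) (hA : A = P.obj) (hB : B = Q.obj) :
    Rep1 p (Hom1.mk' (eqToHom hA.symm ≫ p ≫ eqToHom hB)) := by
  refine ⟨hA, hB, ?_⟩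
  rw [eval_mk']
  exact (conj_heq _ _ _).symm

variable [BraidedGrayMonoid V]

namespace Hom1

/-- The braiding. -/
def bc (P Q : Ob V) : Hom1 (P * Q) (Q * P) :=
  mk' (eqToHom (Ob.obj_mul P Q) ≫ β P.obj Q.obj ≫ eqToHom (Ob.obj_mul Q P).symm)

end Hom1

theorem Rep1.bc {A B : V} (P Q : Ob V) (hA : A = P.obj) (hB : B = Q.obj) :
    Rep1 (β A B) (Hom1.bc P Q) := by
  subst hA hB
  exact Rep1.mk' _ (Ob.obj_mul P Q).symm (Ob.obj_mul Q P).symm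

theorem Rep1.R {A B C : V} (P Q S : Ob V) (hA : A = P.obj) (hB : B = Q.obj) (hC : C = S.obj)
    {D I : V} {h₁ : D = (A ⊗ᵍ B) ⊗ᵍ C} {h₂ : (B ⊗ᵍ A) ⊗ᵍ C = B ⊗ᵍ A ⊗ᵍ C}
    {h₃ : B ⊗ᵍ C ⊗ᵍ A = I} :
    Rep1 (eqToHom h₁ ≫ β A B ▹ C ≫ eqToHom h₂ ≫ B ◃ β A C ≫ eqToHom h₃)
      (lay 1 (Hom1.bc P Q) S ⨾ lay Q (Hom1.bc P S) 1) :=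
  .cst_comp _ (((Rep1.bc P Q hA hB).right S hC).comp
    (.cst_comp _ (.comp_cst _ ((Rep1.bc P S hA hC).left Q hB))))

theorem Rep1.S {A B C : V} (P Q S : Ob V) (hA : A = P.obj) (hB : B = Q.obj) (hC : C = S.obj)
    {D I : V} {h₁ : D = A ⊗ᵍ B ⊗ᵍ C} {h₂ : A ⊗ᵍ C ⊗ᵍ B = (A ⊗ᵍ C) ⊗ᵍ B}
    {h₃ : (C ⊗ᵍ A) ⊗ᵍ B = I} :
    Rep1 (eqToHom h₁ ≫ A ◃ β B C ≫ eqToHom h₂ ≫ β A C ▹ B ≫ eqToHom h₃)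
      (lay P (Hom1.bc Q S) 1 ⨾ lay 1 (Hom1.bc P S) Q) :=
  .cst_comp _ (((Rep1.bc Q S hB hC).left P hA).comp
    (.cst_comp _ (.comp_cst _ ((Rep1.bc P S hA hC).right Q hB))))

namespace Hom1

/-- Pseudonaturality of the braiding in the first variable. -/
def bl {P P' : Ob V} (f : Hom1 P P') (Q : Ob V) :
    lay 1 f Q ⨾ bc P' Q ≅ bc P Q ⨾ lay Q f 1 :=
  isoOf (((rep_self₁ f).right _ rfl).comp (Rep1.bc _ _ rfl rfl))
    ((Rep1.bc _ _ rfl rfl).comp ((rep_self₁ f).left _ rfl)) (βl f.eval Q.obj)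

/-- Pseudonaturality of the braiding in the second variable. -/
def br (P : Ob V) {Q Q' : Ob V} (g : Hom1 Q Q') :
    lay P g 1 ⨾ bc P Q' ≅ bc P Q ⨾ lay 1 g P :=
  isoOf (((rep_self₁ g).left _ rfl).comp (Rep1.bc _ _ rfl rfl))
    ((Rep1.bc _ _ rfl rfl).comp ((rep_self₁ g).right _ rfl)) (βr P.obj g.eval)

/-- The modification `R`. -/
def Rm (P Q S : Ob V) : bc P (Q * S) ≅ lay 1 (bc P Q) S ⨾ lay Q (bc P S) 1 :=
  isoOf (Rep1.bc _ _ rfl (Ob.obj_mul Q S).symm) (Rep1.R P Q S rfl rfl rfl) (R P.obj Q.obj S.obj)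

/-- The modification `S`. -/
def Sm (P Q S : Ob V) : bc (P * Q) S ≅ lay P (bc Q S) 1 ⨾ lay 1 (bc P S) Q :=
  isoOf (Rep1.bc _ _ (Ob.obj_mul P Q).symm rfl) (Rep1.S P Q S rfl rfl rfl)
    (BraidedGrayMonoid.S P.obj Q.obj S.obj)

end Hom1

namespace Rep2

theorem bl {A A' B : V} {P P' : Ob V} (Q : Ob V) {p : A ⟶ A'} {f : Hom1 P P'} (hp : Rep1 p f)
    (hB : B = Q.obj) : Rep2 (βl p B).hom (Hom1.bl f Q).hom := by
  obtain ⟨rfl, rfl, h⟩ := hp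
  subst hB
  obtain rfl := eq_of_heq h
  exact rep_isoOf_hom _ _ _

theorem br {A B B' : V} (P : Ob V) {Q Q' : Ob V} {p : B ⟶ B'} {f : Hom1 Q Q'} (hA : A = P.obj)
    (hp : Rep1 p f) : Rep2 (βr A p).hom (Hom1.br P f).hom := by
  obtain ⟨rfl, rfl, h⟩ := hp
  subst hA
  obtain rfl := eq_of_heq h
  exact rep_isoOf_hom _ _ _

theorem R {A B C : V} (P Q T : Ob V) (hA : A = P.obj) (hB : B = Q.obj) (hC : C = T.obj) :
    Rep2 (BraidedGrayMonoid.R A B C).hom (Rm P Q T).hom := by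
  subst hA hB hC
  exact rep_isoOf_hom _ _ _

theorem S {A B C : V} (P Q T : Ob V) (hA : A = P.obj) (hB : B = Q.obj) (hC : C = T.obj) :
    Rep2 (BraidedGrayMonoid.S A B C).hom (Sm P Q T).hom := by
  subst hA hB hC
  exact rep_isoOf_hom _ _ _

end Rep2

namespace Hom1

variable {P P' P'' Q Q' Q'' S S' : Ob V}

theorem bl_nat {f f' : Hom1 P P'} (η : f ⟶ f') (Q : Ob V) :
    wh (one _) (ten 1 η Q) (bc P' Q) ≫ (bl f' Q).hom =
      (bl f Q).hom ≫ wh (bc P Q) (ten Q η 1) (one _) := by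
  have hη := rep_self₂ η
  exact eq_of_rep
    (((hη.right Q rfl).whiskerRight (Rep1.bc P' Q rfl rfl)).comp (Rep2.bl Q hη.cod rfl))
    ((Rep2.bl Q hη.dom rfl).comp (Rep2.whiskerLeft (Rep1.bc P Q rfl rfl) (hη.left Q rfl)))
    (heq_of_eq (βl_naturality _ _))

theorem br_nat (P : Ob V) {g g' : Hom1 Q Q'} (θ : g ⟶ g') :
    wh (one _) (ten P θ 1) (bc P Q') ≫ (br P g').hom =
      (br P g).hom ≫ wh (bc P Q) (ten 1 θ P) (one _) := by
  have hη := rep_self₂ θ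
  exact eq_of_rep (((hη.left _ rfl).whiskerRight (Rep1.bc _ _ rfl rfl)).comp (Rep2.br _ rfl hη.cod))
    ((Rep2.br _ rfl hη.dom).comp (Rep2.whiskerLeft (Rep1.bc _ _ rfl rfl) (hη.right _ rfl)))
    (heq_of_eq (βr_naturality _ _))

theorem bl_one (P Q : Ob V) : (bl (one P) Q).hom = 𝟙 (bc P Q) :=
  eq_of_rep (Rep2.bl _ (rep_self₁ (one P)) rfl) (Rep2.id (Rep1.bc _ _ rfl rfl)) (βl_id _ _)

theorem br_one (P Q : Ob V) : (br P (one Q)).hom = 𝟙 (bc P Q) :=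
  eq_of_rep (Rep2.br _ rfl (rep_self₁ (one Q))) (Rep2.id (Rep1.bc _ _ rfl rfl)) (βr_id _ _)

theorem bl_comp (f : Hom1 P P') (f' : Hom1 P' P'') (Q : Ob V) :
    (bl (f ⨾ f') Q).hom =
      wh (lay 1 f Q) (bl f' Q).hom (one _) ≫ wh (one _) (bl f Q).hom (lay Q f' 1) := by
  have hf := rep_self₁ f
  have hf' := rep_self₁ f'
  exact eq_of_rep (Rep2.bl _ (hf.comp hf') rfl) ((Rep2.whiskerLeft (hf.right _ rfl)
    (Rep2.bl _ hf' rfl)).vcomp ((Rep2.bl _ hf rfl).whiskerRight (hf'.left _ rfl))) (βl_comp _ _ _)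

theorem br_comp (P : Ob V) (g : Hom1 Q Q') (g' : Hom1 Q' Q'') :
    (br P (g ⨾ g')).hom =
      wh (lay P g 1) (br P g').hom (one _) ≫ wh (one _) (br P g).hom (lay 1 g' P) := by
  have hf := rep_self₁ g
  have hf' := rep_self₁ g'
  exact eq_of_rep (Rep2.br _ rfl (hf.comp hf')) ((Rep2.whiskerLeft (hf.left _ rfl)
    (Rep2.br _ rfl hf')).vcomp ((Rep2.br _ rfl hf).whiskerRight (hf'.right _ rfl))) (βr_comp _ _ _)

/-- The braiding exchanges the two factors, so it carries the interchanger of `f` and `g` to the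
inverse interchanger of `g` and `f`. This is pseudonaturality at the last kind of generating 2-cell
of the Gray tensor product. -/
theorem bc_sig (f : Hom1 P P') (g : Hom1 Q Q') :
    wh (lay P g 1) (bl f Q').hom (one _) ≫ wh (one _) (br P g).hom (lay Q' f 1) ≫
        wh (bc P Q) (sig g f).inv (one _) =
      wh (one _) (sig f g).hom (bc P' Q') ≫ wh (lay 1 f Q) (br P' g).hom (one _) ≫
        wh (one _) (bl f Q).hom (lay 1 g P') := by
  have hf := rep_self₁ f
  have hg := rep_self₁ g
  exact eq_of_rep ((Rep2.whiskerLeft (hg.left P rfl) (Rep2.bl Q' hf rfl)).vcomp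
      (((Rep2.br P rfl hg).whiskerRight (hf.left Q' rfl)).vcomp
        (Rep2.whiskerLeft (Rep1.bc P Q rfl rfl) (Rep2.inv (Rep2.sig hg hf)))))
    (((Rep2.sig hf hg).whiskerRight (Rep1.bc P' Q' rfl rfl)).vcomp
      ((Rep2.whiskerLeft (hf.right Q rfl) (Rep2.br P' rfl hg)).vcomp
        ((Rep2.bl Q hf rfl).whiskerRight (hg.right P' rfl)))) (β_interchanger _ _)

/-- A 1-cell in the first variable goes through both braidings of `R`. One in the second or third
variable goes through a single braiding and slides past the other by an interchanger. -/
theorem Rm_nat₁ (f : Hom1 P P') (Q S : Ob V) :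
    (bl f (Q * S)).hom ≫ wh (one _) (Rm P Q S).hom (lay (Q * S) f 1) =
      wh (lay 1 f (Q * S)) (Rm P' Q S).hom (one _) ≫
        wh (one _) (ten 1 (bl f Q).hom S) (lay Q (bc P' S) 1) ≫
        wh (lay 1 (bc P Q) S) (ten Q (bl f S).hom 1) (one _) := by
  have hf := rep_self₁ f
  have hQS := (Ob.obj_mul Q S).symm
  exact eq_of_rep ((Rep2.bl (Q * S) hf hQS).vcomp
      (Rep2.whiskerRight (Rep2.R P Q S rfl rfl rfl) (hf.left (Q * S) hQS)))
    (.vcomp (.whiskerLeft (hf.right (Q * S) hQS) (.R P' Q S rfl rfl rfl))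
      (.vcomp (.wh (.cst (P * (Q * S)) _ (by rw [Ob.obj_mul₃])) (.right S rfl (.bl Q hf rfl))
          (.cst_comp _ (.comp_cst _ (.left Q rfl (.bc P' S rfl rfl)))))
        (.wh (.cst_comp _ (.comp_cst _ (.right S rfl (.bc P Q rfl rfl))))
          (.left Q rfl (.bl S hf rfl)) (.cst (Q * (S * P')) _ (by rw [Ob.obj_mul₃])))))
    (R_naturality₁ _ _ _)

theorem Rm_nat₂ (P : Ob V) (g : Hom1 Q Q') (S : Ob V) :
    (br P (lay 1 g S)).hom ≫ wh (one _) (Rm P Q S).hom (lay 1 g (S * P)) =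
      wh (lay P g S) (Rm P Q' S).hom (one _) ≫
        wh (one _) (ten 1 (br P g).hom S) (lay Q' (bc P S) 1) ≫
        wh (lay 1 (bc P Q) S) (sig g (bc P S)).inv (one _) := by
  have hg := rep_self₁ g
  exact eq_of_rep (.vcomp (.br P rfl (hg.right S rfl))
      (.whiskerRight (.R P Q S rfl rfl rfl) (.right P rfl (.right S rfl hg))))
    (.vcomp (.whiskerLeft (.left P rfl (.right S rfl hg)) (.R P Q' S rfl rfl rfl))
      (.vcomp (.wh (.cst (P * (Q * S)) _ (by rw [Ob.obj_mul₃])) (.right S rfl (.br P rfl hg))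
          (.cst_comp _ (.comp_cst _ (.left Q' rfl (.bc P S rfl rfl)))))
        (.wh (.cst_comp _ (.comp_cst _ (.right S rfl (.bc P Q rfl rfl))))
          (.inv (.sig hg (.bc P S rfl rfl))) (.cst (Q' * (S * P)) _ (by rw [Ob.obj_mul₃])))))
    (R_naturality₂ _ _ _)

theorem Rm_nat₃ (P Q : Ob V) (h : Hom1 S S') :
    (br P (lay Q h 1)).hom ≫ wh (one _) (Rm P Q S).hom (lay Q h P) =
      wh (lay (P * Q) h 1) (Rm P Q S').hom (one _) ≫
        wh (one _) (sig (bc P Q) h).hom (lay Q (bc P S') 1) ≫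
        wh (lay 1 (bc P Q) S) (ten Q (br P h).hom 1) (one _) := by
  have hh := rep_self₁ h
  exact eq_of_rep (.vcomp (.br P rfl (hh.left Q rfl))
      (.whiskerRight (.R P Q S rfl rfl rfl) (.right P rfl (.left Q rfl hh))))
    (.vcomp (.whiskerLeft (.left P rfl (.left Q rfl hh)) (.R P Q S' rfl rfl rfl))
      (.vcomp (.wh (.cst (P * (Q * S)) _ (by rw [Ob.obj_mul₃])) (.sig (.bc P Q rfl rfl) hh)
          (.cst_comp _ (.comp_cst _ (.left Q rfl (.bc P S' rfl rfl)))))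
        (.wh (.cst_comp _ (.comp_cst _ (.right S rfl (.bc P Q rfl rfl))))
          (.left Q rfl (.br P rfl hh)) (.cst (Q * (S' * P)) _ (by rw [Ob.obj_mul₃])))))
    (R_naturality₃ _ _ _)

/-- For `S` it is the third variable that goes through both braidings; the first two meet one
braiding and one interchanger. -/
theorem Sm_nat₁ (f : Hom1 P P') (Q S : Ob V) :
    (bl (lay 1 f Q) S).hom ≫ wh (one _) (Sm P Q S).hom (lay S f Q) =
      wh (lay 1 f (Q * S)) (Sm P' Q S).hom (one _) ≫
        wh (one _) (sig f (bc Q S)).inv (lay 1 (bc P' S) Q) ≫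
        wh (lay P (bc Q S) 1) (ten 1 (bl f S).hom Q) (one _) := by
  have hf := rep_self₁ f
  exact eq_of_rep (.vcomp (.bl S (hf.right Q rfl) rfl)
      (.whiskerRight (.S P Q S rfl rfl rfl) (.left S rfl (.right Q rfl hf))))
    (.vcomp (.whiskerLeft (.right S rfl (.right Q rfl hf)) (.S P' Q S rfl rfl rfl))
      (.vcomp (.wh (.cst (P * (Q * S)) _ (Ob.tensor_eq₃ rfl rfl rfl))
          (.inv (.sig hf (.bc Q S rfl rfl)))
          (.cst_comp _ (.comp_cst _ (.right Q rfl (.bc P' S rfl rfl)))))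
        (.wh (.cst_comp _ (.comp_cst _ (.left P rfl (.bc Q S rfl rfl))))
          (.right Q rfl (.bl S hf rfl)) (.cst (S * (P' * Q)) _ (Ob.tensor_eq₃ rfl rfl rfl)))))
    (S_naturality₁ _ _ _)

theorem Sm_nat₂ (P : Ob V) (g : Hom1 Q Q') (S : Ob V) :
    (bl (lay P g 1) S).hom ≫ wh (one _) (Sm P Q S).hom (lay (S * P) g 1) =
      wh (lay P g S) (Sm P Q' S).hom (one _) ≫
        wh (one _) (ten P (bl g S).hom 1) (lay 1 (bc P S) Q') ≫
        wh (lay P (bc Q S) 1) (sig (bc P S) g).hom (one _) := by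
  have hg := rep_self₁ g
  exact eq_of_rep (.vcomp (.bl S (hg.left P rfl) rfl)
      (.whiskerRight (.S P Q S rfl rfl rfl) (.left S rfl (.left P rfl hg))))
    (.vcomp (.whiskerLeft (.right S rfl (.left P rfl hg)) (.S P Q' S rfl rfl rfl))
      (.vcomp (.wh (.cst (P * (Q * S)) _ (Ob.tensor_eq₃ rfl rfl rfl))
          (.left P rfl (.bl S hg rfl))
          (.cst_comp _ (.comp_cst _ (.right Q' rfl (.bc P S rfl rfl)))))
        (.wh (.cst_comp _ (.comp_cst _ (.left P rfl (.bc Q S rfl rfl))))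
          (.sig (.bc P S rfl rfl) hg) (.cst (S * (P * Q')) _ (Ob.tensor_eq₃ rfl rfl rfl)))))
    (S_naturality₂ _ _ _)

theorem Sm_nat₃ (P Q : Ob V) (h : Hom1 S S') :
    (br (P * Q) h).hom ≫ wh (one _) (Sm P Q S).hom (lay 1 h (P * Q)) =
      wh (lay (P * Q) h 1) (Sm P Q S').hom (one _) ≫
        wh (one _) (ten P (br Q h).hom 1) (lay 1 (bc P S') Q) ≫
        wh (lay P (bc Q S) 1) (ten 1 (br P h).hom Q) (one _) := by
  have hh := rep_self₁ h
  have hPQ := (Ob.obj_mul P Q).symm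
  exact eq_of_rep (.vcomp (.br (P * Q) hPQ hh)
      (.whiskerRight (.S P Q S rfl rfl rfl) (.right (P * Q) hPQ hh)))
    (.vcomp (.whiskerLeft (.left (P * Q) hPQ hh) (.S P Q S' rfl rfl rfl))
      (.vcomp (.wh (.cst (P * (Q * S)) _ (Ob.tensor_eq₃ rfl rfl rfl))
          (.left P rfl (.br Q rfl hh))
          (.cst_comp _ (.comp_cst _ (.right Q rfl (.bc P S' rfl rfl)))))
        (.wh (.cst_comp _ (.comp_cst _ (.left P rfl (.bc Q S rfl rfl))))
          (.right Q rfl (.br P rfl hh)) (.cst (S' * (P * Q)) _ (Ob.tensor_eq₃ rfl rfl rfl)))))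
    (S_naturality₃ _ _ _)

/-- BA1: the braiding of `P` past three objects does not depend on how the three are split. -/
theorem Rm_cocycle (P Q S T : Ob V) :
    (Rm P Q (S * T)).hom ≫ wh (lay 1 (bc P Q) (S * T)) (ten Q (Rm P S T).hom 1) (one _) =
      (Rm P (Q * S) T).hom ≫
        wh (one _) (ten 1 (Rm P Q S).hom T) (lay (Q * S) (bc P T) 1) := by
  have hQS := (Ob.obj_mul Q S).symm
  have hST := (Ob.obj_mul S T).symm
  exact eq_of_rep (.vcomp (.R P Q (S * T) rfl rfl hST)
      (.wh (.cst_comp _ (.comp_cst _ (.right (S * T) hST (.bc P Q rfl rfl))))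
        (.left Q rfl (.R P S T rfl rfl rfl))
        (.cst (Q * (S * (T * P))) _ (by simp only [Ob.obj_mul, tensor_assoc]))))
    (.vcomp (.R P (Q * S) T rfl hQS rfl)
      (.wh (.cst (P * (Q * (S * T))) _ (by simp only [Ob.obj_mul, tensor_assoc]))
        (.right T rfl (.R P Q S rfl rfl rfl))
        (.cst_comp _ (.comp_cst _ (.left (Q * S) hQS (.bc P T rfl rfl))))))
    (BA1 _ _ _ _)

/-- BA2: the braiding of three objects past `T` does not depend on how the three are split. -/
theorem Sm_cocycle (P Q S T : Ob V) :
    (Sm (P * Q) S T).hom ≫ wh (lay (P * Q) (bc S T) 1) (ten 1 (Sm P Q T).hom S) (one _) =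
      (Sm P (Q * S) T).hom ≫
        wh (one _) (ten P (Sm Q S T).hom 1) (lay 1 (bc P T) (Q * S)) := by
  have hQS := (Ob.obj_mul Q S).symm
  have hPQ := (Ob.obj_mul P Q).symm
  exact eq_of_rep (.vcomp (.S (P * Q) S T hPQ rfl rfl)
      (.wh (.cst_comp _ (.comp_cst _ (.left (P * Q) hPQ (.bc S T rfl rfl))))
        (.right S rfl (.S P Q T rfl rfl rfl))
        (.cst (T * (P * (Q * S))) _ (by simp only [Ob.obj_mul, tensor_assoc]))))
    (.vcomp (.S P (Q * S) T rfl hQS rfl)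
      (.wh (.cst (P * (Q * (S * T))) _ (by simp only [Ob.obj_mul, tensor_assoc]))
        (.left P rfl (.S Q S T rfl rfl rfl))
        (.cst_comp _ (.comp_cst _ (.right (Q * S) hQS (.bc P T rfl rfl))))))
    (BA2 _ _ _ _)

/-- BA3: the braiding of `P * Q` past `S * T` resolves into four elementary braidings by splitting
either pair first. The two resolutions perform the independent braidings `bc P S` and `bc Q T` in
opposite orders, hence the interchanger. -/
theorem Rm_Sm (P Q S T : Ob V) :
    wh (one _) (ten 1 (Sm P Q S).hom T) (lay S (bc (P * Q) T) 1) ≫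
      wh (lay P (bc Q S) T ⨾ lay 1 (bc P S) (Q * T)) (ten S (Sm P Q T).hom 1) (one _) ≫
      wh (lay P (bc Q S) T) (sig (bc P S) (bc Q T)).inv (lay S (bc P T) Q) ≫
      wh (lay P (bc Q S) T ⨾ lay (P * S) (bc Q T) 1) (ten 1 (Rm P S T).inv Q) (one _) ≫
      wh (one _) (ten P (Rm Q S T).inv 1) (lay 1 (bc P (S * T)) Q) =
    (Rm (P * Q) S T).inv ≫ (Sm P Q (S * T)).hom := by
  have hST := (Ob.obj_mul S T).symm
  have hPQ := (Ob.obj_mul P Q).symm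
  have hQT := (Ob.obj_mul Q T).symm
  have hPS := (Ob.obj_mul P S).symm
  have h₁ : Rep1 ((P.obj ◃ β Q.obj S.obj) ▹ T.obj) (lay P (bc Q S) T) :=
    .right T rfl (.left P rfl (.bc Q S rfl rfl))
  have e : (P.obj ⊗ᵍ Q.obj) ⊗ᵍ S.obj ⊗ᵍ T.obj = (P * (Q * (S * T))).obj :=
    Ob.tensor_eq₃ rfl rfl hST
  refine eq_of_rep (.vcomp (.wh (.cst (P * (Q * (S * T))) _ e)
      (.right T rfl (.S P Q S rfl rfl rfl))
      (.cst_comp _ (.comp_cst _ (.left S rfl (.bc (P * Q) T hPQ rfl)))))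
    (.vcomp (.wh (.cst_comp _ (h₁.comp (.cst_comp _ (.comp_cst _
        (.right (Q * T) hQT (.bc P S rfl rfl))))))
      (.left S rfl (.S P Q T rfl rfl rfl))
      (.cst (S * (T * (P * Q))) _ (by simp only [Ob.obj_mul])))
    (.vcomp (.wh (.cst_comp _ (.comp_cst _ h₁)) (.inv (.sig (.bc P S rfl rfl) (.bc Q T rfl rfl)))
      (.cst_comp _ (.comp_cst _ (.left S rfl (.right Q rfl (.bc P T rfl rfl))))))
    (.vcomp (.wh (.cst_comp _ (h₁.comp (.cst_comp _ (.comp_cst _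
        (.left (P * S) hPS (.bc Q T rfl rfl))))))
      (.right Q rfl (.inv (.R P S T rfl rfl rfl)))
      (.cst (S * (T * (P * Q))) _ (by simp only [Ob.obj_mul, tensor_assoc])))
    (.wh (.cst (P * (Q * (S * T))) _ e) (.left P rfl (.inv (.R Q S T rfl rfl rfl)))
      (.cst_comp _ (.comp_cst _ (.right Q rfl (.bc P (S * T) rfl hST)))))))))
    (.comp (.inv (.R (P * Q) S T hPQ rfl rfl)) (.S P Q (S * T) rfl rfl hST))
    (BA3 _ _ _ _)

end Hom1

end

/-! ### Inverse interchangers and the tensor product of 1-cells. -/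

section

variable {V : Type u} [Bicategory.{w, v} V] [Bicategory.Strict V] [GrayMonoid V]

theorem iso_square {C : Type u} [Category.{v} C] {a b c d e f : C} (x : a ≅ b) {y : b ⟶ c}
    {t : c ⟶ d} {s : a ⟶ e} {z : e ⟶ f} (w : f ≅ d) (h : (x.hom ≫ y) ≫ t = s ≫ z ≫ w.hom) :
    y ≫ t ≫ w.inv = x.inv ≫ s ≫ z := by
  rw [Iso.eq_inv_comp, ← Category.assoc, ← Category.assoc, Iso.comp_inv_eq, h, Category.assoc]

namespace Hom1

section

variable {P P' P'' P₃ Q Q' Q'' Q₃ Q₁ Q₂ R S X Y T U : Ob V}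

/-- Whiskering of an invertible 2-cell. -/
@[simps]
def whI (a : Hom1 P Q) {f g : Hom1 Q T} (η : f ≅ g) (b : Hom1 T U) : a ⨾ f ⨾ b ≅ a ⨾ g ⨾ b where
  hom := wh a η.hom b
  inv := wh a η.inv b
  hom_inv_id := by rw [← wh_comp, η.hom_inv_id, wh_id]
  inv_hom_id := by rw [← wh_comp, η.inv_hom_id, wh_id]

/-- The tensor product of an invertible 2-cell with objects. -/
@[simps]
def tenI (R : Ob V) {f g : Hom1 P Q} (η : f ≅ g) (S : Ob V) : lay R f S ≅ lay R g S where
  hom := ten R η.hom S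
  inv := ten R η.inv S
  hom_inv_id := by rw [← ten_comp, η.hom_inv_id, ten_id]
  inv_hom_id := by rw [← ten_comp, η.inv_hom_id, ten_id]

theorem wh_inv_hom (a : Hom1 P Q) {f g : Hom1 Q T} (η : f ≅ g) (b : Hom1 T U) :
    wh a η.inv b ≫ wh a η.hom b = 𝟙 _ := (whI a η b).inv_hom_id

theorem ten_sig_inv (R : Ob V) (f : Hom1 P P') (g : Hom1 Q Q') (S : Ob V) :
    ten R (sig f g).inv S = (sig (lay R f 1) (lay 1 g S)).inv := by
  have h := (tenI R (sig f g) S).hom_inv_id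
  have h' := (sig (lay R f 1) (lay 1 g S)).inv_hom_id
  calc ten R (sig f g).inv S
      = ((sig (lay R f 1) (lay 1 g S)).inv ≫ (sig (lay R f 1) (lay 1 g S)).hom) ≫
          ten R (sig f g).inv S := by
        rw [h']; exact (Category.id_comp _).symm
    _ = (sig (lay R f 1) (lay 1 g S)).inv ≫ ten R (sig f g).hom S ≫ ten R (sig f g).inv S := by
        rw [ten_sig]; exact Category.assoc _ _ _
    _ = _ := (congrArg ((sig (lay R f 1) (lay 1 g S)).inv ≫ ·) h).trans (Category.comp_id _)

theorem sig_mid_inv (f : Hom1 P P') (R : Ob V) (g : Hom1 Q Q') :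
    (sig (lay 1 f R) g).inv = (sig f (lay R g 1)).inv := by
  have h : sig (lay 1 f R) g = sig f (lay R g 1) := Iso.ext (sig_mid f R g)
  rw [h]

theorem sig_comp_left_inv (f : Hom1 P P') (f' : Hom1 P' P'') (g : Hom1 Q Q') :
    (sig (f ⨾ f') g).inv = wh (lay 1 f Q) (sig f' g).inv (one _) ≫
      wh (one _) (sig f g).inv (lay 1 f' Q') := by
  have h : sig (f ⨾ f') g = whI (one _) (sig f g) (lay 1 f' Q') ≪≫
      whI (lay 1 f Q) (sig f' g) (one _) := Iso.ext (sig_comp_left f f' g)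
  rw [h]; rfl

theorem sig_comp_right_inv (f : Hom1 P P') (g : Hom1 Q Q') (g' : Hom1 Q' Q'') :
    (sig f (g ⨾ g')).inv = wh (one _) (sig f g).inv (lay P' g' 1) ≫
      wh (lay P g 1) (sig f g').inv (one _) := by
  have h : sig f (g ⨾ g') = whI (lay P g 1) (sig f g') (one _) ≪≫
      whI (one _) (sig f g) (lay P' g' 1) := Iso.ext (sig_comp_right f g g')
  rw [h]; rfl

theorem sig_one_left_inv (P : Ob V) (g : Hom1 Q Q') : (sig (one P) g).inv = 𝟙 (lay P g 1) := by
  have h : sig (one P) g = Iso.refl _ := Iso.ext (sig_one_left P g)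
  rw [h]; rfl

theorem sig_nat_left_inv {f f' : Hom1 P P'} (η : f ⟶ f') (g : Hom1 Q Q') :
    (sig f g).inv ≫ wh (lay P g 1) (ten 1 η Q') (one _) =
      wh (one _) (ten 1 η Q) (lay P' g 1) ≫ (sig f' g).inv := by
  rw [Iso.inv_comp_eq, ← Category.assoc, Iso.eq_comp_inv]
  exact sig_nat_left η g

theorem sig_nat_right_inv (f : Hom1 P P') {g g' : Hom1 Q Q'} (θ : g ⟶ g') :
    (sig f g).inv ≫ wh (one _) (ten P θ 1) (lay 1 f Q') =
      wh (lay 1 f Q) (ten P' θ 1) (one _) ≫ (sig f g').inv := by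
  rw [Iso.inv_comp_eq, ← Category.assoc, Iso.eq_comp_inv]
  exact sig_nat_right f θ

/-- Naturality of interchangers in the form of a square. -/
theorem sig_square (f : Hom1 P P') {g₁ : Hom1 Q Q₁} {g₂ : Hom1 Q₁ Q'} {h₁ : Hom1 Q Q₂}
    {h₂ : Hom1 Q₂ Q'} (θ : g₁ ⨾ g₂ ⟶ h₁ ⨾ h₂) :
    wh (one _) (sig f g₁).hom (lay P' g₂ 1) ≫ wh (lay 1 f Q) (ten P' θ 1) (one _) ≫
        wh (one _) (sig f h₁).inv (lay P' h₂ 1) =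
      wh (lay P g₁ 1) (sig f g₂).inv (one _) ≫ wh (one _) (ten P θ 1) (lay 1 f Q') ≫
        wh (lay P h₁ 1) (sig f h₂).hom (one _) := by
  have h := sig_nat_right f θ
  rw [sig_comp_right, sig_comp_right] at h
  exact iso_square (whI (lay P g₁ 1) (sig f g₂) (one _))
    (whI (one _) (sig f h₁) (lay P' h₂ 1)) h.symm

end

section

variable {A A' A'' A₃ D D' D'' D₃ B B' B'' C C' C'' : Ob V}

/-- The tensor product of 1-cells. -/
def T (f : Hom1 A A') (g : Hom1 D D') : Hom1 (A * D) (A' * D') := lay 1 f D ⨾ lay A' g 1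

/-- The tensor product of 2-cells. -/
def T₂ {f f' : Hom1 A A'} {g g' : Hom1 D D'} (η : f ⟶ f') (θ : g ⟶ g') : T f g ⟶ T f' g' :=
  wh (one _) (ten 1 η D) (lay A' g 1) ≫ wh (lay 1 f' D) (ten A' θ 1) (one _)

/-- Compatibility of the tensor product with composition. -/
def tc (f : Hom1 A A') (f' : Hom1 A' A'') (g : Hom1 D D') (g' : Hom1 D' D'') :
    T f g ⨾ T f' g' ≅ T (f ⨾ f') (g ⨾ g') :=
  whI (lay 1 f D) (sig f' g) (lay A'' g' 1)

/-- Either bracketing performs the interchangers of `f'` with `g`, of `f''` with `g'` and of `f''`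
with `g`. The orders differ only in the first two, which are disjoint. -/
theorem tc_assoc (f : Hom1 A A') (f' : Hom1 A' A'') (f'' : Hom1 A'' A₃)
    (g : Hom1 D D') (g' : Hom1 D' D'') (g'' : Hom1 D'' D₃) :
    wh (one _) (tc f f' g g').hom (T f'' g'') ≫ (tc (f ⨾ f') f'' (g ⨾ g') g'').hom =
      wh (T f g) (tc f' f'' g' g'').hom (one _) ≫ (tc f (f' ⨾ f'') g (g' ⨾ g'')).hom := by
  simp only [tc, whI_hom, T, wh_wh, wh_comp, sig_comp_left, sig_comp_right]
  have := xch (lay 1 f D) (sig f' g).hom (one _) (sig f'' g').hom (lay A₃ g'' 1)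
  erw [reassoc_of% this]
  rfl

/-- The two middle cells act on different tensor factors and commute. -/
theorem T₂_comp {f f' f'' : Hom1 A A'} {g g' g'' : Hom1 D D'} (η : f ⟶ f') (η' : f' ⟶ f'')
    (θ : g ⟶ g') (θ' : g' ⟶ g'') : T₂ (η ≫ η') (θ ≫ θ') = T₂ η θ ≫ T₂ η' θ' := by
  simp only [T₂, T, ten_comp, wh_comp, Category.assoc]
  have := xch (one _) (ten 1 η' D) (one _) (ten A' θ 1) (one _)
  erw [reassoc_of% this]

/-- The interchanger in `tc` involves `g₁` but not `f₁`: `θ` passes it by naturality, while `η` is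
disjoint from it. In `tc_nat_right` the roles are exchanged. -/
theorem tc_nat_left {f₁ f₂ : Hom1 A A'} {g₁ g₂ : Hom1 D D'} (η : f₁ ⟶ f₂) (θ : g₁ ⟶ g₂)
    (f : Hom1 A' A'') (g : Hom1 D' D'') :
    wh (one _) (T₂ η θ) (T f g) ≫ (tc f₂ f g₂ g).hom =
      (tc f₁ f g₁ g).hom ≫ T₂ (wh (one _) η f) (wh (one _) θ g) := by
  simp only [tc, T₂, whI_hom, T, wh_wh, wh_comp, ten_wh, Category.assoc]
  have h₁ := congrArg (fun z => wh (lay 1 f₂ D) z (lay A'' g 1)) (sig_nat_right f θ)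
  have h₂ := xch (one _) (ten 1 η D) (one _) (sig f g₁).hom (lay A'' g 1)
  simp only [wh_comp, wh_wh] at h₁
  erw [h₁, reassoc_of% h₂]
  rfl

theorem tc_nat_right {f₁ f₂ : Hom1 A' A''} {g₁ g₂ : Hom1 D' D''} (η : f₁ ⟶ f₂) (θ : g₁ ⟶ g₂)
    (f : Hom1 A A') (g : Hom1 D D') :
    wh (T f g) (T₂ η θ) (one _) ≫ (tc f f₂ g g₂).hom =
      (tc f f₁ g g₁).hom ≫ T₂ (wh f η (one _)) (wh g θ (one _)) := by
  simp only [tc, T₂, whI_hom, T, wh_wh, wh_comp, ten_wh, Category.assoc]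
  have h₁ := congrArg (fun z => wh (lay 1 f D) z (lay A'' g₁ 1)) (sig_nat_left η g)
  have h₂ := xch (lay 1 f D) (sig f₂ g).hom (one _) (ten A'' θ 1) (one _)
  simp only [wh_comp, wh_wh] at h₁
  erw [← h₂, reassoc_of% h₁]
  rfl

theorem tc_one_left (f : Hom1 A A') (g : Hom1 D D') :
    (tc (one A) f (one D) g).hom = 𝟙 (T f g) := by
  simp only [tc, whI_hom, sig_one_right, T]
  exact wh_id _ _ _

end

end Hom1

end

/-! ### The middle exchange and its crossings. -/

section

variable {V : Type u} [Bicategory.{w, v} V] [Bicategory.Strict V] [GrayMonoid V]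
  [BraidedGrayMonoid V]

namespace Hom1

section

variable {A A' A'' A₃ D D' D'' D₃ B B' B'' C C' C'' : Ob V}

/-- The middle exchange `1 ⊗ β ⊗ 1`. -/
def χ (A D B C : Ob V) : Hom1 (A * (D * (B * C))) (A * (B * (D * C))) := lay A (bc D B) C

/-- The crossing of `f ⊗ g ⊗ 1 ⊗ 1` and `1 ⊗ β ⊗ 1`. -/
def chl (f : Hom1 A A') (g : Hom1 D D') (B C : Ob V) :
    lay 1 (T f g) (B * C) ⨾ χ A' D' B C ≅ χ A D B C ⨾ (T (lay 1 f B) (lay 1 g C) :) :=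
  whI (lay 1 f (D * (B * C))) (tenI A' (bl g B) C) (one _) ≪≫
    whI (one _) (sig f (lay 1 (bc D B) C)).symm (lay (A' * B) g C)

/-- The crossing of `1 ⊗ 1 ⊗ f ⊗ g` and `1 ⊗ β ⊗ 1`. -/
def chr (A D : Ob V) (f : Hom1 B B') (g : Hom1 C C') :
    lay (A * D) (T f g) 1 ⨾ χ A D B' C' ≅ χ A D B C ⨾ (T (lay A f 1) (lay D g 1) :) :=
  whI (lay (A * D) f C) (tenI A (sig (bc D B') g) 1) (one _) ≪≫
    whI (one _) (tenI A (br D f) C) (lay (A * (B' * D)) g 1)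

/-- A composite crosses in two stages; the only new ingredient is the interchanger of `f'` and `g`,
which must itself cross the exchange. -/
theorem chl_comp (f : Hom1 A A') (f' : Hom1 A' A'') (g : Hom1 D D') (g' : Hom1 D' D'')
    (B C : Ob V) :
    wh (one _) (ten 1 (tc f f' g g').hom (B * C)) (χ A'' D'' B C) ≫
        (chl (f ⨾ f') (g ⨾ g') B C).hom =
      wh (lay 1 (T f g) (B * C)) (chl f' g' B C).hom (one _) ≫
        wh (one _) (chl f g B C).hom (T (lay 1 f' B) (lay 1 g' C) :) ≫
        wh (χ A D B C) (tc (lay 1 f B) (lay 1 f' B) (lay 1 g C) (lay 1 g' C)).hom (one _) := by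
  simp only [tc, whI_hom, T, chl, χ, Iso.trans_hom, tenI_hom, Iso.symm_hom, bl_comp,
    sig_comp_left_inv, wh_comp, ten_comp, wh_wh, ten_wh, ten_sig, Category.assoc]
  have h₁ := xch (lay 1 f (D * (B * C))) (sig f' (lay 1 g (B * C))).hom (one _)
    (ten A'' (bl g' B).hom C) (one _)
  -- Naturality of `Σ_{f',-}` at the pseudonaturality cell of `g` carries this interchanger to the
  -- other side of the braiding.
  have h₂ := sig_square f' (g₁ := lay 1 g (B * C)) (g₂ := lay 1 (bc D' B) C)
    (h₁ := lay 1 (bc D B) C) (h₂ := lay B g C) (ten 1 (bl g B).hom C)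
  replace h₂ := congrArg (fun z => wh (lay 1 f _) z (lay (A'' * B) g' C)) h₂
  simp only [wh_comp, wh_wh, ten_ten] at h₂
  have h₃ := xch (one _) (sig f (lay 1 (bc D B) C)).inv (one _) (sig f' (lay B g C)).hom
    (lay (A'' * B) g' C)
  erw [sig_mid f' B (lay 1 g C), h₃, reassoc_of% h₁, reassoc_of% h₂]
  rfl

/-- The cells meet different parts of the crossing: `θ` only the pseudonaturality of `β`, `η` only
the interchanger. -/
theorem chl_nat {f f' : Hom1 A A'} {g g' : Hom1 D D'} (η : f ⟶ f') (θ : g ⟶ g') (B C : Ob V) :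
    wh (one _) (ten 1 (T₂ η θ) (B * C)) (χ A' D' B C) ≫ (chl f' g' B C).hom =
      (chl f g B C).hom ≫ wh (χ A D B C) (T₂ (ten 1 η B) (ten 1 θ C) :) (one _) := by
  simp only [T₂, whI_hom, T, chl, χ, Iso.trans_hom, tenI_hom, Iso.symm_hom,
    wh_comp, ten_comp, wh_wh, ten_wh, ten_ten, Category.assoc]
  have h₁ := congrArg (fun z => wh (lay 1 f' _) (ten A' z C) (one _)) (bl_nat θ B)
  have h₂ := xch (one _) (sig f' (lay 1 (bc D B) C)).inv (one _) (ten (A' * B) θ C) (one _)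
  have h₃ := xch (one _) (ten 1 η (D * (B * C))) (one _) (ten A' (bl g B).hom C) (one _)
  have h₄ := congrArg (fun z => wh (one _) z (lay (A' * B) g C))
    (sig_nat_left_inv η (lay 1 (bc D B) C))
  simp only [wh_comp, wh_wh, ten_comp, ten_wh, ten_ten] at h₁ h₄
  erw [reassoc_of% h₁, ← h₂, reassoc_of% h₃, ← reassoc_of% h₄]
  rfl

theorem chr_comp (A D : Ob V) (f : Hom1 B B') (f' : Hom1 B' B'') (g : Hom1 C C')
    (g' : Hom1 C' C'') :
    wh (one _) (ten (A * D) (tc f f' g g').hom 1) (χ A D B'' C'') ≫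
        (chr A D (f ⨾ f') (g ⨾ g')).hom =
      wh (lay (A * D) (T f g) 1) (chr A D f' g').hom (one _) ≫
        wh (one _) (chr A D f g).hom (T (lay A f' 1) (lay D g' 1) :) ≫
        wh (χ A D B C) (tc (lay A f 1) (lay A f' 1) (lay D g 1) (lay D g' 1)).hom (one _) := by
  simp only [tc, whI_hom, T, chr, χ, Iso.trans_hom, tenI_hom, br_comp,
    sig_comp_right, wh_comp, ten_comp, wh_wh, ten_wh, ten_sig, Category.assoc]
  have h₁ := xch (lay (A * D) f C) (sig (lay (A * D) f' 1) g).hom (one _)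
    (sig (lay A (bc D B'') 1) g').hom (one _)
  -- Since `g` stands to the right of the braiding, it is naturality of `Σ_{-,g}` at the cell of
  -- `f'` that carries the interchanger across.
  have h₂ := sig_nat_left (f := lay (A * D) f' 1 ⨾ lay A (bc D B'') 1)
    (f' := lay A (bc D B') 1 ⨾ lay A f' D) (ten A (br D f').hom 1) g
  rw [sig_comp_left, sig_comp_left] at h₂
  replace h₂ := congrArg (fun z => wh (lay (A * D) f C) z (lay (A * (B'' * D)) g' 1)) h₂
  simp only [wh_comp, wh_wh, ten_ten, Category.assoc] at h₂
  have h₃ := xch (one _) (ten A (br D f).hom C) (one _) (sig (lay A f' D) g).hom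
    (lay (A * (B'' * D)) g' 1)
  erw [← sig_mid (lay A f' 1) D g]
  erw [h₃, reassoc_of% h₁, ← reassoc_of% h₂]
  rfl

theorem chr_nat (A D : Ob V) {f f' : Hom1 B B'} {g g' : Hom1 C C'} (η : f ⟶ f') (θ : g ⟶ g') :
    wh (one _) (ten (A * D) (T₂ η θ) 1) (χ A D B' C') ≫ (chr A D f' g').hom =
      (chr A D f g).hom ≫ wh (χ A D B C) (T₂ (ten A η 1) (ten D θ 1) :) (one _) := by
  simp only [T₂, whI_hom, T, chr, χ, Iso.trans_hom, tenI_hom,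
    wh_comp, ten_comp, wh_wh, ten_wh, ten_ten, Category.assoc]
  have h₁ := congrArg (fun z => wh (lay (A * D) f' C) (ten A z 1) (one _))
    (sig_nat_right (bc D B') θ)
  have h₂ := xch (one _) (ten A (br D f').hom C) (one _) (ten (A * (B' * D)) θ 1) (one _)
  have h₃ := xch (one _) (ten (A * D) η C) (one _) (ten A (sig (bc D B') g).hom 1) (one _)
  have h₄ := congrArg (fun z => wh (one _) (ten A z C) (lay (A * (B' * D)) g 1)) (br_nat D η)
  simp only [wh_comp, wh_wh, ten_comp, ten_wh, ten_ten] at h₁ h₄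
  erw [reassoc_of% h₁, ← h₂, reassoc_of% h₃, reassoc_of% h₄]
  rfl

theorem wh_ten_id {P Q T U : Ob V} (a : Hom1 P (A * (Q * B))) (f : Hom1 Q T)
    (b : Hom1 (A * (T * B)) U) : wh a (ten A (𝟙 f) B) b = 𝟙 (a ⨾ lay A f B ⨾ b) := by
  rw [ten_id, wh_id]

/-- Needed for the unitors: they end at identity 1-cells, whose crossing must be trivial. -/
theorem chl_one (A D B C : Ob V) : (chl (one A) (one D) B C).hom = 𝟙 (χ A D B C) := by
  have h₁ : wh (one _) (ten A (bl (one D) B).hom C) (one _) = 𝟙 (χ A D B C) :=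
    (congrArg (fun z : bc D B ⟶ bc D B => wh (one _) (ten A z C) (one _)) (bl_one D B)).trans
      (wh_ten_id (A := A) (B := C) (one _) (bc D B) (one _))
  have h₂ : wh (one _) (sig (one A) (lay 1 (bc D B) C)).inv (one _) = 𝟙 (χ A D B C) :=
    (congrArg (fun z : χ A D B C ⟶ χ A D B C => wh (one _) z (one _)) (sig_one_left_inv _ _)).trans
      (wh_id (one _) (χ A D B C) (one _))
  exact (congrArg₂ (fun x y : χ A D B C ⟶ χ A D B C => x ≫ y) h₁ h₂).trans (Category.id_comp _)

theorem chr_one (A D B C : Ob V) : (chr A D (one B) (one C)).hom = 𝟙 (χ A D B C) := by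
  have h₁ : wh (one _) (ten A (sig (bc D B) (one C)).hom 1) (one _) = 𝟙 (χ A D B C) :=
    (congrArg (fun z : lay 1 (bc D B) C ⟶ lay 1 (bc D B) C => wh (one _) (ten A z 1) (one _))
      (sig_one_right _ _)).trans (wh_ten_id (A := A) (B := 1) (one _) (lay 1 (bc D B) C) (one _))
  have h₂ : wh (one _) (ten A (br D (one B)).hom C) (one _) = 𝟙 (χ A D B C) :=
    (congrArg (fun z : bc D B ⟶ bc D B => wh (one _) (ten A z C) (one _)) (br_one D B)).trans
      (wh_ten_id (A := A) (B := C) (one _) (bc D B) (one _))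
  exact (congrArg₂ (fun x y : χ A D B C ⟶ χ A D B C => x ≫ y) h₁ h₂).trans (Category.id_comp _)

end

end Hom1

end

/-! ### The comparison `Om` of braidings and its naturality. -/

section

variable {V : Type u} [Bicategory.{w, v} V] [Bicategory.Strict V] [GrayMonoid V]

theorem iso_flip {C : Type u} [Category.{v} C] {a b c d e : C} (r : b ≅ c) (r' : a ≅ d)
    {x : a ⟶ b} {y : d ⟶ e} {z : e ⟶ c} (h : x ≫ r.hom = r'.hom ≫ y ≫ z) :
    y ≫ z ≫ r.inv = r'.inv ≫ x := by
  rw [Iso.eq_inv_comp, ← Category.assoc, ← Category.assoc, Iso.comp_inv_eq, h, Category.assoc]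

namespace Hom1

section

variable {P P' P₁ P₂ Q Q' Q₁ Q₂ S S' : Ob V}

/-- Naturality of the interchanger at a cell between two-step composites, with the interchangers of
the composites expanded. The variants differ in the side and the direction of the interchangers. -/
theorem sig_left_square_inv {f₁ : Hom1 P P₁} {f₂ : Hom1 P₁ P'} {h₁ : Hom1 P P₂} {h₂ : Hom1 P₂ P'}
    (θ : f₁ ⨾ f₂ ⟶ h₁ ⨾ h₂) (g : Hom1 Q Q') :
    wh (one _) (ten 1 θ Q) (lay P' g 1) ≫ wh (lay 1 h₁ Q) (sig h₂ g).inv (one _) ≫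
        wh (one _) (sig h₁ g).inv (lay 1 h₂ Q') =
      wh (lay 1 f₁ Q) (sig f₂ g).inv (one _) ≫ wh (one _) (sig f₁ g).inv (lay 1 f₂ Q') ≫
        wh (lay P g 1) (ten 1 θ Q') (one _) := by
  have h := sig_nat_left_inv θ g
  rw [sig_comp_left_inv, sig_comp_left_inv, Category.assoc] at h
  exact h.symm

theorem sig_right_square_inv (f : Hom1 P P') {g₁ : Hom1 Q Q₁} {g₂ : Hom1 Q₁ Q'} {h₁ : Hom1 Q Q₂}
    {h₂ : Hom1 Q₂ Q'} (θ : g₁ ⨾ g₂ ⟶ h₁ ⨾ h₂) :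
    wh (one _) (sig f g₁).inv (lay P' g₂ 1) ≫ wh (lay P g₁ 1) (sig f g₂).inv (one _) ≫
        wh (one _) (ten P θ 1) (lay 1 f Q') =
      wh (lay 1 f Q) (ten P' θ 1) (one _) ≫ wh (one _) (sig f h₁).inv (lay P' h₂ 1) ≫
        wh (lay P h₁ 1) (sig f h₂).inv (one _) := by
  have h := sig_nat_right_inv f θ
  rw [sig_comp_right_inv, sig_comp_right_inv, Category.assoc] at h
  exact h

theorem sig_left_square {f₁ : Hom1 P P₁} {f₂ : Hom1 P₁ P'} {h₁ : Hom1 P P₂} {h₂ : Hom1 P₂ P'}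
    (θ : f₁ ⨾ f₂ ⟶ h₁ ⨾ h₂) (g : Hom1 Q Q') :
    wh (one _) (sig f₁ g).hom (lay 1 f₂ Q') ≫ wh (lay 1 f₁ Q) (sig f₂ g).hom (one _) ≫
        wh (one _) (ten 1 θ Q) (lay P' g 1) =
      wh (lay P g 1) (ten 1 θ Q') (one _) ≫ wh (one _) (sig h₁ g).hom (lay 1 h₂ Q') ≫
        wh (lay 1 h₁ Q) (sig h₂ g).hom (one _) := by
  have h := sig_nat_left θ g
  rw [sig_comp_left, sig_comp_left, Category.assoc] at h
  exact h.symm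

variable [BraidedGrayMonoid V]

theorem Rm_nat₁_inv (f : Hom1 P P') (Q S : Ob V) :
    wh (one _) (ten 1 (bl f Q).hom S) (lay Q (bc P' S) 1) ≫
        wh (lay 1 (bc P Q) S) (ten Q (bl f S).hom 1) (one _) ≫
        wh (one _) (Rm P Q S).inv (lay (Q * S) f 1) =
      wh (lay 1 f (Q * S)) (Rm P' Q S).inv (one _) ≫ (bl f (Q * S)).hom :=
  iso_flip (whI (one _) (Rm P Q S) (lay (Q * S) f 1)) (whI (lay 1 f (Q * S)) (Rm P' Q S) (one _))
    (Rm_nat₁ f Q S)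

theorem Rm_nat₂_inv (P : Ob V) (g : Hom1 Q Q') (S : Ob V) :
    wh (one _) (ten 1 (br P g).hom S) (lay Q' (bc P S) 1) ≫
        wh (lay 1 (bc P Q) S) (sig g (bc P S)).inv (one _) ≫
        wh (one _) (Rm P Q S).inv (lay 1 g (S * P)) =
      wh (lay P g S) (Rm P Q' S).inv (one _) ≫ (br P (lay 1 g S)).hom :=
  iso_flip (whI (one _) (Rm P Q S) (lay 1 g (S * P))) (whI (lay P g S) (Rm P Q' S) (one _))
    (Rm_nat₂ P g S)

theorem Rm_nat₃_inv (P Q : Ob V) (h : Hom1 S S') :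
    wh (one _) (sig (bc P Q) h).hom (lay Q (bc P S') 1) ≫
        wh (lay 1 (bc P Q) S) (ten Q (br P h).hom 1) (one _) ≫
        wh (one _) (Rm P Q S).inv (lay Q h P) =
      wh (lay (P * Q) h 1) (Rm P Q S').inv (one _) ≫ (br P (lay Q h 1)).hom :=
  iso_flip (whI (one _) (Rm P Q S) (lay Q h P)) (whI (lay (P * Q) h 1) (Rm P Q S') (one _))
    (Rm_nat₃ P Q h)

/-- The comparison of the two ways of exchanging `D₃ A₂ D₂ A₁` to `A₂ A₁ D₃ D₂`. -/
def Om (D₃ A₂ D₂ A₁ : Ob V) :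
    lay 1 (bc D₃ A₂) (D₂ * A₁) ⨾ lay A₂ (bc (D₃ * D₂) A₁) 1 ≅
      lay (D₃ * A₂) (bc D₂ A₁) 1 ⨾ lay 1 (bc D₃ (A₂ * A₁)) D₂ :=
  whI (lay 1 (bc D₃ A₂) (D₂ * A₁)) (tenI A₂ (Sm D₃ D₂ A₁) 1) (one _) ≪≫
    whI (one _) (sig (bc D₃ A₂) (bc D₂ A₁)).symm (lay A₂ (bc D₃ A₁) D₂) ≪≫
    whI (lay (D₃ * A₂) (bc D₂ A₁) 1) (tenI 1 (Rm D₃ A₂ A₁).symm D₂) (one _)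

variable {A₁ A₁' A₂ A₂' A₃ A₃' D₁ D₁' D₂ D₂' D₃ D₃' : Ob V}

/-- The 1-cell is pushed through the three factors of `Om` in turn: `S`, the interchanger of
braidings, `R⁻¹`. Between these steps independent cells are reordered by `xch`. The other three
variables follow the same pattern, each with the naturality laws of its own position. -/
theorem Om_nat₁ (f : Hom1 D₃ D₃') (A₂ D₂ A₁ : Ob V) :
    wh (one _) (ten 1 (bl f A₂).hom (D₂ * A₁)) (lay A₂ (bc (D₃' * D₂) A₁) 1) ≫
        wh (lay 1 (bc D₃ A₂) (D₂ * A₁)) (ten A₂ (bl (lay 1 f D₂) A₁).hom 1) (one _) ≫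
        wh (one _) (Om D₃ A₂ D₂ A₁).hom (lay (A₂ * A₁) f D₂) =
      wh (lay 1 f (A₂ * (D₂ * A₁))) (Om D₃' A₂ D₂ A₁).hom (one _) ≫
        wh (one _) (sig f (lay A₂ (bc D₂ A₁) 1)).inv (lay 1 (bc D₃' (A₂ * A₁)) D₂) ≫
        wh (lay (D₃ * A₂) (bc D₂ A₁) 1) (ten 1 (bl f (A₂ * A₁)).hom D₂) (one _) := by
  simp only [Om, Iso.trans_hom, whI_hom, tenI_hom, Iso.symm_hom, wh_comp, wh_wh, Category.assoc]
  have h₁ := congrArg (fun z => wh (lay 1 (bc D₃ A₂) (D₂ * A₁)) (ten A₂ z 1) (one _))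
    (Sm_nat₁ f D₂ A₁)
  have h₂ := xch (one _) (ten 1 (bl f A₂).hom (D₂ * A₁)) (one _)
    (ten A₂ (Sm D₃' D₂ A₁).hom 1) (one _)
  have h₃ := xch (one _) (sig (bc D₃ A₂) (bc D₂ A₁)).inv (one _)
    (ten A₂ (bl f A₁).hom D₂) (one _)
  have h₄ := congrArg (fun z => wh (one _) z (lay A₂ (bc D₃' A₁) D₂))
    (sig_left_square_inv (bl f A₂).hom (bc D₂ A₁))
  have h₅ := congrArg (fun z => wh (lay (D₃ * A₂) (bc D₂ A₁) 1) (ten 1 z D₂) (one _))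
    (Rm_nat₁_inv f A₂ A₁)
  have h₆ := xch (one _) (sig f (lay A₂ (bc D₂ A₁) 1)).inv (one _)
    (ten 1 (Rm D₃' A₂ A₁).inv D₂) (one _)
  simp only [wh_comp, wh_wh, ten_comp, ten_wh, ten_ten, ten_sig_inv, sig_mid_inv] at h₁ h₄ h₅
  erw [reassoc_of% h₁]
  erw [reassoc_of% h₂]
  erw [← reassoc_of% h₃]
  erw [reassoc_of% h₄]
  erw [h₅]
  erw [← reassoc_of% h₆]
  rfl

theorem Om_nat₂ (D₃ : Ob V) (f : Hom1 A₂ A₂') (D₂ A₁ : Ob V) :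
    wh (one _) (ten 1 (br D₃ f).hom (D₂ * A₁)) (lay A₂' (bc (D₃ * D₂) A₁) 1) ≫
        wh (lay 1 (bc D₃ A₂) (D₂ * A₁)) (sig f (bc (D₃ * D₂) A₁)).inv (one _) ≫
        wh (one _) (Om D₃ A₂ D₂ A₁).hom (lay 1 f (A₁ * (D₃ * D₂))) =
      wh (lay D₃ f (D₂ * A₁)) (Om D₃ A₂' D₂ A₁).hom (one _) ≫
        wh (one _) (sig (lay D₃ f 1) (bc D₂ A₁)).inv (lay 1 (bc D₃ (A₂' * A₁)) D₂) ≫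
        wh (lay (D₃ * A₂) (bc D₂ A₁) 1) (ten 1 (br D₃ (lay 1 f A₁)).hom D₂) (one _) := by
  simp only [Om, Iso.trans_hom, whI_hom, tenI_hom, Iso.symm_hom, wh_comp, wh_wh, Category.assoc]
  -- `A₂` takes no part in `S`, so `f` passes this factor by interchangers alone.
  have h₁ := sig_nat_right_inv f (Sm D₃ D₂ A₁).hom
  rw [sig_comp_right_inv] at h₁
  replace h₁ := congrArg (fun z => wh (lay 1 (bc D₃ A₂) (D₂ * A₁)) z (one _)) h₁
  have h₂ := xch (one _) (ten 1 (br D₃ f).hom (D₂ * A₁)) (one _)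
    (ten A₂' (Sm D₃ D₂ A₁).hom 1) (one _)
  have h₃ := xch (one _) (sig (bc D₃ A₂) (bc D₂ A₁)).inv (one _)
    (sig f (lay 1 (bc D₃ A₁) D₂)).inv (one _)
  have h₄ := congrArg (fun z => wh (one _) z (lay A₂' (bc D₃ A₁) D₂))
    (sig_left_square_inv (br D₃ f).hom (bc D₂ A₁))
  have h₅ := congrArg (fun z => wh (lay (D₃ * A₂) (bc D₂ A₁) 1) (ten 1 z D₂) (one _))
    (Rm_nat₂_inv D₃ f A₁)
  have h₆ := xch (one _) (sig (lay D₃ f 1) (bc D₂ A₁)).inv (one _)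
    (ten 1 (Rm D₃ A₂' A₁).inv D₂) (one _)
  simp only [wh_comp, wh_wh, ten_comp, ten_wh, ten_ten, ten_sig_inv, sig_mid_inv] at h₁ h₄ h₅
  erw [reassoc_of% h₁]
  erw [reassoc_of% h₂]
  erw [← reassoc_of% h₃]
  erw [reassoc_of% h₄]
  erw [h₅]
  erw [← reassoc_of% h₆]
  rfl

theorem Om_nat₃ (D₃ A₂ : Ob V) (f : Hom1 D₂ D₂') (A₁ : Ob V) :
    wh (one _) (sig (bc D₃ A₂) (lay 1 f A₁)).hom (lay A₂ (bc (D₃ * D₂') A₁) 1) ≫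
        wh (lay 1 (bc D₃ A₂) (D₂ * A₁)) (ten A₂ (bl (lay D₃ f 1) A₁).hom 1) (one _) ≫
        wh (one _) (Om D₃ A₂ D₂ A₁).hom (lay (A₂ * (A₁ * D₃)) f 1) =
      wh (lay (D₃ * A₂) f A₁) (Om D₃ A₂ D₂' A₁).hom (one _) ≫
        wh (one _) (ten (D₃ * A₂) (bl f A₁).hom 1) (lay 1 (bc D₃ (A₂ * A₁)) D₂') ≫
        wh (lay (D₃ * A₂) (bc D₂ A₁) 1) (sig (bc D₃ (A₂ * A₁)) f).hom (one _) := by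
  simp only [Om, Iso.trans_hom, whI_hom, tenI_hom, Iso.symm_hom, wh_comp, wh_wh, Category.assoc]
  have h₁ := congrArg (fun z => wh (lay 1 (bc D₃ A₂) (D₂ * A₁)) (ten A₂ z 1) (one _))
    (Sm_nat₂ D₃ f A₁)
  have h₂ := xch (one _) (sig (bc D₃ A₂) (lay 1 f A₁)).hom (one _)
    (ten A₂ (Sm D₃ D₂' A₁).hom 1) (one _)
  have h₃ := xch (one _) (sig (bc D₃ A₂) (bc D₂ A₁)).inv (one _)
    (sig (lay A₂ (bc D₃ A₁) 1) f).hom (one _)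
  have h₄ := congrArg (fun z => wh (one _) z (lay A₂ (bc D₃ A₁) D₂'))
    (sig_square (bc D₃ A₂) (bl f A₁).hom)
  -- `D₂` takes no part in `R`, so `f` passes this factor by interchangers alone.
  have h₅ := sig_nat_left (Rm D₃ A₂ A₁).inv f
  rw [sig_comp_left] at h₅
  replace h₅ := congrArg (fun z => wh (lay (D₃ * A₂) (bc D₂ A₁) 1) z (one _)) h₅.symm
  have h₆ := xch (one _) (ten (D₃ * A₂) (bl f A₁).hom 1) (one _)
    (ten 1 (Rm D₃ A₂ A₁).inv D₂') (one _)
  simp only [wh_comp, wh_wh, ten_comp, ten_wh, ten_ten, ten_sig, sig_mid,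
    Category.assoc] at h₁ h₄ h₅
  erw [reassoc_of% h₁]
  erw [reassoc_of% h₂]
  erw [← reassoc_of% h₃]
  erw [reassoc_of% h₄]
  erw [h₅]
  erw [← reassoc_of% h₆]
  rfl

theorem Om_nat₄ (D₃ A₂ D₂ : Ob V) (f : Hom1 A₁ A₁') :
    wh (one _) (sig (bc D₃ A₂) (lay D₂ f 1)).hom (lay A₂ (bc (D₃ * D₂) A₁') 1) ≫
        wh (lay 1 (bc D₃ A₂) (D₂ * A₁)) (ten A₂ (br (D₃ * D₂) f).hom 1) (one _) ≫
        wh (one _) (Om D₃ A₂ D₂ A₁).hom (lay A₂ f (D₃ * D₂)) =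
      wh (lay (D₃ * (A₂ * D₂)) f 1) (Om D₃ A₂ D₂ A₁').hom (one _) ≫
        wh (one _) (ten (D₃ * A₂) (br D₂ f).hom 1) (lay 1 (bc D₃ (A₂ * A₁')) D₂) ≫
        wh (lay (D₃ * A₂) (bc D₂ A₁) 1) (ten 1 (br D₃ (lay A₂ f 1)).hom D₂) (one _) := by
  simp only [Om, Iso.trans_hom, whI_hom, tenI_hom, Iso.symm_hom, wh_comp, wh_wh, Category.assoc]
  have h₁ := congrArg (fun z => wh (lay 1 (bc D₃ A₂) (D₂ * A₁)) (ten A₂ z 1) (one _))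
    (Sm_nat₃ D₃ D₂ f)
  have h₂ := xch (one _) (sig (bc D₃ A₂) (lay D₂ f 1)).hom (one _)
    (ten A₂ (Sm D₃ D₂ A₁').hom 1) (one _)
  have h₃ := xch (one _) (sig (bc D₃ A₂) (bc D₂ A₁)).inv (one _)
    (ten A₂ (br D₃ f).hom D₂) (one _)
  have h₄ := congrArg (fun z => wh (one _) z (lay A₂ (bc D₃ A₁') D₂))
    (sig_square (bc D₃ A₂) (br D₂ f).hom)
  have h₅ := congrArg (fun z => wh (lay (D₃ * A₂) (bc D₂ A₁) 1) (ten 1 z D₂) (one _))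
    (Rm_nat₃_inv D₃ A₂ f)
  have h₆ := xch (one _) (ten (D₃ * A₂) (br D₂ f).hom 1) (one _)
    (ten 1 (Rm D₃ A₂ A₁').inv D₂) (one _)
  simp only [wh_comp, wh_wh, ten_comp, ten_wh, ten_ten, ten_sig, sig_mid] at h₁ h₄ h₅
  erw [reassoc_of% h₁]
  erw [reassoc_of% h₂]
  erw [← reassoc_of% h₃]
  erw [reassoc_of% h₄]
  erw [h₅]
  erw [← reassoc_of% h₆]
  rfl

end

end Hom1

end

/-! ### Naturality of `om` in its three pairs of objects. -/

section

variable {V : Type u} [Bicategory.{w, v} V] [Bicategory.Strict V] [GrayMonoid V]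
  [BraidedGrayMonoid V]

namespace Hom1

section

variable {A₁ A₁' A₂ A₂' A₃ A₃' D₁ D₁' D₂ D₂' D₃ D₃' : Ob V}

/-- The comparison of the two ways of exchanging `A₃ D₃ A₂ D₂ A₁ D₁` to `A₃ A₂ A₁ D₃ D₂ D₁`. -/
def om (A₃ D₃ A₂ D₂ A₁ D₁ : Ob V) :
    lay 1 (χ A₃ D₃ A₂ D₂) (A₁ * D₁) ⨾ χ (A₃ * A₂) (D₃ * D₂) A₁ D₁ ≅
      lay (A₃ * D₃) (χ A₂ D₂ A₁ D₁) 1 ⨾ χ A₃ D₃ (A₂ * A₁) (D₂ * D₁) :=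
  tenI A₃ (Om D₃ A₂ D₂ A₁) D₁

/-- `A₃` stands to the left of every braiding, so `f` passes by interchangers; `g` passes by
`Om_nat₁`. -/
theorem om_nat₁ (f : Hom1 A₃ A₃') (g : Hom1 D₃ D₃') (A₂ D₂ A₁ D₁ : Ob V) :
    wh (one _) (ten 1 (chl f g A₂ D₂).hom (A₁ * D₁)) (χ (A₃' * A₂) (D₃' * D₂) A₁ D₁) ≫
        wh (lay 1 (χ A₃ D₃ A₂ D₂) (A₁ * D₁)) (chl (lay 1 f A₂) (lay 1 g D₂) A₁ D₁).hom (one _) ≫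
        wh (one _) (om A₃ D₃ A₂ D₂ A₁ D₁).hom
          (T (lay 1 f (A₂ * A₁)) (lay 1 g (D₂ * D₁)) :) =
      wh (lay 1 (T f g) (A₂ * (D₂ * (A₁ * D₁)))) (om A₃' D₃' A₂ D₂ A₁ D₁).hom (one _) ≫
        wh (one _) (sig (T f g) (χ A₂ D₂ A₁ D₁)).inv (χ A₃' D₃' (A₂ * A₁) (D₂ * D₁)) ≫
        wh (lay (A₃ * D₃) (χ A₂ D₂ A₁ D₁) 1) (chl f g (A₂ * A₁) (D₂ * D₁)).hom (one _) := by
  simp only [T, chl, χ, om, Iso.trans_hom, whI_hom, tenI_hom, Iso.symm_hom, wh_comp, wh_wh,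
    ten_comp, ten_wh, ten_ten, ten_sig_inv, sig_comp_left_inv, sig_mid_inv, Category.assoc]
  have h₁ := xch (one _) (sig f (lay 1 (bc D₃ A₂) (D₂ * (A₁ * D₁)))).inv (one _)
    (ten (A₃' * A₂) (bl (lay 1 g D₂) A₁).hom D₁) (one _)
  have h₂ := sig_right_square_inv f (g₁ := lay 1 (bc D₃ A₂) (D₂ * (A₁ * D₁)))
    (g₂ := lay A₂ (bc (D₃ * D₂) A₁) D₁) (h₁ := lay (D₃ * A₂) (bc D₂ A₁) D₁)
    (h₂ := lay 1 (bc D₃ (A₂ * A₁)) (D₂ * D₁)) (ten 1 (Om D₃ A₂ D₂ A₁).hom D₁)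
  replace h₂ := congrArg (fun z => wh (one _) z (lay (A₃' * (A₂ * A₁)) g (D₂ * D₁))) h₂
  have h₃ := congrArg (fun z => wh (lay 1 f (D₃ * (A₂ * (D₂ * (A₁ * D₁))))) (ten A₃' z D₁) (one _))
    (Om_nat₁ g A₂ D₂ A₁)
  have h₄ := xch (one _) (sig f (lay (D₃ * A₂) (bc D₂ A₁) D₁)).inv (one _)
    (ten A₃' (bl g (A₂ * A₁)).hom (D₂ * D₁)) (one _)
  simp only [wh_comp, wh_wh, ten_comp, ten_wh, ten_ten, ten_sig_inv] at h₂ h₃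
  erw [reassoc_of% h₁]
  erw [h₂]
  erw [reassoc_of% h₃]
  erw [← reassoc_of% h₄]
  rfl

/-- Both objects of the middle pair are braided: `f` passes by `Om_nat₂` and `g` by `Om_nat₃`. -/
theorem om_nat₂ (A₃ D₃ : Ob V) (f : Hom1 A₂ A₂') (g : Hom1 D₂ D₂') (A₁ D₁ : Ob V) :
    wh (one _) (ten 1 (chr A₃ D₃ f g).hom (A₁ * D₁)) (χ (A₃ * A₂') (D₃ * D₂') A₁ D₁) ≫
        wh (lay 1 (χ A₃ D₃ A₂ D₂) (A₁ * D₁)) (chl (lay A₃ f 1) (lay D₃ g 1) A₁ D₁).hom (one _) ≫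
        wh (one _) (om A₃ D₃ A₂ D₂ A₁ D₁).hom
          (T (lay A₃ f A₁) (lay D₃ g D₁) :) =
      wh (lay (A₃ * D₃) (T f g) (A₁ * D₁)) (om A₃ D₃ A₂' D₂' A₁ D₁).hom (one _) ≫
        wh (one _) (ten (A₃ * D₃) (chl f g A₁ D₁).hom 1) (χ A₃ D₃ (A₂' * A₁) (D₂' * D₁)) ≫
        wh (lay (A₃ * D₃) (χ A₂ D₂ A₁ D₁) 1) (chr A₃ D₃ (lay 1 f A₁) (lay 1 g D₁)).hom
          (one _) := by
  simp only [T, chl, chr, χ, om, Iso.trans_hom, whI_hom, tenI_hom, Iso.symm_hom, wh_comp, wh_wh,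
    ten_comp, ten_wh, ten_ten, ten_sig, ten_sig_inv, Category.assoc]
  have h₁ := xch (one _) (ten A₃ (br D₃ f).hom (D₂ * (A₁ * D₁))) (one _)
    (ten (A₃ * A₂') (bl (lay D₃ g 1) A₁).hom D₁) (one _)
  have h₂ := congrArg (fun z => wh (one _) (ten A₃ z D₁) (lay (A₃ * (A₂' * (A₁ * D₃))) g D₁))
    (Om_nat₂ D₃ f D₂ A₁)
  have h₃ := congrArg (fun z => wh (lay (A₃ * D₃) f (D₂ * (A₁ * D₁))) (ten A₃ z D₁) (one _))
    (Om_nat₃ D₃ A₂' g A₁)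
  have h₄ := xch (one _) (sig (lay (A₃ * D₃) f 1) (lay 1 (bc D₂ A₁) D₁)).inv (one _)
    (sig (lay A₃ (bc D₃ (A₂' * A₁)) 1) (lay 1 g D₁)).hom (one _)
  simp only [wh_comp, wh_wh, ten_comp, ten_wh, ten_ten, ten_sig_inv, ten_sig] at h₂ h₃
  erw [reassoc_of% h₁]
  erw [h₂]
  erw [reassoc_of% h₃]
  erw [← reassoc_of% h₄]
  rfl

/-- Here `f` passes by `Om_nat₄`, and `g` by interchangers, as `D₁` stands to the right of every
braiding. -/
theorem om_nat₃ (A₃ D₃ A₂ D₂ : Ob V) (f : Hom1 A₁ A₁') (g : Hom1 D₁ D₁') :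
    wh (one _) (sig (χ A₃ D₃ A₂ D₂) (T f g)).hom (χ (A₃ * A₂) (D₃ * D₂) A₁' D₁') ≫
        wh (lay 1 (χ A₃ D₃ A₂ D₂) (A₁ * D₁)) (chr (A₃ * A₂) (D₃ * D₂) f g).hom (one _) ≫
        wh (one _) (om A₃ D₃ A₂ D₂ A₁ D₁).hom
          (T (lay (A₃ * A₂) f 1) (lay (D₃ * D₂) g 1) :) =
      wh (lay (A₃ * (D₃ * (A₂ * D₂))) (T f g) 1) (om A₃ D₃ A₂ D₂ A₁' D₁').hom (one _) ≫
        wh (one _) (ten (A₃ * D₃) (chr A₂ D₂ f g).hom 1) (χ A₃ D₃ (A₂ * A₁') (D₂ * D₁')) ≫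
        wh (lay (A₃ * D₃) (χ A₂ D₂ A₁ D₁) 1) (chr A₃ D₃ (lay A₂ f 1) (lay D₂ g 1)).hom
          (one _) := by
  simp only [T, chr, χ, om, Iso.trans_hom, whI_hom, tenI_hom, wh_comp, wh_wh,
    ten_comp, ten_wh, ten_ten, ten_sig, sig_comp_right, Category.assoc]
  have h₁ := xch (one _) (sig (lay A₃ (bc D₃ A₂) D₂) (lay 1 f D₁)).hom (one _)
    (sig (lay (A₃ * A₂) (bc (D₃ * D₂) A₁') 1) g).hom (one _)
  have h₂ := congrArg (fun z => wh (one _) (ten A₃ z D₁) (lay (A₃ * (A₂ * (A₁' * (D₃ * D₂)))) g 1))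
    (Om_nat₄ D₃ A₂ D₂ f)
  have h₃ := sig_left_square (f₁ := lay A₃ (bc D₃ A₂) (D₂ * A₁'))
    (f₂ := lay (A₃ * A₂) (bc (D₃ * D₂) A₁') 1) (h₁ := lay (A₃ * (D₃ * A₂)) (bc D₂ A₁') 1)
    (h₂ := lay A₃ (bc D₃ (A₂ * A₁')) D₂) (ten A₃ (Om D₃ A₂ D₂ A₁').hom 1) g
  replace h₃ := congrArg (fun z => wh (lay (A₃ * (D₃ * (A₂ * D₂))) f D₁) z (one _)) h₃
  have h₄ := xch (one _) (ten (A₃ * (D₃ * A₂)) (br D₂ f).hom D₁) (one _)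
    (sig (lay A₃ (bc D₃ (A₂ * A₁')) D₂) g).hom (one _)
  simp only [wh_comp, wh_wh, ten_comp, ten_wh, ten_ten, ten_sig] at h₂ h₃
  -- The objects between the two members of an interchanger are reassigned by `sig_mid` to match the
  -- forms in which they occur in the other identities.
  have e₁ : (sig (lay A₃ (bc D₃ A₂) D₂) (lay 1 f D₁)).hom =
      (sig (lay A₃ (bc D₃ A₂) 1) (lay D₂ f D₁)).hom := sig_mid (lay A₃ (bc D₃ A₂) 1) D₂ (lay 1 f D₁)
  have e₂ : (sig (lay A₃ (bc D₃ A₂) D₂) (lay A₁' g 1)).hom =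
      (sig (lay A₃ (bc D₃ A₂) (D₂ * A₁')) g).hom :=
    (sig_mid (lay A₃ (bc D₃ A₂) D₂) A₁' g).symm
  have e₃ : (sig (lay A₃ (bc D₃ (A₂ * A₁')) D₂) g).hom =
      (sig (lay A₃ (bc D₃ (A₂ * A₁')) 1) (lay D₂ g 1)).hom :=
    sig_mid (lay A₃ (bc D₃ (A₂ * A₁')) 1) D₂ g
  erw [reassoc_of% h₁, e₁, e₂]
  erw [h₂]
  erw [reassoc_of% h₃]
  erw [← reassoc_of% h₄, e₃]
  rfl

end

/-! ### The cocycle law for braidings. -/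

section

theorem Rm_cocycle_inv (P Q S T : Ob V) :
    wh (lay 1 (bc P Q) (S * T)) (ten Q (Rm P S T).inv 1) (one _) ≫ (Rm P Q (S * T)).inv =
      wh (one _) (ten 1 (Rm P Q S).inv T) (lay (Q * S) (bc P T) 1) ≫ (Rm P (Q * S) T).inv := by
  have h : Rm P Q (S * T) ≪≫ whI (lay 1 (bc P Q) (S * T)) (tenI Q (Rm P S T) 1) (one _) =
      Rm P (Q * S) T ≪≫ whI (one _) (tenI 1 (Rm P Q S) T) (lay (Q * S) (bc P T) 1) :=
    Iso.ext (Rm_cocycle P Q S T)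
  exact congrArg Iso.inv h

theorem Om_hom (D₃ A₂ D₂ A₁ : Ob V) : (Om D₃ A₂ D₂ A₁).hom =
    wh (lay 1 (bc D₃ A₂) (D₂ * A₁)) (ten A₂ (Sm D₃ D₂ A₁).hom 1) (one _) ≫
      wh (one _) (sig (bc D₃ A₂) (bc D₂ A₁)).inv (lay A₂ (bc D₃ A₁) D₂) ≫
      wh (lay (D₃ * A₂) (bc D₂ A₁) 1) (ten 1 (Rm D₃ A₂ A₁).inv D₂) (one _) := rfl

variable (x a y b z c : Ob V)

/-- Both sides of the cocycle law are brought to one normal form: the two `S` cells that split `x *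
y * z` past `c`, interchangers pulling `bc z c` to the front, `Om x a y b` kept whole, one more
interchanger, then two `R⁻¹` cells. On this side BA2 is what is needed. -/
theorem Om_cocycle_left :
    wh (one _) (ten 1 (Om x a y b).hom (z * c)) (lay (a * b) (bc (x * (y * z)) c) 1) ≫
      wh (lay (x * a) (bc y b) (z * c)) (Om x (a * b) (y * z) c).hom (one _) ≫
      wh (one _) (ten (x * a) (Om y b z c).hom 1) (lay 1 (bc x (a * (b * c))) (y * z)) =
    wh (lay 1 (bc x a) (y * (b * (z * c))) ⨾ lay a (bc (x * y) b) (z * c))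
        (ten (a * b) (Sm (x * y) z c).hom 1) (one _) ≫
      wh (lay 1 (bc x a) (y * (b * (z * c))) ⨾ lay a (bc (x * y) b) (z * c) ⨾
          lay (a * (b * (x * y))) (bc z c) 1) (ten (a * b) (Sm x y c).hom z) (one _) ≫
      wh (lay 1 (bc x a) (y * (b * (z * c)))) (sig (lay a (bc (x * y) b) 1) (bc z c)).inv
        (lay (a * (b * x)) (bc y c) z ⨾ lay (a * b) (bc x c) (y * z)) ≫
      wh (one _) (sig (bc x a) (lay (y * b) (bc z c) 1)).inv
        (lay a (bc (x * y) b) (c * z) ⨾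
          lay (a * (b * x)) (bc y c) z ⨾ lay (a * b) (bc x c) (y * z)) ≫
      wh (lay (x * (a * (y * b))) (bc z c) 1) (ten 1 (Om x a y b).hom (c * z))
        (lay (a * (b * x)) (bc y c) z ⨾ lay (a * b) (bc x c) (y * z)) ≫
      wh (lay (x * (a * (y * b))) (bc z c) 1 ⨾ lay (x * a) (bc y b) (c * z))
        (sig (bc x (a * b)) (lay 1 (bc y c) z)).inv (lay (a * b) (bc x c) (y * z)) ≫
      wh (lay (x * (a * (y * b))) (bc z c) 1 ⨾ lay (x * a) (bc y b) (c * z) ⨾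
        lay (x * (a * b)) (bc y c) z) (ten 1 (Rm x (a * b) c).inv (y * z)) (one _) ≫
      wh (lay (x * (a * (y * b))) (bc z c) 1) (ten (x * a) (Rm y b c).inv z)
        (lay 1 (bc x (a * (b * c))) (y * z)) := by
  rw [Om_hom x (a * b), Om_hom y b z c]
  simp only [wh_comp, wh_wh, ten_comp, ten_wh, ten_ten, ten_sig_inv, Category.assoc]
  have ha := xch (lay (x * a) (bc y b) (z * c)) (ten (x * (a * b)) (Sm y z c).hom 1) (one _)
    (ten 1 (Rm x (a * b) c).inv (y * z)) (one _)
  have hb := xch (one _) (sig (lay (x * a) (bc y b) 1) (bc z c)).inv (lay (x * (a * b)) (bc y c) z)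
    (ten 1 (Rm x (a * b) c).inv (y * z)) (one _)
  have hc := sig_nat_right_inv (bc x (a * b)) (Sm y z c).hom
  rw [sig_comp_right_inv] at hc
  replace hc := congrArg
    (fun t => wh (lay (x * a) (bc y b) (z * c)) t (lay (a * b) (bc x c) (y * z))) hc
  -- BA2 changes the splitting of `x * y * z` so that `z` is separated first.
  have hd := congrArg (fun t =>
      wh (lay (x * a) (bc y b) (z * c) ⨾ lay 1 (bc x (a * b)) (y * (z * c)))
    (ten (a * b) t 1) (one _)) (Sm_cocycle x y z c)
  have he := xch (one _) (ten 1 (Om x a y b).hom (z * c)) (one _)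
    (ten (a * b) (Sm (x * y) z c).hom 1) (one _)
  have hf := xch (one _) (ten 1 (Om x a y b).hom (z * c)) (lay (a * (b * (x * y))) (bc z c) 1)
    (ten (a * b) (Sm x y c).hom z) (one _)
  have hg := xch (one _) (sig (lay (x * a) (bc y b) 1) (bc z c)).inv (one _)
    (sig (bc x (a * b)) (lay 1 (bc y c) z)).inv (lay (a * b) (bc x c) (y * z))
  have hh := congrArg (fun t => wh (one _) t
    (lay (a * (b * x)) (bc y c) z ⨾ lay (a * b) (bc x c) (y * z)))
    (sig_left_square_inv (Om x a y b).hom (bc z c))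
  simp only [wh_comp, wh_wh, ten_comp, ten_wh, ten_ten, sig_mid_inv]
    at hc hd hh
  erw [← reassoc_of% ha]
  erw [← reassoc_of% hb]
  erw [reassoc_of% hc]
  erw [← reassoc_of% hd]
  erw [reassoc_of% he]
  erw [reassoc_of% hf]
  erw [← reassoc_of% hg]
  erw [reassoc_of% hh]
  rfl

/-- The same normal form is reached with BA3, which replaces `R` at `x * y` by cells at `x` and at
`y`, and BA1, which regroups the `R⁻¹` cells of `x` past `a`, `b`, `c`. -/
theorem Om_cocycle_right :
    wh (lay 1 (bc x a) (y * (b * (z * c)))) (ten a (Om (x * y) b z c).hom 1) (one _) ≫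
      wh (one _) (sig (bc x a) (lay (y * b) (bc z c) 1)).inv (lay a (bc (x * y) (b * c)) z) ≫
      wh (lay (x * (a * (y * b))) (bc z c) 1) (ten 1 (Om x a y (b * c)).hom z) (one _) =
    wh (lay 1 (bc x a) (y * (b * (z * c))) ⨾ lay a (bc (x * y) b) (z * c))
        (ten (a * b) (Sm (x * y) z c).hom 1) (one _) ≫
      wh (lay 1 (bc x a) (y * (b * (z * c))) ⨾ lay a (bc (x * y) b) (z * c) ⨾
          lay (a * (b * (x * y))) (bc z c) 1) (ten (a * b) (Sm x y c).hom z) (one _) ≫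
      wh (lay 1 (bc x a) (y * (b * (z * c)))) (sig (lay a (bc (x * y) b) 1) (bc z c)).inv
        (lay (a * (b * x)) (bc y c) z ⨾ lay (a * b) (bc x c) (y * z)) ≫
      wh (one _) (sig (bc x a) (lay (y * b) (bc z c) 1)).inv
        (lay a (bc (x * y) b) (c * z) ⨾
          lay (a * (b * x)) (bc y c) z ⨾ lay (a * b) (bc x c) (y * z)) ≫
      wh (lay (x * (a * (y * b))) (bc z c) 1) (ten 1 (Om x a y b).hom (c * z))
        (lay (a * (b * x)) (bc y c) z ⨾ lay (a * b) (bc x c) (y * z)) ≫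
      wh (lay (x * (a * (y * b))) (bc z c) 1 ⨾ lay (x * a) (bc y b) (c * z))
        (sig (bc x (a * b)) (lay 1 (bc y c) z)).inv (lay (a * b) (bc x c) (y * z)) ≫
      wh (lay (x * (a * (y * b))) (bc z c) 1 ⨾ lay (x * a) (bc y b) (c * z) ⨾
        lay (x * (a * b)) (bc y c) z) (ten 1 (Rm x (a * b) c).inv (y * z)) (one _) ≫
      wh (lay (x * (a * (y * b))) (bc z c) 1) (ten (x * a) (Rm y b c).inv z)
        (lay 1 (bc x (a * (b * c))) (y * z)) := by
  rw [Om_hom (x * y) b z c, Om_hom x a y (b * c), Om_hom x a y b]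
  simp only [wh_comp, wh_wh, ten_comp, ten_wh, ten_ten, ten_sig_inv, Category.assoc]
  have h₁ := xch (one _) (sig (bc x a) (lay (y * b) (bc z c) 1)).inv (one _)
    (ten a (Rm (x * y) b c).inv z) (one _)
  -- BA3 for `x * y` past `b * c`: the `R⁻¹` cell of one comparison meets the `S` cell of the other.
  have h₂ := congrArg (fun t => wh (lay (x * (a * (y * b))) (bc z c) 1 ⨾
    lay 1 (bc x a) (y * (b * (c * z)))) (ten a t z) (one _)) (Rm_Sm x y b c)
  have h₃ := sig_nat_right_inv (bc x a) (Rm y b c).inv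
  rw [sig_comp_right_inv] at h₃
  replace h₃ := congrArg (fun t => wh (lay (x * (a * (y * b))) (bc z c) 1) (ten 1 t z)
    (lay a (bc x (b * c)) (y * z))) h₃
  have h₄ := xch (lay (x * (a * (y * b))) (bc z c) 1) (ten (x * a) (Rm y b c).inv z) (one _)
    (ten 1 (Rm x a (b * c)).inv (y * z)) (one _)
  have h₅ := xch (lay (x * (a * (y * b))) (bc z c) 1)
    (sig (bc x a) (lay 1 (bc y b) (c * z))).inv (lay (a * (x * b)) (bc y c) z)
    (ten a (Rm x b c).inv (y * z)) (one _)
  have h₆ := xch (lay (x * (a * (y * b))) (bc z c) 1 ⨾ lay (x * a) (bc y b) (c * z))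
    (sig (bc x a) (lay b (bc y c) z)).inv (one _)
    (ten a (Rm x b c).inv (y * z)) (one _)
  -- BA1 makes `R x a b` appear, as `Om x a y b` requires.
  have h₇ := congrArg (fun t => wh (lay (x * (a * (y * b))) (bc z c) 1 ⨾
    lay (x * a) (bc y b) (c * z) ⨾ lay (x * (a * b)) (bc y c) z) (ten 1 t (y * z)) (one _))
    (Rm_cocycle_inv x a b c)
  have h₈ := xch (lay (x * (a * (y * b))) (bc z c) 1 ⨾ lay 1 (bc x a) (y * (b * (c * z))))
    (ten a (Sm x y b).hom (c * z)) (one _) (ten (a * b) (Sm x y c).hom z) (one _)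
  have h₉ := xch (one _) (sig (bc x a) (lay (y * b) (bc z c) 1)).inv
    (lay a (bc (x * y) b) (c * z)) (ten (a * b) (Sm x y c).hom z) (one _)
  have h₁₀ := xch (lay 1 (bc x a) (y * (b * (z * c)))) (sig (lay a (bc (x * y) b) 1) (bc z c)).inv
    (one _) (ten (a * b) (Sm x y c).hom z) (one _)
  have h₁₁ := xch (lay (x * (a * (y * b))) (bc z c) 1)
    (sig (bc x a) (lay 1 (bc y b) (c * z))).inv (one _)
    (sig (lay a (bc x b) 1) (lay 1 (bc y c) z)).inv (lay (a * b) (bc x c) (y * z))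
  -- Moving `R x a b` past the interchangers with `bc y c` reunites it with the other two factors of
  -- `Om x a y b`.
  have h₁₂ := sig_nat_left_inv (Rm x a b).inv (lay 1 (bc y c) z)
  rw [sig_comp_left_inv] at h₁₂
  replace h₁₂ := congrArg (fun t => wh (lay (x * (a * (y * b))) (bc z c) 1 ⨾
    lay (x * a) (bc y b) (c * z)) t (lay (a * b) (bc x c) (y * z))) h₁₂
  simp only [wh_comp, wh_wh, ten_comp, ten_wh, ten_ten, ten_sig_inv, sig_mid_inv, Category.assoc]
    at h₂ h₃ h₇ h₁₂
  erw [← reassoc_of% h₁]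
  erw [← reassoc_of% h₂]
  erw [← reassoc_of% h₃]
  erw [h₄]
  erw [← reassoc_of% h₅]
  erw [← reassoc_of% h₆]
  erw [reassoc_of% h₇]
  erw [reassoc_of% h₈]
  erw [reassoc_of% h₉]
  erw [reassoc_of% h₁₀]
  erw [← reassoc_of% h₁₁]
  erw [← reassoc_of% h₁₂]
  rfl

/-- The associativity coherence of the comparison `Om`. -/
theorem Om_cocycle :
    wh (one _) (ten 1 (Om x a y b).hom (z * c)) (lay (a * b) (bc (x * (y * z)) c) 1) ≫
      wh (lay (x * a) (bc y b) (z * c)) (Om x (a * b) (y * z) c).hom (one _) ≫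
      wh (one _) (ten (x * a) (Om y b z c).hom 1) (lay 1 (bc x (a * (b * c))) (y * z)) =
    wh (lay 1 (bc x a) (y * (b * (z * c)))) (ten a (Om (x * y) b z c).hom 1) (one _) ≫
      wh (one _) (sig (bc x a) (lay (y * b) (bc z c) 1)).inv (lay a (bc (x * y) (b * c)) z) ≫
      wh (lay (x * (a * (y * b))) (bc z c) 1) (ten 1 (Om x a y (b * c)).hom z) (one _) :=
  (Om_cocycle_left x a y b z c).trans (Om_cocycle_right x a y b z c).symm

end

end Hom1

/-! ### The cocycle law for `om` and compatibility of the two crossings. -/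

theorem iso_square_inv {C : Type u} [Category.{v} C] {a b c d e f : C} (x : a ≅ b) {y : a ⟶ c}
    {t : c ⟶ d} {s : b ⟶ e} {z : e ⟶ f} (w : d ≅ f) (h : y ≫ t ≫ w.hom = x.hom ≫ s ≫ z) :
    x.inv ≫ y ≫ t = s ≫ z ≫ w.inv := by
  rw [Iso.inv_comp_eq, ← Category.assoc s, ← Category.assoc x.hom, Iso.eq_comp_inv,
    Category.assoc, h]

namespace Hom1

section

/-- The outermost objects `A₄` and `D₁` are never braided, so this is `Om_cocycle` tensored with
them. -/
theorem om_cocycle (A₄ D₄ A₃ D₃ A₂ D₂ A₁ D₁ : Ob V) :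
    wh (one _) (ten 1 (om A₄ D₄ A₃ D₃ A₂ D₂).hom (A₁ * D₁))
        (χ (A₄ * (A₃ * A₂)) (D₄ * (D₃ * D₂)) A₁ D₁) ≫
      wh (lay (A₄ * D₄) (χ A₃ D₃ A₂ D₂) (A₁ * D₁)) (om A₄ D₄ (A₃ * A₂) (D₃ * D₂) A₁ D₁).hom
        (one _) ≫
      wh (one _) (ten (A₄ * D₄) (om A₃ D₃ A₂ D₂ A₁ D₁).hom 1)
        (χ A₄ D₄ (A₃ * (A₂ * A₁)) (D₃ * (D₂ * D₁))) =
    wh (lay 1 (χ A₄ D₄ A₃ D₃) (A₂ * (D₂ * (A₁ * D₁)))) (om (A₄ * A₃) (D₄ * D₃) A₂ D₂ A₁ D₁).hom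
        (one _) ≫
      wh (one _) (sig (χ A₄ D₄ A₃ D₃) (χ A₂ D₂ A₁ D₁)).inv
        (χ (A₄ * A₃) (D₄ * D₃) (A₂ * A₁) (D₂ * D₁)) ≫
      wh (lay (A₄ * (D₄ * (A₃ * D₃))) (χ A₂ D₂ A₁ D₁) 1)
        (om A₄ D₄ A₃ D₃ (A₂ * A₁) (D₂ * D₁)).hom (one _) := by
  have h := congrArg (fun t => ten A₄ t D₁) (Om_cocycle D₄ A₃ D₃ A₂ D₂ A₁)
  have e : (sig (χ A₄ D₄ A₃ D₃) (χ A₂ D₂ A₁ D₁)).inv =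
    (sig (lay A₄ (bc D₄ A₃) 1) (lay (D₃ * A₂) (bc D₂ A₁) D₁)).inv :=
    sig_mid_inv (lay A₄ (bc D₄ A₃) 1) D₃ (lay A₂ (bc D₂ A₁) D₁)
  simp only [ten_comp, ten_wh, ten_ten, ten_sig_inv] at h
  rw [e]
  have e₁ : ten 1 (om A₄ D₄ A₃ D₃ A₂ D₂).hom (A₁ * D₁) =
    ten A₄ (Om D₄ A₃ D₃ A₂).hom (D₂ * (A₁ * D₁)) := ten_ten _ _ _ _ _
  have e₂ : ten (A₄ * D₄) (om A₃ D₃ A₂ D₂ A₁ D₁).hom 1 =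
    ten (A₄ * (D₄ * A₃)) (Om D₃ A₂ D₂ A₁).hom D₁ := ten_ten _ _ _ _ _
  rw [e₁, e₂]
  exact h

variable {A A' B B' C C' D D' : Ob V}

/-- The part of `chl_chr` not involving the leftmost 1-cell `f`. It contains the one place where two
1-cells enter the same braiding. -/
theorem chl_chr_core (g : Hom1 D D') (h : Hom1 B B') (k : Hom1 C C') :
    wh (one _) (sig g (lay 1 h C)).inv (lay (D' * B') k 1 ⨾ lay 1 (bc D' B') C') ≫
      wh (lay D h C) (sig g (lay B' k 1)).inv (lay 1 (bc D' B') C') ≫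
      wh (lay D h C ⨾ lay (D * B') k 1) (ten 1 (bl g B').hom C') (one _) ≫
      wh (lay D h C) (sig (bc D B') k).hom (lay B' g C') ≫
      wh (one _) (ten 1 (br D h).hom C) (lay (B' * D) k 1 ⨾ lay B' g C') =
    wh (lay 1 g (B * C) ⨾ lay D' h C) (sig (bc D' B') k).hom (one _) ≫
      wh (lay 1 g (B * C)) (ten 1 (br D' h).hom C) (lay (B' * D') k 1) ≫
      wh (one _) (ten 1 (bl g B).hom C) (lay 1 h (D' * C) ⨾ lay (B' * D') k 1) ≫
      wh (lay 1 (bc D B) C) (sig h (lay 1 g C)).hom (lay (B' * D') k 1) ≫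
      wh (lay 1 (bc D B) C ⨾ lay 1 h (D * C)) (sig (lay B' g 1) k).inv (one _) := by
  have h₁ := iso_square_inv (whI (one _) (sig (lay 1 g B') k) (lay 1 (bc D' B') C'))
    (whI (lay 1 (bc D B') C) (sig (lay B' g 1) k) (one _))
    (sig_left_square (bl g B').hom k).symm
  -- The braided factors carry `g` and `h`; this is pseudonaturality of `β` at their interchanger,
  -- rearranged.
  have h₂ := iso_square_inv (whI (one _) (sig g h) (bc D' B'))
    (whI (bc D B) (sig h g).symm (one _)) (bc_sig g h)
  simp only [whI_inv, Iso.symm_inv, sig_mid_inv] at h₁ h₂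
  replace h₁ := congrArg (fun t => wh (lay D h C) t (one _)) h₁
  replace h₂ := congrArg (fun t => wh (one _) (ten 1 t C) (lay (B' * D') k 1)) h₂
  simp only [wh_comp, wh_wh, ten_comp, ten_wh, ten_sig, ten_sig_inv] at h₁ h₂
  have h₃ := xch (one _) (ten 1 (br D h).hom C) (one _) (sig (lay B' g 1) k).inv (one _)
  have h₄ := xch (one _) (sig g (lay 1 h C)).inv (one _) (sig (bc D' B') k).hom (one _)
  erw [reassoc_of% h₁]
  erw [← h₃]
  erw [reassoc_of% h₄]
  erw [reassoc_of% h₂]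
  rfl

/-- The 2-cell on tensor products induced by 2-cells between composites. -/
def Th {X₁ X₂ Y₁ Y₂ : Ob V} {f : Hom1 A X₁} {f' : Hom1 X₁ A'} {h : Hom1 A X₂} {h' : Hom1 X₂ A'}
    {g : Hom1 D Y₁} {g' : Hom1 Y₁ D'} {k : Hom1 D Y₂} {k' : Hom1 Y₂ D'}
    (η : f ⨾ f' ⟶ h ⨾ h') (θ : g ⨾ g' ⟶ k ⨾ k') : T f g ⨾ T f' g' ⟶ T h k ⨾ T h' k' :=
  (tc f f' g g').hom ≫ T₂ η θ ≫ (tc h h' k k').inv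

/-- What pseudonaturality of the middle exchange requires at an interchanger: crossing with the left
pair and with the right pair in either order agree. The 1-cell `f` lies to the left of the braiding
and only contributes interchangers; the rest is `chl_chr_core`. -/
theorem chl_chr (f : Hom1 A A') (g : Hom1 D D') (h : Hom1 B B') (k : Hom1 C C') :
    wh (one _) (sig (T f g) (T h k)).inv (χ A' D' B' C') ≫
        wh (lay (A * D) (T h k) 1) (chl f g B' C').hom (one _) ≫
        wh (one _) (chr A D h k).hom (T (lay 1 f B') (lay 1 g C') :) =
      wh (lay 1 (T f g) (B * C)) (chr A' D' h k).hom (one _) ≫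
        wh (one _) (chl f g B C).hom (T (lay A' h 1) (lay D' k 1) :) ≫
        wh (χ A D B C) (Th (f := lay 1 f B) (f' := lay A' h 1) (h := lay A h 1) (h' := lay 1 f B')
          (g := lay 1 g C) (g' := lay D' k 1) (k := lay D k 1) (k' := lay 1 g C')
          (sig f h).inv (sig g k).inv) (one _) := by
  simp only [Th, T, T₂, tc, chl, chr, χ, Iso.trans_hom, whI_hom, whI_inv, tenI_hom, Iso.symm_hom,
    wh_comp, wh_wh, ten_sig, ten_sig_inv, sig_comp_left_inv, sig_comp_right_inv, sig_mid_inv,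
    Category.assoc]
  have h₁ := xch (lay (A * D) h C) (sig f (lay (D * B') k 1)).inv (one _)
    (ten A' (bl g B').hom C') (one _)
  have h₂ := sig_right_square_inv f (g₁ := lay (D * B') k 1) (g₂ := lay 1 (bc D B') C')
    (h₁ := lay 1 (bc D B') C) (h₂ := lay (B' * D) k 1) (sig (bc D B') k).hom
  replace h₂ := congrArg (fun t => wh (lay (A * D) h C) t (lay (A' * B') g C')) h₂
  have h₃ := xch (one _) (ten A (br D h).hom C) (one _) (sig f (lay (B' * D) k 1)).inv
    (lay (A' * B') g C')
  have h₄ := xch (one _) (sig f (lay D h C)).inv (one _) (sig (lay A' g 1) (lay B' k 1)).inv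
    (lay A' (bc D' B') C')
  have h₅ := xch (one _) (sig f (lay D h C)).inv (lay (A' * (D * B')) k 1)
    (ten A' (bl g B').hom C') (one _)
  have h₆ := xch (one _) (sig f (lay D h C)).inv (one _) (sig (lay A' (bc D B') 1) k).hom
    (lay (A' * B') g C')
  have h₇ := sig_right_square_inv f (g₁ := lay D h C) (g₂ := lay 1 (bc D B') C)
    (h₁ := lay 1 (bc D B) C) (h₂ := lay 1 h (D * C)) (ten 1 (br D h).hom C)
  replace h₇ := congrArg (fun t => wh (one _) t (lay (A' * (B' * D)) k 1 ⨾ lay (A' * B') g C')) h₇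
  have h₈ := congrArg (fun t => wh (lay 1 f (D * (B * C))) (ten A' t 1) (one _))
    (chl_chr_core g h k)
  have h₉ := xch (one _) (sig f (lay 1 (bc D B) C)).inv (one _)
    (sig (lay A' h 1) (lay 1 g C)).hom (lay (A' * (B' * D')) k 1)
  have h₁₀ := xch (one _) (sig f (lay 1 (bc D B) C)).inv (lay A' h (D * C))
    (sig (lay (A' * B') g 1) k).inv (one _)
  have h₁₁ := xch (lay A (bc D B) C) (sig f (lay 1 h (D * C))).inv (one _)
    (sig (lay (A' * B') g 1) k).inv (one _)
  simp only [wh_comp, wh_wh, ten_comp, ten_wh, ten_ten, ten_sig, ten_sig_inv] at h₂ h₇ h₈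
  erw [reassoc_of% h₁]
  erw [reassoc_of% h₂]
  erw [← h₃]
  erw [reassoc_of% h₄]
  erw [reassoc_of% h₅]
  erw [reassoc_of% h₆]
  erw [reassoc_of% h₇]
  erw [reassoc_of% h₈]
  erw [← reassoc_of% h₁₀]
  erw [← reassoc_of% h₉]
  erw [← reassoc_of% h₁₁]
  rfl

end

end Hom1

end

/-! ### Two-cells between tensor products of composites. -/

section

variable {V : Type u} [Bicategory.{w, v} V] [Bicategory.Strict V] [GrayMonoid V]

theorem iso_turn {C : Type u} [Category.{v} C] {a b c d e : C} (r : a ≅ b) (r' : d ≅ c)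
    {x : b ⟶ c} {y : a ⟶ e} {z : e ⟶ d} (h : r.hom ≫ x = y ≫ z ≫ r'.hom) :
    r.inv ≫ y ≫ z = x ≫ r'.inv := by
  rw [Iso.inv_comp_eq, ← Category.assoc, Iso.eq_comp_inv, h, Category.assoc]

namespace Hom1

section

variable {A A' A₁ A₂ B₁ B₂ C₁ C₂ D D' X₁ X₂ Y₁ Y₂ Z₁ Z₂ : Ob V}

/-- Compatibility of the tensor product with a composite of three 1-cells. -/
def tc₃ (f : Hom1 A A₁) (f' : Hom1 A₁ A₂) (f'' : Hom1 A₂ A') (g : Hom1 D X₁) (g' : Hom1 X₁ X₂)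
    (g'' : Hom1 X₂ D') : T f g ⨾ T f' g' ⨾ T f'' g'' ≅ T (f ⨾ f' ⨾ f'') (g ⨾ g' ⨾ g'') :=
  whI (one _) (tc f f' g g') (T f'' g'') ≪≫ tc (f ⨾ f') f'' (g ⨾ g') g''

/-- Conjugation by `tc₃` turns a whiskered `Th` into a single `T₂`, so that successive `Th`s
telescope. -/
theorem Th_whisker_right {f : Hom1 A A₁} {f' : Hom1 A₁ A₂} {h : Hom1 A B₁} {h' : Hom1 B₁ A₂}
    {g : Hom1 D X₁} {g' : Hom1 X₁ X₂} {k : Hom1 D Y₁} {k' : Hom1 Y₁ X₂}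
    (η : f ⨾ f' ⟶ h ⨾ h') (θ : g ⨾ g' ⟶ k ⨾ k') (f'' : Hom1 A₂ A') (g'' : Hom1 X₂ D') :
    wh (one _) (Th η θ) (T f'' g'') =
      (tc₃ f f' f'' g g' g'').hom ≫ T₂ (wh (one _) η f'') (wh (one _) θ g'') ≫
        (tc₃ h h' f'' k k' g'').inv := by
  rw [← Category.assoc, Iso.eq_comp_inv]
  simp only [Th, tc₃, Iso.trans_hom, whI_hom, wh_comp, Category.assoc]
  have h₁ := wh_inv_hom (one _) (tc h h' k k') (T f'' g'')
  have h₂ := tc_nat_left η θ f'' g''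
  erw [reassoc_of% h₁]
  erw [h₂]

theorem Th_whisker_left {f : Hom1 A₁ A₂} {f' : Hom1 A₂ A'} {h : Hom1 A₁ B₁} {h' : Hom1 B₁ A'}
    {g : Hom1 X₁ X₂} {g' : Hom1 X₂ D'} {k : Hom1 X₁ Y₁} {k' : Hom1 Y₁ D'}
    (f₀ : Hom1 A A₁) (g₀ : Hom1 D X₁) (η : f ⨾ f' ⟶ h ⨾ h') (θ : g ⨾ g' ⟶ k ⨾ k') :
    wh (T f₀ g₀) (Th η θ) (one _) =
      (tc₃ f₀ f f' g₀ g g').hom ≫ T₂ (wh f₀ η (one _)) (wh g₀ θ (one _)) ≫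
        (tc₃ f₀ h h' g₀ k k').inv := by
  rw [← Category.assoc, Iso.eq_comp_inv]
  simp only [Th, tc₃, Iso.trans_hom, whI_hom, wh_comp, Category.assoc]
  have h₁ := wh_inv_hom (T f₀ g₀) (tc h h' k k') (one _)
  have h₂ := tc_nat_right η θ f₀ g₀
  -- `tc₃` is bracketed from the left, whereas whiskering on the left calls for the other
  -- bracketing.
  have h₃ := tc_assoc f₀ h h' g₀ k k'
  have h₄ := tc_assoc f₀ f f' g₀ g g'
  erw [h₃]
  erw [reassoc_of% h₁]
  erw [h₂]
  erw [← reassoc_of% h₄]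

/-- After conjugation the inner `tc₃` cells cancel. Since `T₂` preserves composition, the equation
is then the given hexagon in each tensor factor. These hexagons have the shape of (AC). -/
theorem Th_hexagon {f₁ : Hom1 A A₁} {f₂ : Hom1 A₁ A₂} {f₃ : Hom1 A₂ A'} {p₁ : Hom1 A B₁}
    {p₂ : Hom1 B₁ A₂} {q₂ : Hom1 B₁ B₂} {q₃ : Hom1 B₂ A'} {l₂ : Hom1 A₁ C₁} {l₃ : Hom1 C₁ A'}
    {n₁ : Hom1 A C₂} {n₂ : Hom1 C₂ C₁} {r₂ : Hom1 C₂ B₂}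
    {f₁' : Hom1 D X₁} {f₂' : Hom1 X₁ X₂} {f₃' : Hom1 X₂ D'} {p₁' : Hom1 D Y₁}
    {p₂' : Hom1 Y₁ X₂} {q₂' : Hom1 Y₁ Y₂} {q₃' : Hom1 Y₂ D'} {l₂' : Hom1 X₁ Z₁} {l₃' : Hom1 Z₁ D'}
    {n₁' : Hom1 D Z₂} {n₂' : Hom1 Z₂ Z₁} {r₂' : Hom1 Z₂ Y₂}
    {a : f₁ ⨾ f₂ ⟶ p₁ ⨾ p₂} {b : p₂ ⨾ f₃ ⟶ q₂ ⨾ q₃} {c : p₁ ⨾ q₂ ⟶ n₁ ⨾ r₂}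
    {d : f₂ ⨾ f₃ ⟶ l₂ ⨾ l₃} {s : f₁ ⨾ l₂ ⟶ n₁ ⨾ n₂} {e : n₂ ⨾ l₃ ⟶ r₂ ⨾ q₃}
    {a' : f₁' ⨾ f₂' ⟶ p₁' ⨾ p₂'} {b' : p₂' ⨾ f₃' ⟶ q₂' ⨾ q₃'} {c' : p₁' ⨾ q₂' ⟶ n₁' ⨾ r₂'}
    {d' : f₂' ⨾ f₃' ⟶ l₂' ⨾ l₃'} {s' : f₁' ⨾ l₂' ⟶ n₁' ⨾ n₂'} {e' : n₂' ⨾ l₃' ⟶ r₂' ⨾ q₃'}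
    (h : wh (one _) a f₃ ≫ wh p₁ b (one _) ≫ wh (one _) c q₃ =
      wh f₁ d (one _) ≫ wh (one _) s l₃ ≫ wh n₁ e (one _))
    (h' : wh (one _) a' f₃' ≫ wh p₁' b' (one _) ≫ wh (one _) c' q₃' =
      wh f₁' d' (one _) ≫ wh (one _) s' l₃' ≫ wh n₁' e' (one _)) :
    wh (one _) (Th a a') (T f₃ f₃') ≫ wh (T p₁ p₁') (Th b b') (one _) ≫
        wh (one _) (Th c c') (T q₃ q₃') =
      wh (T f₁ f₁') (Th d d') (one _) ≫ wh (one _) (Th s s') (T l₃ l₃') ≫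
        wh (T n₁ n₁') (Th e e') (one _) := by
  simp only [Th_whisker_left, Th_whisker_right]
  have k := congrArg₂ (fun x y => T₂ x y) h h'
  simp only [T₂_comp] at k
  have h₁ := (tc₃ p₁ p₂ f₃ p₁' p₂' f₃').inv_hom_id
  have h₂ := (tc₃ p₁ q₂ q₃ p₁' q₂' q₃').inv_hom_id
  have h₃ := (tc₃ f₁ l₂ l₃ f₁' l₂' l₃').inv_hom_id
  have h₄ := (tc₃ n₁ n₂ l₃ n₁' n₂' l₃').inv_hom_id
  simp only [Category.assoc]
  erw [reassoc_of% h₁, reassoc_of% h₂, reassoc_of% h₃, reassoc_of% h₄, reassoc_of% k]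

end

section

variable [BraidedGrayMonoid V]

variable {A A' A₁ A₂ B B' C C' D D' X₁ X₂ : Ob V}

/-- `Th` is a `T₂` between two `tc` cells; the crossing is compatible with the former by `chl_nat`
and with the latter by `chl_comp`. -/
theorem chl_Th {f : Hom1 A A₁} {f' : Hom1 A₁ A'} {h : Hom1 A A₂} {h' : Hom1 A₂ A'}
    {g : Hom1 D X₁} {g' : Hom1 X₁ D'} {k : Hom1 D X₂} {k' : Hom1 X₂ D'}
    (η : f ⨾ f' ⟶ h ⨾ h') (θ : g ⨾ g' ⟶ k ⨾ k') (B C : Ob V) :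
    wh (one _) (ten 1 (Th η θ) (B * C)) (χ A' D' B C) ≫
        wh (lay 1 (T h k) (B * C)) (chl h' k' B C).hom (one _) ≫
        wh (one _) (chl h k B C).hom (T (lay 1 h' B) (lay 1 k' C) :) =
      wh (lay 1 (T f g) (B * C)) (chl f' g' B C).hom (one _) ≫
        wh (one _) (chl f g B C).hom (T (lay 1 f' B) (lay 1 g' C) :) ≫
        wh (χ A D B C) (Th (f := lay 1 f B) (f' := lay 1 f' B) (h := lay 1 h B) (h' := lay 1 h' B)
          (g := lay 1 g C) (g' := lay 1 g' C) (k := lay 1 k C) (k' := lay 1 k' C)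
          (ten 1 η B) (ten 1 θ C)) (one _) := by
  simp only [Th, wh_comp, ten_comp, Category.assoc]
  have h₁ := chl_comp f f' g g' B C
  have h₂ := iso_turn (whI (one _) (tenI 1 (tc h h' k k') (B * C)) (χ A' D' B C))
    (whI (χ A D B C) (tc (lay 1 h B) (lay 1 h' B) (lay 1 k C) (lay 1 k' C)) (one _))
    (chl_comp h h' k k' B C)
  have h₃ := chl_nat η θ B C
  erw [← reassoc_of% h₁]
  erw [← reassoc_of% h₃]
  erw [h₂]
  rfl

theorem chr_Th {f : Hom1 B A₁} {f' : Hom1 A₁ B'} {h : Hom1 B A₂} {h' : Hom1 A₂ B'}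
    {g : Hom1 C X₁} {g' : Hom1 X₁ C'} {k : Hom1 C X₂} {k' : Hom1 X₂ C'} (A D : Ob V)
    (η : f ⨾ f' ⟶ h ⨾ h') (θ : g ⨾ g' ⟶ k ⨾ k') :
    wh (one _) (ten (A * D) (Th η θ) 1) (χ A D B' C') ≫
        wh (lay (A * D) (T h k) 1) (chr A D h' k').hom (one _) ≫
        wh (one _) (chr A D h k).hom (T (lay A h' 1) (lay D k' 1) :) =
      wh (lay (A * D) (T f g) 1) (chr A D f' g').hom (one _) ≫
        wh (one _) (chr A D f g).hom (T (lay A f' 1) (lay D g' 1) :) ≫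
        wh (χ A D B C) (Th (f := lay A f 1) (f' := lay A f' 1) (h := lay A h 1) (h' := lay A h' 1)
          (g := lay D g 1) (g' := lay D g' 1) (k := lay D k 1) (k' := lay D k' 1)
          (ten A η 1) (ten D θ 1)) (one _) := by
  simp only [Th, wh_comp, ten_comp, Category.assoc]
  have h₁ := chr_comp A D f f' g g'
  have h₂ := iso_turn (whI (one _) (tenI (A * D) (tc h h' k k') 1) (χ A D B' C'))
    (whI (χ A D B C) (tc (lay A h 1) (lay A h' 1) (lay D k 1) (lay D k' 1)) (one _))
    (chr_comp A D h h' k k')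
  have h₃ := chr_nat A D η θ
  erw [← reassoc_of% h₁]
  erw [← reassoc_of% h₃]
  erw [h₂]
  rfl

end

end Hom1

end

/-! ### The associator of a tensor product and its pentagon. -/

section

variable {V : Type u} [Bicategory.{w, v} V] [Bicategory.Strict V] [GrayMonoid V]
  [BraidedGrayMonoid V]

namespace Hom1

section

variable {A₄ A₃ A₂ A₁ A₄₃ A₃₂ A₂₁ A₄₃₂ A₃₂₁ A D₄ D₃ D₂ D₁ D₄₃ D₃₂ D₂₁ D₄₃₂ D₃₂₁ D : Ob V}

/-- The associator of a tensor product. -/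
def al {p : Hom1 (A₃ * A₂) A₃₂} {p' : Hom1 (A₃₂ * A₁) A} {q : Hom1 (A₂ * A₁) A₂₁}
    {q' : Hom1 (A₃ * A₂₁) A} {k : Hom1 (D₃ * D₂) D₃₂} {k' : Hom1 (D₃₂ * D₁) D}
    {l : Hom1 (D₂ * D₁) D₂₁} {l' : Hom1 (D₃ * D₂₁) D}
    (η : lay 1 p A₁ ⨾ p' ⟶ lay A₃ q 1 ⨾ q') (θ : lay 1 k D₁ ⨾ k' ⟶ lay D₃ l 1 ⨾ l') :
    lay 1 (χ A₃ D₃ A₂ D₂ ⨾ (T p k :)) (A₁ * D₁) ⨾ χ A₃₂ D₃₂ A₁ D₁ ⨾ (T p' k' :) ⟶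
      lay (A₃ * D₃) (χ A₂ D₂ A₁ D₁ ⨾ (T q l :)) 1 ⨾ χ A₃ D₃ A₂₁ D₂₁ ⨾ (T q' l' :) :=
  wh (lay 1 (χ A₃ D₃ A₂ D₂) (A₁ * D₁)) (chl p k A₁ D₁).hom (T p' k' :) ≫
    wh (lay 1 (χ A₃ D₃ A₂ D₂) (A₁ * D₁) ⨾ χ (A₃ * A₂) (D₃ * D₂) A₁ D₁) (Th (f := lay 1 p A₁)
      (f' := p') (h := lay A₃ q 1) (h' := q') (g := lay 1 k D₁) (g' := k') (k := lay D₃ l 1)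
      (k' := l') η θ) (one _) ≫
    wh (one _) (om A₃ D₃ A₂ D₂ A₁ D₁).hom ((T (lay A₃ q 1) (lay D₃ l 1) :) ⨾ (T q' l' :)) ≫
    wh (lay (A₃ * D₃) (χ A₂ D₂ A₁ D₁) 1) (chr A₃ D₃ q l).inv (T q' l' :)

/-- Moving all tensor products of 1-cells to the right of the middle exchanges, for the
bracketing `((4 3) 2) 1`. -/
def moveLL (A₂ A₁ D₂ D₁ : Ob V) (p : Hom1 (A₄ * A₃) A₄₃) (p' : Hom1 (A₄₃ * A₂) A₄₃₂)
    (k : Hom1 (D₄ * D₃) D₄₃) (k' : Hom1 (D₄₃ * D₂) D₄₃₂) :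
    lay 1 (χ A₄ D₄ A₃ D₃ ⨾ (T p k :)) (A₂ * (D₂ * (A₁ * D₁))) ⨾
        lay 1 (χ A₄₃ D₄₃ A₂ D₂ ⨾ (T p' k' :)) (A₁ * D₁) ⨾ χ A₄₃₂ D₄₃₂ A₁ D₁ ⟶
      lay 1 (χ A₄ D₄ A₃ D₃) (A₂ * (D₂ * (A₁ * D₁))) ⨾
        lay 1 (χ (A₄ * A₃) (D₄ * D₃) A₂ D₂) (A₁ * D₁) ⨾
        χ (A₄ * (A₃ * A₂)) (D₄ * (D₃ * D₂)) A₁ D₁ ⨾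
        (T (lay 1 p (A₂ * A₁)) (lay 1 k (D₂ * D₁)) :) ⨾ (T (lay 1 p' A₁) (lay 1 k' D₁) :) :=
  wh (lay 1 (χ A₄ D₄ A₃ D₃) (A₂ * (D₂ * (A₁ * D₁)))) (ten 1 (chl p k A₂ D₂).hom (A₁ * D₁))
      (lay 1 (T p' k' :) (A₁ * D₁) ⨾ χ A₄₃₂ D₄₃₂ A₁ D₁) ≫
    wh (lay 1 (χ A₄ D₄ A₃ D₃) (A₂ * (D₂ * (A₁ * D₁))) ⨾
        lay 1 (χ (A₄ * A₃) (D₄ * D₃) A₂ D₂) (A₁ * D₁) ⨾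
        lay 1 (T (lay 1 p A₂) (lay 1 k D₂) :) (A₁ * D₁)) (chl p' k' A₁ D₁).hom (one _) ≫
    wh (lay 1 (χ A₄ D₄ A₃ D₃) (A₂ * (D₂ * (A₁ * D₁))) ⨾
        lay 1 (χ (A₄ * A₃) (D₄ * D₃) A₂ D₂) (A₁ * D₁))
      (chl (lay 1 p A₂) (lay 1 k D₂) A₁ D₁).hom (T (lay 1 p' A₁) (lay 1 k' D₁) :)

/-- Moving all tensor products of 1-cells to the right of the middle exchanges, for the
bracketing `(4 (3 2)) 1`. -/
def moveRL (A₁ D₁ : Ob V) (q : Hom1 (A₃ * A₂) A₃₂) (q' : Hom1 (A₄ * A₃₂) A₄₃₂)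
    (l : Hom1 (D₃ * D₂) D₃₂) (l' : Hom1 (D₄ * D₃₂) D₄₃₂) :
    lay (A₄ * D₄) (χ A₃ D₃ A₂ D₂ ⨾ (T q l :)) (A₁ * D₁) ⨾
        lay 1 (χ A₄ D₄ A₃₂ D₃₂ ⨾ (T q' l' :)) (A₁ * D₁) ⨾ χ A₄₃₂ D₄₃₂ A₁ D₁ ⟶
      lay (A₄ * D₄) (χ A₃ D₃ A₂ D₂) (A₁ * D₁) ⨾
        lay 1 (χ A₄ D₄ (A₃ * A₂) (D₃ * D₂)) (A₁ * D₁) ⨾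
        χ (A₄ * (A₃ * A₂)) (D₄ * (D₃ * D₂)) A₁ D₁ ⨾
        (T (lay A₄ q A₁) (lay D₄ l D₁) :) ⨾ (T (lay 1 q' A₁) (lay 1 l' D₁) :) :=
  wh (lay (A₄ * D₄) (χ A₃ D₃ A₂ D₂) (A₁ * D₁)) (ten 1 (chr A₄ D₄ q l).hom (A₁ * D₁))
      (lay 1 (T q' l' :) (A₁ * D₁) ⨾ χ A₄₃₂ D₄₃₂ A₁ D₁) ≫
    wh (lay (A₄ * D₄) (χ A₃ D₃ A₂ D₂) (A₁ * D₁) ⨾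
        lay 1 (χ A₄ D₄ (A₃ * A₂) (D₃ * D₂)) (A₁ * D₁) ⨾
        lay 1 (T (lay A₄ q 1) (lay D₄ l 1) :) (A₁ * D₁)) (chl q' l' A₁ D₁).hom (one _) ≫
    wh (lay (A₄ * D₄) (χ A₃ D₃ A₂ D₂) (A₁ * D₁) ⨾
        lay 1 (χ A₄ D₄ (A₃ * A₂) (D₃ * D₂)) (A₁ * D₁))
      (chl (lay A₄ q 1) (lay D₄ l 1) A₁ D₁).hom (T (lay 1 q' A₁) (lay 1 l' D₁) :)

/-- Moving all tensor products of 1-cells to the right of the middle exchanges, for the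
bracketing `4 ((3 2) 1)`. -/
def moveLR (A₄ A₁ D₄ D₁ : Ob V) (q : Hom1 (A₃ * A₂) A₃₂) (q' : Hom1 (A₃₂ * A₁) A₃₂₁)
    (l : Hom1 (D₃ * D₂) D₃₂) (l' : Hom1 (D₃₂ * D₁) D₃₂₁) :
    lay (A₄ * D₄) (χ A₃ D₃ A₂ D₂ ⨾ (T q l :)) (A₁ * D₁) ⨾
        lay (A₄ * D₄) (χ A₃₂ D₃₂ A₁ D₁ ⨾ (T q' l' :)) 1 ⨾ χ A₄ D₄ A₃₂₁ D₃₂₁ ⟶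
      lay (A₄ * D₄) (χ A₃ D₃ A₂ D₂) (A₁ * D₁) ⨾
        lay (A₄ * D₄) (χ (A₃ * A₂) (D₃ * D₂) A₁ D₁) 1 ⨾
        χ A₄ D₄ (A₃ * (A₂ * A₁)) (D₃ * (D₂ * D₁)) ⨾
        (T (lay A₄ q A₁) (lay D₄ l D₁) :) ⨾ (T (lay A₄ q' 1) (lay D₄ l' 1) :) :=
  wh (lay (A₄ * D₄) (χ A₃ D₃ A₂ D₂) (A₁ * D₁)) (ten (A₄ * D₄) (chl q l A₁ D₁).hom 1)
      (lay (A₄ * D₄) (T q' l' :) 1 ⨾ χ A₄ D₄ A₃₂₁ D₃₂₁) ≫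
    wh (lay (A₄ * D₄) (χ A₃ D₃ A₂ D₂) (A₁ * D₁) ⨾
        lay (A₄ * D₄) (χ (A₃ * A₂) (D₃ * D₂) A₁ D₁) 1 ⨾
        lay (A₄ * D₄) (T (lay 1 q A₁) (lay 1 l D₁) :) 1) (chr A₄ D₄ q' l').hom (one _) ≫
    wh (lay (A₄ * D₄) (χ A₃ D₃ A₂ D₂) (A₁ * D₁) ⨾
        lay (A₄ * D₄) (χ (A₃ * A₂) (D₃ * D₂) A₁ D₁) 1)
      (chr A₄ D₄ (lay 1 q A₁) (lay 1 l D₁)).hom (T (lay A₄ q' 1) (lay D₄ l' 1) :)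

/-- Moving all tensor products of 1-cells to the right of the middle exchanges, for the
bracketing `4 (3 (2 1))`. -/
def moveRR (A₄ A₃ D₄ D₃ : Ob V) (r : Hom1 (A₂ * A₁) A₂₁) (r' : Hom1 (A₃ * A₂₁) A₃₂₁)
    (n : Hom1 (D₂ * D₁) D₂₁) (n' : Hom1 (D₃ * D₂₁) D₃₂₁) :
    lay (A₄ * (D₄ * (A₃ * D₃))) (χ A₂ D₂ A₁ D₁ ⨾ (T r n :)) 1 ⨾
        lay (A₄ * D₄) (χ A₃ D₃ A₂₁ D₂₁ ⨾ (T r' n' :)) 1 ⨾ χ A₄ D₄ A₃₂₁ D₃₂₁ ≅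
      lay (A₄ * (D₄ * (A₃ * D₃))) (χ A₂ D₂ A₁ D₁) 1 ⨾
        lay (A₄ * D₄) (χ A₃ D₃ (A₂ * A₁) (D₂ * D₁)) 1 ⨾
        χ A₄ D₄ (A₃ * (A₂ * A₁)) (D₃ * (D₂ * D₁)) ⨾
        (T (lay (A₄ * A₃) r 1) (lay (D₄ * D₃) n 1) :) ⨾ (T (lay A₄ r' 1) (lay D₄ n' 1) :) :=
  whI (lay (A₄ * (D₄ * (A₃ * D₃))) (χ A₂ D₂ A₁ D₁) 1) (tenI (A₄ * D₄) (chr A₃ D₃ r n) 1)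
      (lay (A₄ * D₄) (T r' n' :) 1 ⨾ χ A₄ D₄ A₃₂₁ D₃₂₁) ≪≫
    whI (lay (A₄ * (D₄ * (A₃ * D₃))) (χ A₂ D₂ A₁ D₁) 1 ⨾
        lay (A₄ * D₄) (χ A₃ D₃ (A₂ * A₁) (D₂ * D₁)) 1 ⨾
        lay (A₄ * D₄) (T (lay A₃ r 1) (lay D₃ n 1) :) 1) (chr A₄ D₄ r' n') (one _) ≪≫
    whI (lay (A₄ * (D₄ * (A₃ * D₃))) (χ A₂ D₂ A₁ D₁) 1 ⨾
        lay (A₄ * D₄) (χ A₃ D₃ (A₂ * A₁) (D₂ * D₁)) 1)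
      (chr A₄ D₄ (lay A₃ r 1) (lay D₃ n 1)) (T (lay A₄ r' 1) (lay D₄ n' 1) :)

/-- Moving all tensor products of 1-cells to the right of the middle exchanges, for the
bracketing `(4 3) (2 1)`, with `4 3` first. -/
def movePairL (p : Hom1 (A₄ * A₃) A₄₃) (r : Hom1 (A₂ * A₁) A₂₁)
    (k : Hom1 (D₄ * D₃) D₄₃) (n : Hom1 (D₂ * D₁) D₂₁) :
    lay 1 (χ A₄ D₄ A₃ D₃ ⨾ (T p k :)) (A₂ * (D₂ * (A₁ * D₁))) ⨾
        lay (A₄₃ * D₄₃) (χ A₂ D₂ A₁ D₁ ⨾ (T r n :)) 1 ⨾ χ A₄₃ D₄₃ A₂₁ D₂₁ ⟶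
      lay 1 (χ A₄ D₄ A₃ D₃) (A₂ * (D₂ * (A₁ * D₁))) ⨾
        lay (A₄ * (A₃ * (D₄ * D₃))) (χ A₂ D₂ A₁ D₁) 1 ⨾
        χ (A₄ * A₃) (D₄ * D₃) (A₂ * A₁) (D₂ * D₁) ⨾
        (T (lay 1 p (A₂ * A₁)) (lay 1 k (D₂ * D₁)) :) ⨾ (T (lay A₄₃ r 1) (lay D₄₃ n 1) :) :=
  wh (lay 1 (χ A₄ D₄ A₃ D₃ ⨾ (T p k :)) (A₂ * (D₂ * (A₁ * D₁))) ⨾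
        lay (A₄₃ * D₄₃) (χ A₂ D₂ A₁ D₁) 1) (chr A₄₃ D₄₃ r n).hom (one _) ≫
    wh (lay 1 (χ A₄ D₄ A₃ D₃) (A₂ * (D₂ * (A₁ * D₁)))) (sig (T p k :) (χ A₂ D₂ A₁ D₁)).inv
      (χ A₄₃ D₄₃ (A₂ * A₁) (D₂ * D₁) ⨾ (T (lay A₄₃ r 1) (lay D₄₃ n 1) :)) ≫
    wh (lay 1 (χ A₄ D₄ A₃ D₃) (A₂ * (D₂ * (A₁ * D₁))) ⨾
        lay (A₄ * (A₃ * (D₄ * D₃))) (χ A₂ D₂ A₁ D₁) 1)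
      (chl p k (A₂ * A₁) (D₂ * D₁)).hom (T (lay A₄₃ r 1) (lay D₄₃ n 1) :)

/-- Moving all tensor products of 1-cells to the right of the middle exchanges, for the
bracketing `(4 3) (2 1)`, with `2 1` first. -/
def movePairR (p : Hom1 (A₄ * A₃) A₄₃) (r : Hom1 (A₂ * A₁) A₂₁)
    (k : Hom1 (D₄ * D₃) D₄₃) (n : Hom1 (D₂ * D₁) D₂₁) :
    lay (A₄ * (D₄ * (A₃ * D₃))) (χ A₂ D₂ A₁ D₁ ⨾ (T r n :)) 1 ⨾
        lay 1 (χ A₄ D₄ A₃ D₃ ⨾ (T p k :)) (A₂₁ * D₂₁) ⨾ χ A₄₃ D₄₃ A₂₁ D₂₁ ⟶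
      lay (A₄ * (D₄ * (A₃ * D₃))) (χ A₂ D₂ A₁ D₁) 1 ⨾
        lay 1 (χ A₄ D₄ A₃ D₃) (A₂ * (A₁ * (D₂ * D₁))) ⨾
        χ (A₄ * A₃) (D₄ * D₃) (A₂ * A₁) (D₂ * D₁) ⨾
        (T (lay (A₄ * A₃) r 1) (lay (D₄ * D₃) n 1) :) ⨾ (T (lay 1 p A₂₁) (lay 1 k D₂₁) :) :=
  wh (lay (A₄ * (D₄ * (A₃ * D₃))) (χ A₂ D₂ A₁ D₁ ⨾ (T r n :)) 1 ⨾
        lay 1 (χ A₄ D₄ A₃ D₃) (A₂₁ * D₂₁)) (chl p k A₂₁ D₂₁).hom (one _) ≫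
    wh (lay (A₄ * (D₄ * (A₃ * D₃))) (χ A₂ D₂ A₁ D₁) 1) (sig (χ A₄ D₄ A₃ D₃) (T r n :)).hom
      (χ (A₄ * A₃) (D₄ * D₃) A₂₁ D₂₁ ⨾ (T (lay 1 p A₂₁) (lay 1 k D₂₁) :)) ≫
    wh (lay (A₄ * (D₄ * (A₃ * D₃))) (χ A₂ D₂ A₁ D₁) 1 ⨾
        lay 1 (χ A₄ D₄ A₃ D₃) (A₂ * (A₁ * (D₂ * D₁))))
      (chr (A₄ * A₃) (D₄ * D₃) r n).hom (T (lay 1 p A₂₁) (lay 1 k D₂₁) :)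

/-- The inverse crossing that ends `al` cancels against the first step of `moveRL`. The remaining
crossings commute with `om`, and `chl_Th` carries `Th` past the last exchange. -/
theorem al_moveRL (A₁ D₁ : Ob V) {p : Hom1 (A₄ * A₃) A₄₃} {p' : Hom1 (A₄₃ * A₂) A₄₃₂}
    {q : Hom1 (A₃ * A₂) A₃₂} {q' : Hom1 (A₄ * A₃₂) A₄₃₂} {k : Hom1 (D₄ * D₃) D₄₃}
    {k' : Hom1 (D₄₃ * D₂) D₄₃₂} {l : Hom1 (D₃ * D₂) D₃₂} {l' : Hom1 (D₄ * D₃₂) D₄₃₂}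
    (η : lay 1 p A₂ ⨾ p' ⟶ lay A₄ q 1 ⨾ q') (θ : lay 1 k D₂ ⨾ k' ⟶ lay D₄ l 1 ⨾ l') :
    wh (one _) (ten 1 (al η θ) (A₁ * D₁)) (χ A₄₃₂ D₄₃₂ A₁ D₁) ≫ moveRL A₁ D₁ q q' l l' =
      moveLL A₂ A₁ D₂ D₁ p p' k k' ≫
        wh (one _) (ten 1 (om A₄ D₄ A₃ D₃ A₂ D₂).hom (A₁ * D₁))
          (χ (A₄ * (A₃ * A₂)) (D₄ * (D₃ * D₂)) A₁ D₁ ⨾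
            (T (lay 1 p (A₂ * A₁)) (lay 1 k (D₂ * D₁)) :) ⨾ (T (lay 1 p' A₁) (lay 1 k' D₁) :)) ≫
        wh (lay (A₄ * D₄) (χ A₃ D₃ A₂ D₂) (A₁ * D₁) ⨾
            lay 1 (χ A₄ D₄ (A₃ * A₂) (D₃ * D₂)) (A₁ * D₁) ⨾
            χ (A₄ * (A₃ * A₂)) (D₄ * (D₃ * D₂)) A₁ D₁)
          (Th (f := lay 1 p (A₂ * A₁)) (f' := lay 1 p' A₁) (h := lay A₄ q A₁)
            (h' := lay 1 q' A₁) (g := lay 1 k (D₂ * D₁)) (g' := lay 1 k' D₁)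
            (k := lay D₄ l D₁) (k' := lay 1 l' D₁) (ten 1 η A₁) (ten 1 θ D₁)) (one _) := by
  simp only [al, moveRL, moveLL, wh_comp, wh_wh, ten_comp, ten_wh, Category.assoc]
  have h₁ := wh_inv_hom (lay (A₄ * D₄) (χ A₃ D₃ A₂ D₂) (A₁ * D₁))
    (tenI 1 (chr A₄ D₄ q l) (A₁ * D₁)) (lay 1 (T q' l' :) (A₁ * D₁) ⨾ χ A₄₃₂ D₄₃₂ A₁ D₁)
  have h₂ := xch (one _) (ten 1 (om A₄ D₄ A₃ D₃ A₂ D₂).hom (A₁ * D₁))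
    (lay 1 (T (lay A₄ q 1) (lay D₄ l 1) :) (A₁ * D₁)) (chl q' l' A₁ D₁).hom (one _)
  have h₃ := xch (one _) (ten 1 (om A₄ D₄ A₃ D₃ A₂ D₂).hom (A₁ * D₁)) (one _)
    (chl (lay A₄ q 1) (lay D₄ l 1) A₁ D₁).hom (T (lay 1 q' A₁) (lay 1 l' D₁) :)
  have h₄ := congrArg (fun t => wh (lay 1 (χ A₄ D₄ A₃ D₃) (A₂ * (D₂ * (A₁ * D₁))) ⨾
    lay 1 (χ (A₄ * A₃) (D₄ * D₃) A₂ D₂) (A₁ * D₁)) t (one _)) (chl_Th η θ A₁ D₁)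
  have h₅ := xch (one _) (ten 1 (om A₄ D₄ A₃ D₃ A₂ D₂).hom (A₁ * D₁))
    (χ (A₄ * (A₃ * A₂)) (D₄ * (D₃ * D₂)) A₁ D₁)
    (Th (f := lay 1 p (A₂ * A₁)) (f' := lay 1 p' A₁) (h := lay A₄ q A₁)
      (h' := lay 1 q' A₁) (g := lay 1 k (D₂ * D₁)) (g' := lay 1 k' D₁)
      (k := lay D₄ l D₁) (k' := lay 1 l' D₁) (ten 1 η A₁) (ten 1 θ D₁)) (one _)
  simp only [wh_comp, wh_wh] at h₄
  erw [reassoc_of% h₁]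
  erw [reassoc_of% h₂]
  erw [h₃]
  erw [reassoc_of% h₄]
  erw [← h₅]
  rfl

/-- The same argument with the idle pair on the left, using `chr_Th` for the last exchange. -/
theorem al_moveRR (A₄ D₄ : Ob V) {q : Hom1 (A₃ * A₂) A₃₂} {q' : Hom1 (A₃₂ * A₁) A₃₂₁}
    {r : Hom1 (A₂ * A₁) A₂₁} {r' : Hom1 (A₃ * A₂₁) A₃₂₁} {l : Hom1 (D₃ * D₂) D₃₂}
    {l' : Hom1 (D₃₂ * D₁) D₃₂₁} {n : Hom1 (D₂ * D₁) D₂₁} {n' : Hom1 (D₃ * D₂₁) D₃₂₁}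
    (η : lay 1 q A₁ ⨾ q' ⟶ lay A₃ r 1 ⨾ r') (θ : lay 1 l D₁ ⨾ l' ⟶ lay D₃ n 1 ⨾ n') :
    wh (one _) (ten (A₄ * D₄) (al η θ) 1) (χ A₄ D₄ A₃₂₁ D₃₂₁) ≫ (moveRR A₄ A₃ D₄ D₃ r r' n n').hom =
      moveLR A₄ A₁ D₄ D₁ q q' l l' ≫
        wh (one _) (ten (A₄ * D₄) (om A₃ D₃ A₂ D₂ A₁ D₁).hom 1)
          (χ A₄ D₄ (A₃ * (A₂ * A₁)) (D₃ * (D₂ * D₁)) ⨾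
            (T (lay A₄ q A₁) (lay D₄ l D₁) :) ⨾ (T (lay A₄ q' 1) (lay D₄ l' 1) :)) ≫
        wh (lay (A₄ * (D₄ * (A₃ * D₃))) (χ A₂ D₂ A₁ D₁) 1 ⨾
            lay (A₄ * D₄) (χ A₃ D₃ (A₂ * A₁) (D₂ * D₁)) 1 ⨾
            χ A₄ D₄ (A₃ * (A₂ * A₁)) (D₃ * (D₂ * D₁)))
          (Th (f := lay A₄ q A₁) (f' := lay A₄ q' 1) (h := lay (A₄ * A₃) r 1)
            (h' := lay A₄ r' 1) (g := lay D₄ l D₁) (g' := lay D₄ l' 1)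
            (k := lay (D₄ * D₃) n 1) (k' := lay D₄ n' 1) (ten A₄ η 1) (ten D₄ θ 1)) (one _) := by
  simp only [al, moveLR, moveRR, Iso.trans_hom, whI_hom, tenI_hom, wh_comp, wh_wh, ten_comp, ten_wh,
    Category.assoc]
  have h₁ := wh_inv_hom (lay (A₄ * (D₄ * (A₃ * D₃))) (χ A₂ D₂ A₁ D₁) 1)
    (tenI (A₄ * D₄) (chr A₃ D₃ r n) 1) (lay (A₄ * D₄) (T r' n' :) 1 ⨾ χ A₄ D₄ A₃₂₁ D₃₂₁)
  have h₂ := xch (one _) (ten (A₄ * D₄) (om A₃ D₃ A₂ D₂ A₁ D₁).hom 1)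
    (lay (A₄ * D₄) (T (lay A₃ r 1) (lay D₃ n 1) :) 1) (chr A₄ D₄ r' n').hom (one _)
  have h₃ := xch (one _) (ten (A₄ * D₄) (om A₃ D₃ A₂ D₂ A₁ D₁).hom 1) (one _)
    (chr A₄ D₄ (lay A₃ r 1) (lay D₃ n 1)).hom (T (lay A₄ r' 1) (lay D₄ n' 1) :)
  have h₄ := congrArg (fun t => wh (lay (A₄ * D₄) (χ A₃ D₃ A₂ D₂) (A₁ * D₁) ⨾
    lay (A₄ * D₄) (χ (A₃ * A₂) (D₃ * D₂) A₁ D₁) 1) t (one _)) (chr_Th A₄ D₄ η θ)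
  have h₅ := xch (one _) (ten (A₄ * D₄) (om A₃ D₃ A₂ D₂ A₁ D₁).hom 1)
    (χ A₄ D₄ (A₃ * (A₂ * A₁)) (D₃ * (D₂ * D₁)))
    (Th (f := lay A₄ q A₁) (f' := lay A₄ q' 1) (h := lay (A₄ * A₃) r 1)
      (h' := lay A₄ r' 1) (g := lay D₄ l D₁) (g' := lay D₄ l' 1)
      (k := lay (D₄ * D₃) n 1) (k' := lay D₄ n' 1) (ten A₄ η 1) (ten D₄ θ 1)) (one _)
  simp only [wh_comp, wh_wh] at h₄
  erw [reassoc_of% h₁]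
  erw [reassoc_of% h₂]
  erw [h₃]
  erw [reassoc_of% h₄]
  erw [← h₅]
  rfl

/-- Here the pairs 3 and 2 are composed before the associator acts, so their `T` has to cross `om`
in its middle pair, by `om_nat₂`. -/
theorem al_moveLR {q : Hom1 (A₃ * A₂) A₃₂} {q' : Hom1 (A₄ * A₃₂) A₄₃₂} {t : Hom1 (A₄₃₂ * A₁) A}
    {q'' : Hom1 (A₃₂ * A₁) A₃₂₁} {v : Hom1 (A₄ * A₃₂₁) A}
    {l : Hom1 (D₃ * D₂) D₃₂} {l' : Hom1 (D₄ * D₃₂) D₄₃₂} {t' : Hom1 (D₄₃₂ * D₁) D}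
    {l'' : Hom1 (D₃₂ * D₁) D₃₂₁} {v' : Hom1 (D₄ * D₃₂₁) D}
    (η : lay 1 q' A₁ ⨾ t ⟶ lay A₄ q'' 1 ⨾ v) (θ : lay 1 l' D₁ ⨾ t' ⟶ lay D₄ l'' 1 ⨾ v') :
    wh (lay (A₄ * D₄) (χ A₃ D₃ A₂ D₂ ⨾ (T q l :)) (A₁ * D₁)) (al η θ) (one _) ≫
        wh (one _) (moveLR A₄ A₁ D₄ D₁ q q'' l l'') (T v v' :) =
      wh (one _) (moveRL A₁ D₁ q q' l l') (T t t' :) ≫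
        wh (lay (A₄ * D₄) (χ A₃ D₃ A₂ D₂) (A₁ * D₁))
          (om A₄ D₄ (A₃ * A₂) (D₃ * D₂) A₁ D₁).hom
          ((T (lay A₄ q A₁) (lay D₄ l D₁) :) ⨾ (T (lay 1 q' A₁) (lay 1 l' D₁) :) ⨾ (T t t' :)) ≫
        wh (lay (A₄ * D₄) (χ A₃ D₃ A₂ D₂) (A₁ * D₁) ⨾
            lay (A₄ * D₄) (χ (A₃ * A₂) (D₃ * D₂) A₁ D₁) 1 ⨾
            χ A₄ D₄ (A₃ * (A₂ * A₁)) (D₃ * (D₂ * D₁)) ⨾ (T (lay A₄ q A₁) (lay D₄ l D₁) :))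
          (Th (f := lay 1 q' A₁) (f' := t) (h := lay A₄ q'' 1) (h' := v)
            (g := lay 1 l' D₁) (g' := t') (k := lay D₄ l'' 1) (k' := v') η θ) (one _) := by
  simp only [al, moveLR, moveRL, wh_comp, wh_wh, Category.assoc]
  have h₁ := xch (lay (A₄ * D₄) (χ A₃ D₃ A₂ D₂) (A₁ * D₁)) (ten (A₄ * D₄) (chl q l A₁ D₁).hom 1)
    (one _) (chr A₄ D₄ q'' l'').inv (T v v' :)
  have h₂ := wh_inv_hom (lay (A₄ * D₄) (χ A₃ D₃ A₂ D₂) (A₁ * D₁) ⨾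
        lay (A₄ * D₄) (χ (A₃ * A₂) (D₃ * D₂) A₁ D₁) 1 ⨾
        lay (A₄ * D₄) (T (lay 1 q A₁) (lay 1 l D₁) :) 1) (chr A₄ D₄ q'' l'') (T v v' :)
  have h₃ := xch (lay (A₄ * D₄) (χ A₃ D₃ A₂ D₂ ⨾ (T q l :)) (A₁ * D₁))
    (om A₄ D₄ A₃₂ D₃₂ A₁ D₁).hom (one _)
    (Th (f := lay 1 q' A₁) (f' := t) (h := lay A₄ q'' 1) (h' := v)
            (g := lay 1 l' D₁) (g' := t') (k := lay D₄ l'' 1) (k' := v') η θ) (one _)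
  have h₄ := xch (lay (A₄ * D₄) (χ A₃ D₃ A₂ D₂) (A₁ * D₁)) (ten (A₄ * D₄) (chl q l A₁ D₁).hom 1)
    (χ A₄ D₄ (A₃₂ * A₁) (D₃₂ * D₁))
    (Th (f := lay 1 q' A₁) (f' := t) (h := lay A₄ q'' 1) (h' := v)
            (g := lay 1 l' D₁) (g' := t') (k := lay D₄ l'' 1) (k' := v') η θ) (one _)
  have h₅ := xch (lay (A₄ * D₄) (χ A₃ D₃ A₂ D₂) (A₁ * D₁) ⨾
        lay (A₄ * D₄) (χ (A₃ * A₂) (D₃ * D₂) A₁ D₁) 1)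
      (chr A₄ D₄ (lay 1 q A₁) (lay 1 l D₁)).hom (one _)
    (Th (f := lay 1 q' A₁) (f' := t) (h := lay A₄ q'' 1) (h' := v)
            (g := lay 1 l' D₁) (g' := t') (k := lay D₄ l'' 1) (k' := v') η θ) (one _)
  have h₆ := congrArg (fun z => wh (lay (A₄ * D₄) (χ A₃ D₃ A₂ D₂) (A₁ * D₁)) z
    ((T (lay 1 q' A₁) (lay 1 l' D₁) :) ⨾ (T t t' :))) (om_nat₂ A₄ D₄ q l A₁ D₁)
  have h₇ := xch (lay (A₄ * D₄) (χ A₃ D₃ A₂ D₂) (A₁ * D₁))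
    (ten 1 (chr A₄ D₄ q l).hom (A₁ * D₁)) (one _) (chl q' l' A₁ D₁).hom (T t t' :)
  simp only [wh_comp, wh_wh] at h₆
  erw [← reassoc_of% h₁]
  erw [reassoc_of% h₂]
  erw [← reassoc_of% h₃]
  erw [← reassoc_of% h₄]
  erw [← h₅]
  erw [← reassoc_of% h₆]
  erw [← reassoc_of% h₇]
  rfl

/-- The pairs 4 and 3 have been composed: their `T` crosses `om` in its left pair, by `om_nat₁`. -/
theorem al_movePairL {p : Hom1 (A₄ * A₃) A₄₃} {p' : Hom1 (A₄₃ * A₂) A₄₃₂} {t : Hom1 (A₄₃₂ * A₁) A}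
    {r : Hom1 (A₂ * A₁) A₂₁} {s : Hom1 (A₄₃ * A₂₁) A}
    {k : Hom1 (D₄ * D₃) D₄₃} {k' : Hom1 (D₄₃ * D₂) D₄₃₂} {t' : Hom1 (D₄₃₂ * D₁) D}
    {n : Hom1 (D₂ * D₁) D₂₁} {s' : Hom1 (D₄₃ * D₂₁) D}
    (η : lay 1 p' A₁ ⨾ t ⟶ lay A₄₃ r 1 ⨾ s) (θ : lay 1 k' D₁ ⨾ t' ⟶ lay D₄₃ n 1 ⨾ s') :
    wh (lay 1 (χ A₄ D₄ A₃ D₃ ⨾ (T p k :)) (A₂ * (D₂ * (A₁ * D₁)))) (al η θ) (one _) ≫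
        wh (one _) (movePairL p r k n) (T s s' :) =
      wh (one _) (moveLL A₂ A₁ D₂ D₁ p p' k k') (T t t' :) ≫
        wh (lay 1 (χ A₄ D₄ A₃ D₃) (A₂ * (D₂ * (A₁ * D₁))))
          (om (A₄ * A₃) (D₄ * D₃) A₂ D₂ A₁ D₁).hom
          ((T (lay 1 p (A₂ * A₁)) (lay 1 k (D₂ * D₁)) :) ⨾ (T (lay 1 p' A₁) (lay 1 k' D₁) :) ⨾
            (T t t' :)) ≫
        wh (lay 1 (χ A₄ D₄ A₃ D₃) (A₂ * (D₂ * (A₁ * D₁))) ⨾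
            lay (A₄ * (A₃ * (D₄ * D₃))) (χ A₂ D₂ A₁ D₁) 1 ⨾
            χ (A₄ * A₃) (D₄ * D₃) (A₂ * A₁) (D₂ * D₁) ⨾
            (T (lay 1 p (A₂ * A₁)) (lay 1 k (D₂ * D₁)) :))
          (Th (f := lay 1 p' A₁) (f' := t) (h := lay A₄₃ r 1) (h' := s)
            (g := lay 1 k' D₁) (g' := t') (k := lay D₄₃ n 1) (k' := s') η θ) (one _) := by
  simp only [al, movePairL, moveLL, wh_comp, wh_wh, Category.assoc]
  have h₂ := wh_inv_hom (lay 1 (χ A₄ D₄ A₃ D₃ ⨾ (T p k :)) (A₂ * (D₂ * (A₁ * D₁))) ⨾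
        lay (A₄₃ * D₄₃) (χ A₂ D₂ A₁ D₁) 1) (chr A₄₃ D₄₃ r n) (T s s' :)
  have h₃ := xch (lay 1 (χ A₄ D₄ A₃ D₃ ⨾ (T p k :)) (A₂ * (D₂ * (A₁ * D₁))))
    (om A₄₃ D₄₃ A₂ D₂ A₁ D₁).hom (one _)
    (Th (f := lay 1 p' A₁) (f' := t) (h := lay A₄₃ r 1) (h' := s)
            (g := lay 1 k' D₁) (g' := t') (k := lay D₄₃ n 1) (k' := s') η θ) (one _)
  have h₄ := xch (lay 1 (χ A₄ D₄ A₃ D₃) (A₂ * (D₂ * (A₁ * D₁))))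
    (sig (T p k :) (χ A₂ D₂ A₁ D₁)).inv (χ A₄₃ D₄₃ (A₂ * A₁) (D₂ * D₁))
    (Th (f := lay 1 p' A₁) (f' := t) (h := lay A₄₃ r 1) (h' := s)
            (g := lay 1 k' D₁) (g' := t') (k := lay D₄₃ n 1) (k' := s') η θ) (one _)
  have h₅ := xch (lay 1 (χ A₄ D₄ A₃ D₃) (A₂ * (D₂ * (A₁ * D₁))) ⨾
        lay (A₄ * (A₃ * (D₄ * D₃))) (χ A₂ D₂ A₁ D₁) 1)
      (chl p k (A₂ * A₁) (D₂ * D₁)).hom (one _)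
    (Th (f := lay 1 p' A₁) (f' := t) (h := lay A₄₃ r 1) (h' := s)
            (g := lay 1 k' D₁) (g' := t') (k := lay D₄₃ n 1) (k' := s') η θ) (one _)
  have h₆ := congrArg (fun z => wh (lay 1 (χ A₄ D₄ A₃ D₃) (A₂ * (D₂ * (A₁ * D₁)))) z
    ((T (lay 1 p' A₁) (lay 1 k' D₁) :) ⨾ (T t t' :))) (om_nat₁ p k A₂ D₂ A₁ D₁)
  have h₇ := xch (lay 1 (χ A₄ D₄ A₃ D₃) (A₂ * (D₂ * (A₁ * D₁))))
    (ten 1 (chl p k A₂ D₂).hom (A₁ * D₁)) (one _) (chl p' k' A₁ D₁).hom (T t t' :)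
  simp only [wh_comp, wh_wh] at h₆
  erw [reassoc_of% h₂]
  erw [← reassoc_of% h₃]
  erw [← reassoc_of% h₄]
  erw [← h₅]
  erw [← reassoc_of% h₆]
  erw [← reassoc_of% h₇]
  rfl

/-- The pairs 2 and 1 have been composed: their `T` crosses `om` in its right pair, by `om_nat₃`. -/
theorem al_moveRR' {p : Hom1 (A₄ * A₃) A₄₃} {r : Hom1 (A₂ * A₁) A₂₁} {s : Hom1 (A₄₃ * A₂₁) A}
    {r' : Hom1 (A₃ * A₂₁) A₃₂₁} {v : Hom1 (A₄ * A₃₂₁) A}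
    {k : Hom1 (D₄ * D₃) D₄₃} {n : Hom1 (D₂ * D₁) D₂₁} {s' : Hom1 (D₄₃ * D₂₁) D}
    {n' : Hom1 (D₃ * D₂₁) D₃₂₁} {v' : Hom1 (D₄ * D₃₂₁) D}
    (η : lay 1 p A₂₁ ⨾ s ⟶ lay A₄ r' 1 ⨾ v) (θ : lay 1 k D₂₁ ⨾ s' ⟶ lay D₄ n' 1 ⨾ v') :
    wh (lay (A₄ * (D₄ * (A₃ * D₃))) (χ A₂ D₂ A₁ D₁ ⨾ (T r n :)) 1)
          (al (p := p) (p' := s) (q := r') (q' := v) (k := k) (k' := s') (l := n') (l' := v') η θ)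
          (one _) ≫
        wh (one _) (moveRR A₄ A₃ D₄ D₃ r r' n n').hom (T v v' :) =
      wh (one _) (movePairR p r k n) (T s s' :) ≫
        wh (lay (A₄ * (D₄ * (A₃ * D₃))) (χ A₂ D₂ A₁ D₁) 1)
          (om A₄ D₄ A₃ D₃ (A₂ * A₁) (D₂ * D₁)).hom
          ((T (lay (A₄ * A₃) r 1) (lay (D₄ * D₃) n 1) :) ⨾ (T (lay 1 p A₂₁) (lay 1 k D₂₁) :) ⨾
            (T s s' :)) ≫
        wh (lay (A₄ * (D₄ * (A₃ * D₃))) (χ A₂ D₂ A₁ D₁) 1 ⨾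
            lay (A₄ * D₄) (χ A₃ D₃ (A₂ * A₁) (D₂ * D₁)) 1 ⨾
            χ A₄ D₄ (A₃ * (A₂ * A₁)) (D₃ * (D₂ * D₁)) ⨾
            (T (lay (A₄ * A₃) r 1) (lay (D₄ * D₃) n 1) :))
          (Th (f := lay 1 p A₂₁) (f' := s) (h := lay A₄ r' 1) (h' := v)
            (g := lay 1 k D₂₁) (g' := s') (k := lay D₄ n' 1) (k' := v') η θ) (one _) := by
  simp only [al, moveRR, movePairR, Iso.trans_hom, whI_hom, tenI_hom, wh_comp, wh_wh,
    Category.assoc]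
  have h₁ := xch (lay (A₄ * (D₄ * (A₃ * D₃))) (χ A₂ D₂ A₁ D₁) 1)
    (ten (A₄ * D₄) (chr A₃ D₃ r n).hom 1)
    (one _) (chr A₄ D₄ r' n').inv (T v v' :)
  have h₂ := wh_inv_hom (lay (A₄ * (D₄ * (A₃ * D₃))) (χ A₂ D₂ A₁ D₁) 1 ⨾
        lay (A₄ * D₄) (χ A₃ D₃ (A₂ * A₁) (D₂ * D₁)) 1 ⨾
        lay (A₄ * D₄) (T (lay A₃ r 1) (lay D₃ n 1) :) 1) (chr A₄ D₄ r' n') (T v v' :)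
  have h₃ := xch (lay (A₄ * (D₄ * (A₃ * D₃))) (χ A₂ D₂ A₁ D₁ ⨾ (T r n :)) 1)
    (om A₄ D₄ A₃ D₃ A₂₁ D₂₁).hom (one _)
    (Th (f := lay 1 p A₂₁) (f' := s) (h := lay A₄ r' 1) (h' := v)
            (g := lay 1 k D₂₁) (g' := s') (k := lay D₄ n' 1) (k' := v') η θ) (one _)
  have h₄ := xch (lay (A₄ * (D₄ * (A₃ * D₃))) (χ A₂ D₂ A₁ D₁) 1)
    (ten (A₄ * D₄) (chr A₃ D₃ r n).hom 1)
    (χ A₄ D₄ (A₃ * A₂₁) (D₃ * D₂₁))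
    (Th (f := lay 1 p A₂₁) (f' := s) (h := lay A₄ r' 1) (h' := v)
            (g := lay 1 k D₂₁) (g' := s') (k := lay D₄ n' 1) (k' := v') η θ) (one _)
  have h₅ := xch (lay (A₄ * (D₄ * (A₃ * D₃))) (χ A₂ D₂ A₁ D₁) 1 ⨾
        lay (A₄ * D₄) (χ A₃ D₃ (A₂ * A₁) (D₂ * D₁)) 1)
      (chr A₄ D₄ (lay A₃ r 1) (lay D₃ n 1)).hom (one _)
    (Th (f := lay 1 p A₂₁) (f' := s) (h := lay A₄ r' 1) (h' := v)
            (g := lay 1 k D₂₁) (g' := s') (k := lay D₄ n' 1) (k' := v') η θ) (one _)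
  have h₆ := congrArg (fun z => wh (lay (A₄ * (D₄ * (A₃ * D₃))) (χ A₂ D₂ A₁ D₁) 1) z
    ((T (lay 1 p A₂₁) (lay 1 k D₂₁) :) ⨾ (T s s' :))) (om_nat₃ A₄ D₄ A₃ D₃ r n)
  simp only [wh_comp, wh_wh] at h₆
  erw [← reassoc_of% h₁]
  erw [reassoc_of% h₂]
  erw [← reassoc_of% h₃]
  erw [← reassoc_of% h₄]
  erw [← h₅]
  erw [← reassoc_of% h₆]
  rfl

/-- The interchanger of two compositions has four parts. That of the two exchanges remains; the part
with the second `T` cancels against `movePairR`; the part with the second exchange belongs to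
`movePairL`; and that of the two `T`s becomes a `Th` by `chl_chr`. -/
theorem movePairL_movePairR (p : Hom1 (A₄ * A₃) A₄₃) (r : Hom1 (A₂ * A₁) A₂₁)
    (k : Hom1 (D₄ * D₃) D₄₃) (n : Hom1 (D₂ * D₁) D₂₁) :
    wh (one _) (sig (χ A₄ D₄ A₃ D₃ ⨾ (T p k :)) (χ A₂ D₂ A₁ D₁ ⨾ (T r n :))).inv
        (χ A₄₃ D₄₃ A₂₁ D₂₁) ≫
        movePairR p r k n =
      movePairL p r k n ≫
        wh (one _) (sig (χ A₄ D₄ A₃ D₃) (χ A₂ D₂ A₁ D₁)).inv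
          (χ (A₄ * A₃) (D₄ * D₃) (A₂ * A₁) (D₂ * D₁) ⨾
            (T (lay 1 p (A₂ * A₁)) (lay 1 k (D₂ * D₁)) :) ⨾ (T (lay A₄₃ r 1) (lay D₄₃ n 1) :)) ≫
        wh (lay (A₄ * (D₄ * (A₃ * D₃))) (χ A₂ D₂ A₁ D₁) 1 ⨾
            lay 1 (χ A₄ D₄ A₃ D₃) (A₂ * (A₁ * (D₂ * D₁))) ⨾
            χ (A₄ * A₃) (D₄ * D₃) (A₂ * A₁) (D₂ * D₁))
          (Th (f := lay 1 p (A₂ * A₁)) (f' := lay A₄₃ r 1) (h := lay (A₄ * A₃) r 1)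
            (h' := lay 1 p A₂₁) (g := lay 1 k (D₂ * D₁)) (g' := lay D₄₃ n 1)
            (k := lay (D₄ * D₃) n 1) (k' := lay 1 k D₂₁)
            (sig p r).inv (sig k n).inv) (one _) := by
  simp only [movePairL, movePairR, sig_comp_left_inv, sig_comp_right_inv, wh_comp, wh_wh,
    Category.assoc]
  have h₁ := xch (lay (A₄ * (D₄ * (A₃ * D₃))) (χ A₂ D₂ A₁ D₁) 1)
    (sig (χ A₄ D₄ A₃ D₃) (T r n :)).inv (one _) (chl p k A₂₁ D₂₁).hom (one _)
  have h₂ := wh_inv_hom (lay (A₄ * (D₄ * (A₃ * D₃))) (χ A₂ D₂ A₁ D₁) 1)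
    (sig (χ A₄ D₄ A₃ D₃) (T r n :))
    (χ (A₄ * A₃) (D₄ * D₃) A₂₁ D₂₁ ⨾ (T (lay 1 p A₂₁) (lay 1 k D₂₁) :))
  have h₃ := xch (one _) (sig (χ A₄ D₄ A₃ D₃) (χ A₂ D₂ A₁ D₁)).inv
    (lay (A₄ * (A₃ * (D₄ * D₃))) (T r n :) 1) (chl p k A₂₁ D₂₁).hom (one _)
  have h₄ := xch (one _) (sig (χ A₄ D₄ A₃ D₃) (χ A₂ D₂ A₁ D₁)).inv (one _)
    (chr (A₄ * A₃) (D₄ * D₃) r n).hom (T (lay 1 p A₂₁) (lay 1 k D₂₁) :)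
  have h₅ := congrArg (fun z => wh (lay 1 (χ A₄ D₄ A₃ D₃) (A₂ * (D₂ * (A₁ * D₁))) ⨾
    lay (A₄ * (A₃ * (D₄ * D₃))) (χ A₂ D₂ A₁ D₁) 1) z (one _)) (chl_chr p k r n)
  have h₆ := xch (lay 1 (χ A₄ D₄ A₃ D₃) (A₂ * (D₂ * (A₁ * D₁))))
    (sig (T p k :) (χ A₂ D₂ A₁ D₁)).inv (one _) (chr A₄₃ D₄₃ r n).hom (one _)
  have h₇ := xch (one _) (sig (χ A₄ D₄ A₃ D₃) (χ A₂ D₂ A₁ D₁)).inv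
    (χ (A₄ * A₃) (D₄ * D₃) (A₂ * A₁) (D₂ * D₁))
    (Th (f := lay 1 p (A₂ * A₁)) (f' := lay A₄₃ r 1) (h := lay (A₄ * A₃) r 1)
      (h' := lay 1 p A₂₁) (g := lay 1 k (D₂ * D₁)) (g' := lay D₄₃ n 1)
      (k := lay (D₄ * D₃) n 1) (k' := lay 1 k D₂₁)
      (sig p r).inv (sig k n).inv) (one _)
  simp only [wh_comp, wh_wh] at h₅
  erw [reassoc_of% h₁]
  erw [reassoc_of% h₂]
  have h₀ := xch (one _) (sig (χ A₄ D₄ A₃ D₃) (χ A₂ D₂ A₁ D₁)).inv (one _)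
    (sig (T p k :) (T r n :)).inv (χ A₄₃ D₄₃ A₂₁ D₂₁)
  erw [reassoc_of% h₀]
  erw [reassoc_of% h₃]
  erw [h₄]
  erw [reassoc_of% h₅]
  erw [reassoc_of% h₆]
  erw [← h₇]
  rfl

/-- Sorting turns each side into `moveLL` followed by alternating cells on exchanges and on `T`s.
Once these are separated, `om_cocycle` and `Th_hexagon` compare them. -/
theorem al_pentagon {p : Hom1 (A₄ * A₃) A₄₃} {p' : Hom1 (A₄₃ * A₂) A₄₃₂} {q : Hom1 (A₃ * A₂) A₃₂}
    {q' : Hom1 (A₄ * A₃₂) A₄₃₂} {q'' : Hom1 (A₃₂ * A₁) A₃₂₁} {r : Hom1 (A₂ * A₁) A₂₁}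
    {r' : Hom1 (A₃ * A₂₁) A₃₂₁} {s : Hom1 (A₄₃ * A₂₁) A} {t : Hom1 (A₄₃₂ * A₁) A}
    {v : Hom1 (A₄ * A₃₂₁) A}
    {k : Hom1 (D₄ * D₃) D₄₃} {k' : Hom1 (D₄₃ * D₂) D₄₃₂} {l : Hom1 (D₃ * D₂) D₃₂}
    {l' : Hom1 (D₄ * D₃₂) D₄₃₂} {l'' : Hom1 (D₃₂ * D₁) D₃₂₁} {n : Hom1 (D₂ * D₁) D₂₁}
    {n' : Hom1 (D₃ * D₂₁) D₃₂₁} {s' : Hom1 (D₄₃ * D₂₁) D} {t' : Hom1 (D₄₃₂ * D₁) D}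
    {v' : Hom1 (D₄ * D₃₂₁) D}
    {a : lay 1 p A₂ ⨾ p' ⟶ lay A₄ q 1 ⨾ q'} {b : lay 1 q' A₁ ⨾ t ⟶ lay A₄ q'' 1 ⨾ v}
    {c : lay 1 q A₁ ⨾ q'' ⟶ lay A₃ r 1 ⨾ r'} {d : lay 1 p' A₁ ⨾ t ⟶ lay A₄₃ r 1 ⨾ s}
    {e : lay 1 p A₂₁ ⨾ s ⟶ lay A₄ r' 1 ⨾ v}
    {a' : lay 1 k D₂ ⨾ k' ⟶ lay D₄ l 1 ⨾ l'} {b' : lay 1 l' D₁ ⨾ t' ⟶ lay D₄ l'' 1 ⨾ v'}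
    {c' : lay 1 l D₁ ⨾ l'' ⟶ lay D₃ n 1 ⨾ n'} {d' : lay 1 k' D₁ ⨾ t' ⟶ lay D₄₃ n 1 ⨾ s'}
    {e' : lay 1 k D₂₁ ⨾ s' ⟶ lay D₄ n' 1 ⨾ v'}
    (h : wh (one _) (ten 1 a A₁) t ≫ wh (lay A₄ q A₁) b (one _) ≫ wh (one _) (ten A₄ c 1) v =
      wh (lay 1 p (A₂ * A₁)) d (one _) ≫ wh (one _) (sig p r).inv s ≫
        wh (lay (A₄ * A₃) r 1) e (one _))
    (h' : wh (one _) (ten 1 a' D₁) t' ≫ wh (lay D₄ l D₁) b' (one _) ≫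
        wh (one _) (ten D₄ c' 1) v' =
      wh (lay 1 k (D₂ * D₁)) d' (one _) ≫ wh (one _) (sig k n).inv s' ≫
        wh (lay (D₄ * D₃) n 1) e' (one _)) :
    wh (one _) (ten 1 (al a a') (A₁ * D₁)) (χ A₄₃₂ D₄₃₂ A₁ D₁ ⨾ (T t t' :)) ≫
        wh (lay (A₄ * D₄) (χ A₃ D₃ A₂ D₂ ⨾ (T q l :)) (A₁ * D₁)) (al b b') (one _) ≫
        wh (one _) (ten (A₄ * D₄) (al c c') 1) (χ A₄ D₄ A₃₂₁ D₃₂₁ ⨾ (T v v' :)) =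
      wh (lay 1 (χ A₄ D₄ A₃ D₃ ⨾ (T p k :)) (A₂ * (D₂ * (A₁ * D₁)))) (al d d') (one _) ≫
        wh (one _) (sig (χ A₄ D₄ A₃ D₃ ⨾ (T p k :)) (χ A₂ D₂ A₁ D₁ ⨾ (T r n :))).inv
          (χ A₄₃ D₄₃ A₂₁ D₂₁ ⨾ (T s s' :)) ≫
        wh (lay (A₄ * (D₄ * (A₃ * D₃))) (χ A₂ D₂ A₁ D₁ ⨾ (T r n :)) 1)
          (al (p := p) (p' := s) (q := r') (q' := v) (k := k) (k' := s') (l := n') (l' := v') e e')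
          (one _) := by
  have h₁ := congrArg (fun z => wh (one _) z (T t t' :)) (al_moveRL A₁ D₁ a a')
  have h₂ := al_moveLR b b' (q := q) (l := l)
  have h₃ := congrArg (fun z => wh (one _) z (T v v' :)) (al_moveRR A₄ D₄ c c')
  have h₄ := al_movePairL d d' (p := p) (k := k)
  have h₅ := congrArg (fun z => wh (one _) z (T s s' :)) (movePairL_movePairR p r k n)
  have h₆ := al_moveRR' (p := p) (s := s) (r' := r') (v := v) (k := k) (s' := s') (n' := n')
    (v' := v')
    (r := r) (n := n) e e'
  simp only [wh_comp, wh_wh] at h₁ h₃ h₅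
  -- The sorting of the final bracketing is appended to both sides; it is the only move whose
  -- invertibility is needed.
  refine (cancel_mono (whI (one _) (moveRR A₄ A₃ D₄ D₃ r r' n n') (T v v' :)).hom).1 ?_
  simp only [Category.assoc, whI_hom]
  erw [h₃, reassoc_of% h₂, reassoc_of% h₁, h₆, reassoc_of% h₅, reassoc_of% h₄]
  -- These six exchanges put the cells on exchanges before the `Th` cells: three for each side.
  have x₁ := xch (one _) (ten (A₄ * D₄) (om A₃ D₃ A₂ D₂ A₁ D₁).hom 1)
    (χ A₄ D₄ (A₃ * (A₂ * A₁)) (D₃ * (D₂ * D₁)) ⨾ (T (lay A₄ q A₁) (lay D₄ l D₁) :))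
    (Th (f := lay 1 q' A₁) (f' := t) (h := lay A₄ q'' 1) (h' := v) (g := lay 1 l' D₁) (g' := t')
      (k := lay D₄ l'' 1) (k' := v') b b') (one _)
  have x₂ := xch (lay (A₄ * D₄) (χ A₃ D₃ A₂ D₂) (A₁ * D₁))
    (om A₄ D₄ (A₃ * A₂) (D₃ * D₂) A₁ D₁).hom (one _)
    (Th (f := lay 1 p (A₂ * A₁)) (f' := lay 1 p' A₁) (h := lay A₄ q A₁)
      (h' := lay 1 q' A₁) (g := lay 1 k (D₂ * D₁)) (g' := lay 1 k' D₁)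
      (k := lay D₄ l D₁) (k' := lay 1 l' D₁) (ten 1 a A₁) (ten 1 a' D₁)) (T t t' :)
  have x₃ := xch (one _) (ten (A₄ * D₄) (om A₃ D₃ A₂ D₂ A₁ D₁).hom 1)
    (χ A₄ D₄ (A₃ * (A₂ * A₁)) (D₃ * (D₂ * D₁)))
    (Th (f := lay 1 p (A₂ * A₁)) (f' := lay 1 p' A₁) (h := lay A₄ q A₁)
      (h' := lay 1 q' A₁) (g := lay 1 k (D₂ * D₁)) (g' := lay 1 k' D₁)
      (k := lay D₄ l D₁) (k' := lay 1 l' D₁) (ten 1 a A₁) (ten 1 a' D₁)) (T t t' :)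
  have x₄ := xch (lay (A₄ * (D₄ * (A₃ * D₃))) (χ A₂ D₂ A₁ D₁) 1)
    (om A₄ D₄ A₃ D₃ (A₂ * A₁) (D₂ * D₁)).hom (one _)
    (Th (f := lay 1 p (A₂ * A₁)) (f' := lay A₄₃ r 1) (h := lay (A₄ * A₃) r 1)
      (h' := lay 1 p A₂₁) (g := lay 1 k (D₂ * D₁)) (g' := lay D₄₃ n 1)
      (k := lay (D₄ * D₃) n 1) (k' := lay 1 k D₂₁) (sig p r).inv (sig k n).inv) (T s s' :)
  have x₅ := xch (one _) (sig (χ A₄ D₄ A₃ D₃) (χ A₂ D₂ A₁ D₁)).inv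
    (χ (A₄ * A₃) (D₄ * D₃) (A₂ * A₁) (D₂ * D₁) ⨾ (T (lay 1 p (A₂ * A₁)) (lay 1 k (D₂ * D₁)) :))
    (Th (f := lay 1 p' A₁) (f' := t) (h := lay A₄₃ r 1) (h' := s)
      (g := lay 1 k' D₁) (g' := t') (k := lay D₄₃ n 1) (k' := s') d d') (one _)
  have x₆ := xch (lay (A₄ * (D₄ * (A₃ * D₃))) (χ A₂ D₂ A₁ D₁) 1)
    (om A₄ D₄ A₃ D₃ (A₂ * A₁) (D₂ * D₁)).hom ((T (lay 1 p (A₂ * A₁)) (lay 1 k (D₂ * D₁)) :))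
    (Th (f := lay 1 p' A₁) (f' := t) (h := lay A₄₃ r 1) (h' := s)
      (g := lay 1 k' D₁) (g' := t') (k := lay D₄₃ n 1) (k' := s') d d') (one _)
  have w := congrArg (fun z => wh (one _) z ((T (lay 1 p (A₂ * A₁)) (lay 1 k (D₂ * D₁)) :) ⨾
    (T (lay 1 p' A₁) (lay 1 k' D₁) :) ⨾ (T t t' :))) (om_cocycle A₄ D₄ A₃ D₃ A₂ D₂ A₁ D₁)
  have θ := congrArg (fun z => wh (lay (A₄ * (D₄ * (A₃ * D₃))) (χ A₂ D₂ A₁ D₁) 1 ⨾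
    lay (A₄ * D₄) (χ A₃ D₃ (A₂ * A₁) (D₂ * D₁)) 1 ⨾
    χ A₄ D₄ (A₃ * (A₂ * A₁)) (D₃ * (D₂ * D₁))) z (one _))
    (Th_hexagon (f₁ := lay 1 p (A₂ * A₁)) (f₂ := lay 1 p' A₁) (f₃ := t)
      (p₁ := lay A₄ q A₁) (p₂ := lay 1 q' A₁) (q₂ := lay A₄ q'' 1) (q₃ := v)
      (l₂ := lay A₄₃ r 1) (l₃ := s) (n₁ := lay (A₄ * A₃) r 1)
      (n₂ := lay 1 p A₂₁) (r₂ := lay A₄ r' 1)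
      (f₁' := lay 1 k (D₂ * D₁)) (f₂' := lay 1 k' D₁) (f₃' := t')
      (p₁' := lay D₄ l D₁) (p₂' := lay 1 l' D₁) (q₂' := lay D₄ l'' 1) (q₃' := v')
      (l₂' := lay D₄₃ n 1) (l₃' := s') (n₁' := lay (D₄ * D₃) n 1)
      (n₂' := lay 1 k D₂₁) (r₂' := lay D₄ n' 1)
      (a := ten 1 a A₁) (b := b) (c := ten A₄ c 1) (d := d) (s := (sig p r).inv)
      (e := e) (a' := ten 1 a' D₁) (b' := b') (c' := ten D₄ c' 1) (d' := d')
      (s' := (sig k n).inv) (e' := e') h h')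
  simp only [wh_comp, wh_wh] at w θ
  erw [← reassoc_of% x₁]
  erw [← reassoc_of% x₂]
  erw [← reassoc_of% x₃]
  erw [← reassoc_of% x₄]
  erw [← reassoc_of% x₅]
  erw [← reassoc_of% x₆]
  erw [reassoc_of% w, θ]
  rfl

/-! ### Crossings and comparisons at unit objects. -/

theorem Th_triangle {A A₁ A' D D₁ D' : Ob V} {f : Hom1 A A₁} {g g' : Hom1 A₁ A} {m : Hom1 A A'}
    {k : Hom1 D D₁} {l l' : Hom1 D₁ D} {n : Hom1 D D'}
    {η : g ⨾ m ⟶ g' ⨾ m} {lam : f ⨾ g' ⟶ one A} {rho : f ⨾ g ⟶ one A}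
    {θ : l ⨾ n ⟶ l' ⨾ n} {lam' : k ⨾ l' ⟶ one D} {rho' : k ⨾ l ⟶ one D}
    (h : wh f η (one _) ≫ wh (one _) lam m = wh (one _) rho m)
    (h' : wh k θ (one _) ≫ wh (one _) lam' n = wh (one _) rho' n) :
    wh (T f k :) (Th η θ) (one _) ≫ wh (one _) (tc f g' k l').hom (T m n :) ≫
        wh (one _) (T₂ lam lam') (T m n :) =
      wh (one _) (tc f g k l).hom (T m n :) ≫ wh (one _) (T₂ rho rho') (T m n :) := by
  have h₁ := wh_inv_hom (one _) (tc f g' k l') (T m n :)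
  have h₂ := tc_nat_left lam lam' m n
  have h₃ := tc_nat_left rho rho' m n
  -- The unitors end at identities, where `tc` is the identity, so naturality of `tc` absorbs the
  -- following `T m n` into `T₂`.
  have k₂ : wh (one _) (T₂ lam lam') (T m n :) =
      (tc (f ⨾ g') m (k ⨾ l') n).hom ≫ T₂ (wh (one _) lam m) (wh (one _) lam' n) := by
    rw [← h₂]; erw [tc_one_left, Category.comp_id]
  have k₃ : wh (one _) (T₂ rho rho') (T m n :) =
      (tc (f ⨾ g) m (k ⨾ l) n).hom ≫ T₂ (wh (one _) rho m) (wh (one _) rho' n) := by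
    rw [← h₃]; erw [tc_one_left, Category.comp_id]
  rw [Th_whisker_left, k₂, k₃, ← h, ← h', T₂_comp]
  simp only [tc₃, Iso.trans_hom, Iso.trans_inv, whI_hom, whI_inv, Category.assoc]
  erw [reassoc_of% h₁, Iso.inv_hom_id_assoc]
  rfl

/-- A composite contracted to an identity may be contracted before or after crossing the exchange,
because the crossing of identities is trivial. -/
theorem chl_unitor {A A' D D' : Ob V} {f : Hom1 A A'} {f' : Hom1 A' A} {g : Hom1 D D'}
    {g' : Hom1 D' D} (η : f ⨾ f' ⟶ one A) (θ : g ⨾ g' ⟶ one D) (B C : Ob V) {X Y : Ob V}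
    (x : Hom1 X (A * (D * (B * C)))) (y : Hom1 (A * (B * (D * C))) Y) :
    wh x (ten 1 (tc f f' g g').hom (B * C)) (χ A D B C ⨾ y) ≫
        wh x (ten 1 (T₂ η θ) (B * C)) (χ A D B C ⨾ y) =
      wh (x ⨾ lay 1 (T f g :) (B * C)) (chl f' g' B C).hom y ≫
        wh x (chl f g B C).hom ((T (lay 1 f' B) (lay 1 g' C) :) ⨾ y) ≫
        wh (x ⨾ χ A D B C) (tc (lay 1 f B) (lay 1 f' B) (lay 1 g C) (lay 1 g' C)).hom y ≫
        wh (x ⨾ χ A D B C) (T₂ (f := lay 1 f B ⨾ lay 1 f' B) (f' := one (A * B))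
          (g := lay 1 g C ⨾ lay 1 g' C) (g' := one (D * C)) (ten 1 η B) (ten 1 θ C)) y := by
  have h₁ := chl_comp f f' g g' B C
  have h₂ := chl_nat η θ B C
  -- A trivial crossing is inserted so that `chl_nat` applies.
  have h₃ : wh (one _) (ten 1 (T₂ η θ) (B * C)) (χ A D B C) =
      wh (one _) (ten 1 (T₂ η θ) (B * C)) (χ A D B C) ≫ (chl (one A) (one D) B C).hom := by
    rw [chl_one]; exact (Category.comp_id _).symm
  have h₄ : wh x (ten 1 (T₂ η θ) (B * C)) (χ A D B C ⨾ y) = _ :=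
    (wh_wh x (one _) (ten 1 (T₂ η θ) (B * C)) (χ A D B C) y).symm.trans
      ((congrArg (fun z => wh x z y)
      (h₃.trans h₂)).trans ((wh_comp x _ _ y).trans (congrArg (fun z => _ ≫ z)
        (wh_wh x (χ A D B C) _ (one _) y))))
  replace h₁ := congrArg (fun z => wh x z y) h₁
  simp only [wh_comp, wh_wh] at h₁
  rw [h₄]
  erw [reassoc_of% h₁]
  rfl

theorem chr_unitor {B B' C C' : Ob V} (A D : Ob V) {f : Hom1 B B'} {f' : Hom1 B' B} {g : Hom1 C C'}
    {g' : Hom1 C' C} (η : f ⨾ f' ⟶ one B) (θ : g ⨾ g' ⟶ one C) {X Y : Ob V}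
    (x : Hom1 X (A * (D * (B * C)))) (y : Hom1 (A * (B * (D * C))) Y) :
    wh x (ten (A * D) (tc f f' g g').hom 1) (χ A D B C ⨾ y) ≫
        wh x (ten (A * D) (T₂ η θ) 1) (χ A D B C ⨾ y) =
      wh (x ⨾ lay (A * D) (T f g :) 1) (chr A D f' g').hom y ≫
        wh x (chr A D f g).hom ((T (lay A f' 1) (lay D g' 1) :) ⨾ y) ≫
        wh (x ⨾ χ A D B C) (tc (lay A f 1) (lay A f' 1) (lay D g 1) (lay D g' 1)).hom y ≫
        wh (x ⨾ χ A D B C) (T₂ (f := lay A f 1 ⨾ lay A f' 1) (f' := one (A * B))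
          (g := lay D g 1 ⨾ lay D g' 1) (g' := one (D * C)) (ten A η 1) (ten D θ 1)) y := by
  have h₁ := chr_comp A D f f' g g'
  have h₂ := chr_nat A D η θ
  have h₃ : wh (one _) (ten (A * D) (T₂ η θ) 1) (χ A D B C) =
      wh (one _) (ten (A * D) (T₂ η θ) 1) (χ A D B C) ≫ (chr A D (one B) (one C)).hom := by
    rw [chr_one]; exact (Category.comp_id _).symm
  have h₄ : wh x (ten (A * D) (T₂ η θ) 1) (χ A D B C ⨾ y) = _ :=
    (wh_wh x (one _) (ten (A * D) (T₂ η θ) 1) (χ A D B C) y).symm.trans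
      ((congrArg (fun z => wh x z y)
      (h₃.trans h₂)).trans ((wh_comp x _ _ y).trans (congrArg (fun z => _ ≫ z)
        (wh_wh x (χ A D B C) _ (one _) y))))
  replace h₁ := congrArg (fun z => wh x z y) h₁
  simp only [wh_comp, wh_wh] at h₁
  rw [h₄]
  erw [reassoc_of% h₁]
  rfl

/-- The identity 2-cells between equal, but not syntactically identical, 1-cells. -/
def IsCast {P Q : Ob V} {f g : Hom1 P Q} (η : f ⟶ g) : Prop := ∃ h : f = g, η = eqToHom h

namespace IsCast

variable {P Q S U : Ob V} {f g h : Hom1 P Q}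

theorem comp {η : f ⟶ g} {θ : g ⟶ h} (hη : IsCast η) (hθ : IsCast θ) : IsCast (η ≫ θ) := by
  obtain ⟨rfl, rfl⟩ := hη; obtain ⟨rfl, rfl⟩ := hθ
  exact ⟨rfl, Category.id_comp _⟩

theorem wh (a : Hom1 S P) {η : f ⟶ g} (hη : IsCast η) (b : Hom1 Q U) : IsCast (wh a η b) := by
  obtain ⟨rfl, rfl⟩ := hη
  exact ⟨rfl, wh_id _ _ _⟩

theorem ten (R : Ob V) {η : f ⟶ g} (hη : IsCast η) (S : Ob V) : IsCast (ten R η S) := by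
  obtain ⟨rfl, rfl⟩ := hη
  exact ⟨rfl, ten_id _ _ _⟩

theorem inv {η : f ≅ g} (hη : IsCast η.hom) : IsCast η.inv := by
  obtain ⟨rfl, h⟩ := hη
  have e : η = Iso.refl f := Iso.ext h
  exact ⟨rfl, by rw [e]; rfl⟩

theorem eqToHom (h : f = g) : IsCast (eqToHom h) := ⟨h, rfl⟩

theorem sig {f : Hom1 P P} (h : f = one P) (g : Hom1 Q S) : IsCast (sig f g).hom := by
  subst h
  exact ⟨rfl, sig_one_left _ _⟩

theorem of_rep (h : f = g) {η : f ⟶ g} {A B A' B' : V} {p q : A ⟶ B} {x : p ⟶ q} {p' : A' ⟶ B'}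
    (hη : Rep2 x η) (hp : Rep1 p' f) (hx : x ≍ 𝟙 p') : IsCast η := by
  subst h
  exact ⟨rfl, eq_of_rep hη (Rep2.id hp) hx⟩

end IsCast

section

variable [SemistrictBraided V]

open SemistrictBraided

theorem eq_of_rep₁ {P Q : Ob V} {F G : Hom1 P Q} {A B : V} {p : A ⟶ B} (hF : Rep1 p F)
    (hG : Rep1 p G) : F = G := by
  have h : F.eval = G.eval := eq_of_heq (hF.heq.symm.trans hG.heq)
  refine Hom1.ext ?_
  funext R S Z k
  rw [F.fn_eq', G.fn_eq', h]

theorem bc_one_right (P : Ob V) : bc P 1 = one P := by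
  have h : Rep1 (β P.obj 𝕀) (bc P 1) := .bc P 1 rfl rfl
  rw [β_unit] at h
  exact eq_of_rep₁ h (Rep1.cst P _ (by rw [tensor_unit]))

theorem bc_one_left (P : Ob V) : bc 1 P = one P := by
  have h : Rep1 (β 𝕀 P.obj) (bc 1 P) := .bc 1 P rfl rfl
  rw [unit_β] at h
  exact eq_of_rep₁ h (Rep1.cst P _ (by rw [unit_tensor]))

/-- Semi-strictness makes `bc P 1` equal to the identity, though not by definition, so `R` with unit
in the middle is an identity 2-cell only up to equality of 1-cells. -/
theorem isCast_Rm (P Q : Ob V) : IsCast (Rm P 1 Q).hom :=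
  .of_rep (by rw [bc_one_right]; rfl) (.R P 1 Q rfl rfl rfl) (.bc P Q rfl rfl) (R_unit₂ _ _)

theorem isCast_Sm (P Q : Ob V) : IsCast (Sm P 1 Q).hom :=
  .of_rep (by rw [bc_one_left]; rfl) (.S P 1 Q rfl rfl rfl) (.bc P Q rfl rfl) (S_unit₂ _ _)

/-- With units in the two middle places all three factors are trivial: `S`, the interchanger with
`bc D 1`, and `R⁻¹`. -/
theorem isCast_Om (D A : Ob V) : IsCast (Om D 1 1 A).hom :=
  (((isCast_Sm D A).ten 1 1).wh (lay 1 (bc D 1) A) (one _)).comp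
    ((((IsCast.sig (bc_one_right D) (bc 1 A)).inv).wh (one _) (lay 1 (bc D A) 1)).comp
      (((isCast_Rm D A).inv.ten 1 1).wh (lay D (bc 1 A) 1) (one _)))

theorem isCast_om (A₂ D₂ A₁ D₁ : Ob V) : IsCast (om A₂ D₂ 1 1 A₁ D₁).hom :=
  (isCast_Om D₂ A₁).ten A₂ D₁

/-- Exchanging with a unit object is the identity. -/
theorem χ_one_left (A D : Ob V) : χ 1 1 A D = one (A * D) :=
  congrArg (fun z => lay 1 z D) (bc_one_left A)

theorem χ_one_right (A D : Ob V) : χ A D 1 1 = one (A * D) :=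
  congrArg (fun z => lay A z 1) (bc_one_right D)

end

end

end Hom1

end

/-! ### Unitors of a tensor product and identity coherence. -/

section

variable {V : Type u} [Bicategory.{w, v} V] [Bicategory.Strict V] [GrayMonoid V]
  [BraidedGrayMonoid V] [SemistrictBraided V]

namespace Hom1

section

variable {A₄ A₃ A₂ A₁ A₄₃ A₃₂ A₂₁ A₄₃₂ A₃₂₁ A D₄ D₃ D₂ D₁ D₄₃ D₃₂ D₂₁ D₄₃₂ D₃₂₁ D : Ob V}

/-- The left unitor of a tensor product. -/
def lu {u : Hom1 1 D₃} {q : Hom1 (D₃ * A₁) A₁} {z : Hom1 1 D₄} {l : Hom1 (D₄ * D₁) D₁}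
    (η : lay 1 u A₁ ⨾ q ⟶ one A₁) (θ : lay 1 z D₁ ⨾ l ⟶ one D₁) :
    lay 1 (T u z :) (A₁ * D₁) ⨾ χ D₃ D₄ A₁ D₁ ⨾ (T q l :) ⟶ one (A₁ * D₁) :=
  wh (one _) (chl u z A₁ D₁).hom (T q l :) ≫
    wh (χ 1 1 A₁ D₁) (tc (lay 1 u A₁) q (lay 1 z D₁) l).hom (one _) ≫
    wh (χ 1 1 A₁ D₁) (T₂ (f' := one A₁) (g' := one D₁) η θ) (one _) ≫ eqToHom (χ_one_left A₁ D₁)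

/-- The right unitor of a tensor product. -/
def ru {u : Hom1 1 D₃} {p : Hom1 (A₁ * D₃) A₁} {z : Hom1 1 D₄} {k : Hom1 (D₁ * D₄) D₁}
    (η : lay A₁ u 1 ⨾ p ⟶ one A₁) (θ : lay D₁ z 1 ⨾ k ⟶ one D₁) :
    lay (A₁ * D₁) (T u z :) 1 ⨾ χ A₁ D₁ D₃ D₄ ⨾ (T p k :) ⟶ one (A₁ * D₁) :=
  wh (one _) (chr A₁ D₁ u z).hom (T p k :) ≫
    wh (χ A₁ D₁ 1 1) (tc (lay A₁ u 1) p (lay D₁ z 1) k).hom (one _) ≫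
    wh (χ A₁ D₁ 1 1) (T₂ (f' := one A₁) (g' := one D₁) η θ) (one _) ≫ eqToHom (χ_one_right A₁ D₁)

/-- By `om_nat₂` the comparison moves past the units, after which its middle pair is the unit object
and it is trivial. The crossings of the associator match those of the unitors, and what is left on
the `T`s is `Th_triangle`. -/
theorem al_triangle {U W : Ob V} {u : Hom1 1 U} {p : Hom1 (A₂ * U) A₂} {q : Hom1 (U * A₁) A₁}
    {m : Hom1 (A₂ * A₁) A} {z : Hom1 1 W} {k : Hom1 (D₂ * W) D₂} {l : Hom1 (W * D₁) D₁}
    {n : Hom1 (D₂ * D₁) D}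
    {a : lay 1 p A₁ ⨾ m ⟶ lay A₂ q 1 ⨾ m} {b : lay 1 u A₁ ⨾ q ⟶ one A₁}
    {c : lay A₂ u 1 ⨾ p ⟶ one A₂}
    {a' : lay 1 k D₁ ⨾ n ⟶ lay D₂ l 1 ⨾ n} {b' : lay 1 z D₁ ⨾ l ⟶ one D₁}
    {c' : lay D₂ z 1 ⨾ k ⟶ one D₂}
    (h : wh (lay A₂ u A₁) a (one _) ≫ wh (one _) (ten A₂ b 1) m = wh (one _) (ten 1 c A₁) m)
    (h' : wh (lay D₂ z D₁) a' (one _) ≫ wh (one _) (ten D₂ b' 1) n = wh (one _) (ten 1 c' D₁) n) :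
    wh (lay (A₂ * D₂) (T u z :) (A₁ * D₁)) (al a a') (one _) ≫
        wh (one _) (ten (A₂ * D₂) (lu (u := u) (q := q) (z := z) (l := l) b b') 1)
          (χ A₂ D₂ A₁ D₁ ⨾ (T m n :)) =
      wh (one _) (ten 1 (ru (u := u) (p := p) (z := z) (k := k) c c') (A₁ * D₁))
        (χ A₂ D₂ A₁ D₁ ⨾ (T m n :)) := by
  simp only [al, lu, ru, wh_comp, wh_wh, ten_comp, ten_wh, Category.assoc]
  have h₁ := xch (one _) (ten (A₂ * D₂) (chl u z A₁ D₁).hom 1) (one _) (chr A₂ D₂ q l).inv (T m n :)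
  have h₂ := chr_unitor (B := A₁) (C := D₁) A₂ D₂ (f := lay 1 u A₁) (f' := q) (g := lay 1 z D₁)
    (g' := l) b b' (lay (A₂ * D₂) (χ 1 1 A₁ D₁) 1) (T m n :)
  have h₃ := chl_unitor (A := A₂) (D := D₂) (f := lay A₂ u 1) (f' := p) (g := lay D₂ z 1) (g' := k)
    c c' A₁ D₁ (lay 1 (χ A₂ D₂ 1 1) (A₁ * D₁)) (T m n :)
  have h₄ := wh_inv_hom
    (lay (A₂ * D₂) (χ 1 1 A₁ D₁) 1 ⨾ lay (A₂ * D₂) (T (lay 1 u A₁) (lay 1 z D₁) :) 1)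
    (chr A₂ D₂ q l) (T m n :)
  have x₁ := xch (lay (A₂ * D₂) (T u z :) (A₁ * D₁)) (om A₂ D₂ U W A₁ D₁).hom (one _)
    (Th (f := lay 1 p A₁) (f' := m) (h := lay A₂ q 1) (h' := m) (g := lay 1 k D₁) (g' := n)
      (k := lay D₂ l 1) (k' := n) a a') (one _)
  have x₂ := xch (one _) (ten (A₂ * D₂) (chl u z A₁ D₁).hom 1) (χ A₂ D₂ (U * A₁) (W * D₁))
    (Th (f := lay 1 p A₁) (f' := m) (h := lay A₂ q 1) (h' := m) (g := lay 1 k D₁) (g' := n)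
      (k := lay D₂ l 1) (k' := n) a a') (one _)
  have x₃ := xch (lay (A₂ * D₂) (χ 1 1 A₁ D₁) 1) (chr A₂ D₂ (lay 1 u A₁) (lay 1 z D₁)).hom (one _)
    (Th (f := lay 1 p A₁) (f' := m) (h := lay A₂ q 1) (h' := m) (g := lay 1 k D₁) (g' := n)
      (k := lay D₂ l 1) (k' := n) a a') (one _)
  have h₅ := congrArg (fun t => wh (one _) t ((T (lay 1 p A₁) (lay 1 k D₁) :) ⨾ (T m n :)))
    (om_nat₂ A₂ D₂ u z A₁ D₁)
  have x₄ := xch (one _) (ten 1 (chr A₂ D₂ u z).hom (A₁ * D₁)) (one _) (chl p k A₁ D₁).hom (T m n :)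
  have h₆ := Th_triangle (f := lay A₂ u A₁) (g := lay 1 p A₁) (g' := lay A₂ q 1)
    (k := lay D₂ z D₁) (l := lay 1 k D₁) (l' := lay D₂ l 1) h h'
  have h₇ := congrArg (fun t => wh (lay (A₂ * D₂) (χ 1 1 A₁ D₁) 1 ⨾ χ A₂ D₂ A₁ D₁) t (one _)) h₆
  have x₅ := xch (one _) (om A₂ D₂ 1 1 A₁ D₁).hom (one _)
    (tc (lay A₂ u A₁) (lay 1 p A₁) (lay D₂ z D₁) (lay 1 k D₁)).hom (T m n :)
  have x₆ := xch (one _) (om A₂ D₂ 1 1 A₁ D₁).hom (one _)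
    (T₂ (f' := one (A₂ * A₁)) (g' := one (D₂ * D₁)) (ten 1 c A₁) (ten 1 c' D₁)) (T m n :)
  -- All cells here are `eqToHom`s, so the two sides agree as soon as their endpoints do.
  have h₈ : wh (one _) (om A₂ D₂ 1 1 A₁ D₁).hom (T m n :) ≫
        wh (one _) (ten (A₂ * D₂) (eqToHom (χ_one_left A₁ D₁)) 1) (χ A₂ D₂ A₁ D₁ ⨾ (T m n :)) =
      wh (one _) (ten 1 (eqToHom (χ_one_right A₂ D₂)) (A₁ * D₁)) (χ A₂ D₂ A₁ D₁ ⨾ (T m n :)) := by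
    have c₁ := (isCast_om A₂ D₂ A₁ D₁).wh (one _) (T m n :)
    have c₂ := ((IsCast.eqToHom (χ_one_left A₁ D₁)).ten (A₂ * D₂) 1).wh (one _)
      (χ A₂ D₂ A₁ D₁ ⨾ (T m n :))
    have c₃ := ((IsCast.eqToHom (χ_one_right A₂ D₂)).ten 1 (A₁ * D₁)).wh (one _)
      (χ A₂ D₂ A₁ D₁ ⨾ (T m n :))
    obtain ⟨e₁, c₁⟩ := c₁
    obtain ⟨e₂, c₂⟩ := c₂
    obtain ⟨e₃, c₃⟩ := c₃
    rw [c₁, c₂, c₃]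
    exact eqToHom_trans _ _
  simp only [wh_comp, wh_wh] at h₅ h₇
  erw [← reassoc_of% h₁]
  erw [reassoc_of% h₂]
  erw [Category.assoc, Category.assoc, Category.assoc]
  erw [reassoc_of% h₄]
  erw [← reassoc_of% x₁]
  erw [← reassoc_of% x₂]
  erw [← reassoc_of% x₃]
  erw [← reassoc_of% h₅]
  erw [← reassoc_of% x₄]
  erw [reassoc_of% h₃]
  erw [Category.assoc, Category.assoc, Category.assoc]
  erw [reassoc_of% h₇]
  erw [reassoc_of% x₅]
  erw [reassoc_of% x₆]
  erw [h₈]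
  rfl

end

end Hom1

end

/-! ### Tensor product cells in `V` and their counterparts in the model. -/

section

variable {V : Type u} [Bicategory.{w, v} V] [Bicategory.Strict V] [GrayMonoid V]
  [BraidedGrayMonoid V]

namespace Rep2

section

variable {W X Y Z : V} {P Q S U : Ob V}

theorem whI {p : W ⟶ X} {f g : X ⟶ Y} {q : Y ⟶ Z} {x : f ≅ g} {a : Hom1 P Q} {F G : Hom1 Q S}
    {b : Hom1 S U} {y : F ⟶ G} (hp : Rep1 p a) (hx : Rep2 x.hom y) (hq : Rep1 q b) :
    Rep2 (whiskerIso p x q).hom (Hom1.wh a y b) := wh hp hx hq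

theorem vI {p q q' r : X ⟶ Y} {F G H : Hom1 P Q} {x : p ≅ q} {x' : q' ≅ r} {y : F ⟶ G}
    {y' : G ⟶ H} {e : q = q'} (h : Rep2 x.hom y) (h' : Rep2 x'.hom y') :
    Rep2 (vcompIso x x' e).hom (y ≫ y') := vcomp (e := e) h h'

theorem transI {p q r : X ⟶ Y} {F G H : Hom1 P Q} {x : p ≅ q} {x' : q ≅ r} {y : F ⟶ G}
    {y' : G ⟶ H} (h : Rep2 x.hom y) (h' : Rep2 x'.hom y') : Rep2 (x ≪≫ x').hom (y ≫ y') :=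
  comp h h'

theorem symmI {p q : X ⟶ Y} {F G : Hom1 P Q} {x : p ≅ q} {y : F ≅ G} (h : Rep2 x.hom y.hom) :
    Rep2 x.symm.hom y.inv := inv h

theorem comp_eqToHom {p q : X ⟶ Y} {F G H : Hom1 P Q} {x : p ⟶ q} {y : F ⟶ G} (h : Rep2 x y)
    (e : G = H) : Rep2 x (y ≫ eqToHom e) := by
  subst e; simpa using h

end

end Rep2

section

variable {A A' A'' B B' C C' D D' D'' : V} {P P' P'' Q Q' R R' S S' S'' : Ob V}

theorem Rep1.T {p : A ⟶ A'} {q : D ⟶ D'} {F : Hom1 P P'} {G : Hom1 S S'} (hp : Rep1 p F)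
    (hq : Rep1 q G) : Rep1 (p ⊗₁ q) (Hom1.T F G) :=
  (hp.right _ hq.src).comp (hq.left _ hp.tgt)

theorem Rep1.mid (hA : A = P.obj) (hD : D = S.obj) (hB : B = Q.obj) (hC : C = R.obj) :
    Rep1 (mid A D B C) (χ P S Q R) :=
  .cst_comp _ (.comp_cst _ (.left P hA (.right R hC (.bc S Q hD hB))))

theorem Rep2.tc {p : A ⟶ A'} {p' : A' ⟶ A''} {q : D ⟶ D'} {q' : D' ⟶ D''} {F : Hom1 P P'}
    {F' : Hom1 P' P''} {G : Hom1 S S'} {G' : Hom1 S' S''} (hp : Rep1 p F) (hp' : Rep1 p' F')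
    (hq : Rep1 q G) (hq' : Rep1 q' G') :
    Rep2 (tensorHomComp p p' q q').hom (Hom1.tc F F' G G').hom :=
  .cast (.whI (hp.right _ hq.src) (.sig hp' hq) (hq'.left _ hp'.tgt))

theorem Rep2.T₂ {p p' : A ⟶ A'} {q q' : D ⟶ D'} {F F' : Hom1 P P'} {G G' : Hom1 S S'}
    {x : p ≅ p'} {x' : q ≅ q'} {y : F ⟶ F'} {y' : G ⟶ G'} (h : Rep2 x.hom y)
    (h' : Rep2 x'.hom y') : Rep2 (tensorIso x x').hom (Hom1.T₂ y y') :=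
  .comp (.whiskerRight (h.right _ h'.dom.src) (h'.dom.left _ h.dom.tgt))
    (.whiskerLeft (h.cod.right _ h'.dom.src) (h'.left _ h.dom.tgt))

theorem Rep2.chl {p : A ⟶ A'} {q : D ⟶ D'} {F : Hom1 P P'} {G : Hom1 S S'} (hp : Rep1 p F)
    (hq : Rep1 q G) (hB : B = Q.obj) (hC : C = R.obj) :
    Rep2 (midLeft p q B C).hom (Hom1.chl F G Q R).hom := by
  have hBC := Ob.tensor_eq hB hC
  refine .cast (.vI (.whI (.comp_cst _ (.right (Q * R) hBC (.right S hq.src hp)))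
      (.tensor P' R hp.tgt hC (.bl Q hq hB))
      (.cst (P' * (Q * (S' * R))) _ ?_))
    (.whI (.cst (P * (S * (Q * R))) _ ?_)
      (.symmI (.sig hp (.right R hC (.bc S Q hq.src hB))))
      (.comp_cst _ (.left P' hp.tgt (.right R hC (.left Q hB hq))))))
  · simp only [hp.tgt, hq.tgt, hB, hC, Ob.obj_mul, tensor_assoc]
  · simp only [hp.src, hq.src, hB, hC, Ob.obj_mul, tensor_assoc]

theorem Rep2.chr {p : B ⟶ B'} {q : C ⟶ C'} {F : Hom1 Q Q'} {G : Hom1 R R'} (hA : A = P.obj)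
    (hD : D = S.obj) (hp : Rep1 p F) (hq : Rep1 q G) :
    Rep2 (midRight A D p q).hom (Hom1.chr P S F G).hom := by
  have e : (A ⊗ᵍ B' ⊗ᵍ D) ⊗ᵍ C' = (P * (Q' * (S * R'))).obj := by
    simp only [hp.tgt, hq.tgt, hA, hD, Ob.obj_mul, tensor_assoc]
  refine .cast (.vI (.whI (.cst_comp _ (.left P hA (.right R hq.src (.left S hD hp))))
      (.left P hA (.sig (.bc S Q' hD hp.tgt) hq))
      (.cst (P * (Q' * (S * R'))) _ ?_))
    (.whI (.cst (P * (S * (Q * R))) _ ?_)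
      (.tensor P R hA hq.src (.br S hD hp))
      (.comp_cst _ (.left P hA (.left (Q' * S) (Ob.tensor_eq hp.tgt hD) hq)))))
  · simp only [hp.tgt, hq.tgt, hA, hD, Ob.obj_mul, tensor_assoc]
  · simp only [hp.src, hq.src, hA, hD, Ob.obj_mul, tensor_assoc]

end

section

variable {A₃ A₂ A₁ D₃ D₂ D₁ : V} {P₃ P₂ P₁ S₃ S₂ S₁ : Ob V}

theorem Rep2.om (hA₃ : A₃ = P₃.obj) (hD₃ : D₃ = S₃.obj) (hA₂ : A₂ = P₂.obj) (hD₂ : D₂ = S₂.obj)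
    (hA₁ : A₁ = P₁.obj) (hD₁ : D₁ = S₁.obj) :
    Rep2 (midAssoc A₃ D₃ A₂ D₂ A₁ D₁).hom (Hom1.om P₃ S₃ P₂ S₂ P₁ S₁).hom := by
  have hA₃₂ := Ob.tensor_eq hA₃ hA₂
  have hAD₁ := Ob.tensor_eq hA₁ hD₁
  have hAD₂₁ := Ob.tensor_eq hD₂ hD₁
  have hDA := Ob.tensor_eq hD₃ hA₂
  simp only [Hom1.om, Hom1.Om, tenI_hom, Iso.trans_hom, whI_hom, ten_comp, ten_wh, ten_ten,
    Iso.symm_hom]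
  refine .cast (.vI (.whI (.comp_cst _ (.right (P₁ * S₁) hAD₁ (.mid hA₃ hD₃ hA₂ hD₂)))
      (.tensor (P₃ * P₂) S₁ hA₃₂ hD₁ (.S S₃ S₂ P₁ hD₃ hD₂ hA₁))
      (.cst (P₃ * (P₂ * (P₁ * (S₃ * (S₂ * S₁))))) _ ?_))
    (.vI (.whI (.cst (P₃ * (S₃ * (P₂ * (S₂ * (P₁ * S₁))))) _ ?_)
        (.tensor P₃ S₁ hA₃ hD₁ (.symmI (.sig (.bc S₃ P₂ hD₃ hA₂) (.bc S₂ P₁ hD₂ hA₁))))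
        (.cst_comp _ (.comp_cst _ (.left (P₃ * P₂) hA₃₂
          (.right S₁ hD₁ (.right S₂ hD₂ (.bc S₃ P₁ hD₃ hA₁)))))))
      (.whI (.cst_comp _ (.comp_cst _ (.left P₃ hA₃
          (.right S₁ hD₁ (.left (S₃ * P₂) hDA (.bc S₂ P₁ hD₂ hA₁))))))
        (.tensor P₃ (S₂ * S₁) hA₃ hAD₂₁ (.symmI (.R S₃ P₂ P₁ hD₃ hA₂ hA₁)))
        (.cst (P₃ * (P₂ * (P₁ * (S₃ * (S₂ * S₁))))) _ ?_))))
  · simp only [hA₃, hD₃, hA₂, hD₂, hA₁, hD₁, Ob.obj_mul, tensor_assoc]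
  · simp only [hA₃, hD₃, hA₂, hD₂, hA₁, hD₁, Ob.obj_mul, tensor_assoc]
  · simp only [hA₃, hD₃, hA₂, hD₂, hA₁, hD₁, Ob.obj_mul, tensor_assoc]

end

namespace Hom1

/-- `assocTensor` splits the composites by the inverse `tc` only after the comparison of exchanges,
whereas `al` does so before it, inside `Th`. The two cells are disjoint. -/
theorem al_eq {P₃ P₂ P₁ P₃₂ P₂₁ P S₃ S₂ S₁ S₃₂ S₂₁ S : Ob V}
    {p : Hom1 (P₃ * P₂) P₃₂} {p' : Hom1 (P₃₂ * P₁) P} {q : Hom1 (P₂ * P₁) P₂₁}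
    {q' : Hom1 (P₃ * P₂₁) P} {k : Hom1 (S₃ * S₂) S₃₂} {k' : Hom1 (S₃₂ * S₁) S}
    {l : Hom1 (S₂ * S₁) S₂₁} {l' : Hom1 (S₃ * S₂₁) S}
    (η : lay 1 p P₁ ⨾ p' ⟶ lay P₃ q 1 ⨾ q') (θ : lay 1 k S₁ ⨾ k' ⟶ lay S₃ l 1 ⨾ l') :
    al η θ =
      wh (lay 1 (χ P₃ S₃ P₂ S₂) (P₁ * S₁)) (chl p k P₁ S₁).hom (T p' k' :) ≫
      wh (lay 1 (χ P₃ S₃ P₂ S₂) (P₁ * S₁) ⨾ χ (P₃ * P₂) (S₃ * S₂) P₁ S₁)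
        ((tc (lay 1 p P₁) p' (lay 1 k S₁) k').hom ≫ T₂ η θ) (one _) ≫
      wh (one _) (om P₃ S₃ P₂ S₂ P₁ S₁).hom (T (lay P₃ q 1 ⨾ q') (lay S₃ l 1 ⨾ l') :) ≫
      wh (lay (P₃ * S₃) (χ P₂ S₂ P₁ S₁) 1 ⨾ χ P₃ S₃ (P₂ * P₁) (S₂ * S₁))
        (tc (lay P₃ q 1) q' (lay S₃ l 1) l').inv (one _) ≫
      wh (lay (P₃ * S₃) (χ P₂ S₂ P₁ S₁) 1) (chr P₃ S₃ q l).inv (T q' l' :) := by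
  have h := xch (one _) (om P₃ S₃ P₂ S₂ P₁ S₁).hom (one _)
    (tc (lay P₃ q 1) q' (lay S₃ l 1) l').inv (one _)
  simp only [al, Th, wh_comp, Category.assoc]
  erw [← reassoc_of% h]
  rfl

section

variable [SemistrictBraided V] {A₁ D₁ D₃ D₄ : Ob V}

theorem lu_eq {u : Hom1 1 D₃} {q : Hom1 (D₃ * A₁) A₁} {z : Hom1 1 D₄} {l : Hom1 (D₄ * D₁) D₁}
    (η : lay 1 u A₁ ⨾ q ⟶ one A₁) (θ : lay 1 z D₁ ⨾ l ⟶ one D₁) :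
    lu (u := u) (q := q) (z := z) (l := l) η θ =
      (wh (one _) (chl u z A₁ D₁).hom (T q l :) ≫
        wh (χ 1 1 A₁ D₁) ((tc (lay 1 u A₁) q (lay 1 z D₁) l).hom ≫
          T₂ (f' := one A₁) (g' := one D₁) η θ) (one _)) ≫ eqToHom (χ_one_left A₁ D₁) := by
  rw [wh_comp]; erw [Category.assoc, Category.assoc]; rfl

theorem ru_eq {u : Hom1 1 D₃} {p : Hom1 (A₁ * D₃) A₁} {z : Hom1 1 D₄} {k : Hom1 (D₁ * D₄) D₁}
    (η : lay A₁ u 1 ⨾ p ⟶ one A₁) (θ : lay D₁ z 1 ⨾ k ⟶ one D₁) :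
    ru (u := u) (p := p) (z := z) (k := k) η θ =
      (wh (one _) (chr A₁ D₁ u z).hom (T p k :) ≫
        wh (χ A₁ D₁ 1 1) ((tc (lay A₁ u 1) p (lay D₁ z 1) k).hom ≫
          T₂ (f' := one A₁) (g' := one D₁) η θ) (one _)) ≫ eqToHom (χ_one_right A₁ D₁) := by
  rw [wh_comp]; erw [Category.assoc, Category.assoc]; rfl

end

end Hom1

section

variable {A₃ A₂ A₁ A₃₂ A₂₁ A D₃ D₂ D₁ D₃₂ D₂₁ D : V}
  {P₃ P₂ P₁ P₃₂ P₂₁ P S₃ S₂ S₁ S₃₂ S₂₁ S : Ob V}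

theorem Rep1.compTensor {m : A₂ ⊗ᵍ A₁ ⟶ A} {n : D₂ ⊗ᵍ D₁ ⟶ D} {M : Hom1 (P₂ * P₁) P}
    {N : Hom1 (S₂ * S₁) S} (hA₂ : A₂ = P₂.obj) (hA₁ : A₁ = P₁.obj) (hD₂ : D₂ = S₂.obj)
    (hD₁ : D₁ = S₁.obj) (hm : Rep1 m M) (hn : Rep1 n N) :
    Rep1 (compTensor m n) (χ P₂ S₂ P₁ S₁ ⨾ (Hom1.T M N :)) :=
  (Rep1.mid hA₂ hD₂ hA₁ hD₁).comp (hm.T hn)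

theorem Rep1.unitTensor {u : 𝕀 ⟶ A} {z : 𝕀 ⟶ D} {F : Hom1 1 P} {G : Hom1 1 S} (hu : Rep1 u F)
    (hz : Rep1 z G) : Rep1 (unitTensor u z) (Hom1.T F G) :=
  .cst_comp _ (hu.T hz)

theorem Rep2.assocTensor {m₃₂ : A₃ ⊗ᵍ A₂ ⟶ A₃₂} {m : A₃₂ ⊗ᵍ A₁ ⟶ A} {m₂₁ : A₂ ⊗ᵍ A₁ ⟶ A₂₁}
    {m' : A₃ ⊗ᵍ A₂₁ ⟶ A} {n₃₂ : D₃ ⊗ᵍ D₂ ⟶ D₃₂} {n : D₃₂ ⊗ᵍ D₁ ⟶ D} {n₂₁ : D₂ ⊗ᵍ D₁ ⟶ D₂₁}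
    {n' : D₃ ⊗ᵍ D₂₁ ⟶ D}
    {α : m₃₂ ▹ A₁ ≫ m ≅ cst ((A₃ ⊗ᵍ A₂) ⊗ᵍ A₁) (A₃ ⊗ᵍ A₂ ⊗ᵍ A₁) ≫ A₃ ◃ m₂₁ ≫ m'}
    {γ : n₃₂ ▹ D₁ ≫ n ≅ cst ((D₃ ⊗ᵍ D₂) ⊗ᵍ D₁) (D₃ ⊗ᵍ D₂ ⊗ᵍ D₁) ≫ D₃ ◃ n₂₁ ≫ n'}
    {p : Hom1 (P₃ * P₂) P₃₂} {p' : Hom1 (P₃₂ * P₁) P} {q : Hom1 (P₂ * P₁) P₂₁}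
    {q' : Hom1 (P₃ * P₂₁) P} {k : Hom1 (S₃ * S₂) S₃₂} {k' : Hom1 (S₃₂ * S₁) S}
    {l : Hom1 (S₂ * S₁) S₂₁} {l' : Hom1 (S₃ * S₂₁) S}
    {η : lay 1 p P₁ ⨾ p' ⟶ lay P₃ q 1 ⨾ q'} {θ : lay 1 k S₁ ⨾ k' ⟶ lay S₃ l 1 ⨾ l'}
    (hA₃ : A₃ = P₃.obj) (hA₂ : A₂ = P₂.obj) (hA₁ : A₁ = P₁.obj) (hD₃ : D₃ = S₃.obj)
    (hD₂ : D₂ = S₂.obj) (hD₁ : D₁ = S₁.obj) (hp : Rep1 m₃₂ p) (hp' : Rep1 m p')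
    (hq : Rep1 m₂₁ q) (hq' : Rep1 m' q') (hk : Rep1 n₃₂ k) (hk' : Rep1 n k') (hl : Rep1 n₂₁ l)
    (hl' : Rep1 n' l') (hα : Rep2 α.hom η) (hγ : Rep2 γ.hom θ) :
    Rep2 (assocTensor α γ).hom (al η θ) := by
  have hAD₁ := Ob.tensor_eq hA₁ hD₁
  have hAD₃ := Ob.tensor_eq hA₃ hD₃
  have hp₁ := hp.right P₁ hA₁
  have hk₁ := hk.right S₁ hD₁
  have hq₃ := hq.left P₃ hA₃
  have hl₃ := hl.left S₃ hD₃
  have h₀ := (Rep1.mid hA₃ hD₃ hA₂ hD₂).right (P₁ * S₁) hAD₁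
  have h₁ := (Rep1.mid hA₂ hD₂ hA₁ hD₁).left (P₃ * S₃) hAD₃
  have e : ((A₃ ⊗ᵍ D₃) ⊗ᵍ (A₂ ⊗ᵍ D₂)) ⊗ᵍ (A₁ ⊗ᵍ D₁) =
      (P₃ * (S₃ * (P₂ * (S₂ * (P₁ * S₁))))).obj := by
    simp only [hA₃, hD₃, hA₂, hD₂, hA₁, hD₁, Ob.obj_mul, tensor_assoc]
  rw [al_eq]
  exact .cast (.vI (.whI h₀ (.chl hp hk hA₁ hD₁) (hp'.T hk'))
    (.vI (.whI (h₀.comp (.mid (Ob.tensor_eq hA₃ hA₂) (Ob.tensor_eq hD₃ hD₂) hA₁ hD₁))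
        (.transI (.tc hp₁ hp' hk₁ hk') (.T₂ hα hγ)) (.id _ (hp'.T hk').tgt))
    (.vI (.whI (.id _ e) (.om hA₃ hD₃ hA₂ hD₂ hA₁ hD₁)
        (.T (.cst_comp _ (hq₃.comp hq')) (.cst_comp _ (hl₃.comp hl'))))
    (.vI (.whI (.cst_comp _ (h₁.comp (.mid hA₃ hD₃ (Ob.tensor_eq hA₂ hA₁)
          (Ob.tensor_eq hD₂ hD₁))))
        (.symmI (.tc hq₃ hq' hl₃ hl')) (.id _ (hp'.T hk').tgt))
    (.whI (.cst_comp _ h₁) (.symmI (.chr hA₃ hD₃ hq hl)) (hq'.T hl'))))))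

end

section

variable [SemistrictBraided V] {A A' D D' : V} {P P' S S' : Ob V}

theorem Rep2.leftUnitorTensor {u : 𝕀 ⟶ A'} {m : A' ⊗ᵍ A ⟶ A} {z : 𝕀 ⟶ D'} {n : D' ⊗ᵍ D ⟶ D}
    {x : u ▹ A ≫ m ≅ cst (𝕀 ⊗ᵍ A) A} {x' : z ▹ D ≫ n ≅ cst (𝕀 ⊗ᵍ D) D}
    {F : Hom1 1 P'} {p : Hom1 (P' * P) P} {G : Hom1 1 S'} {k : Hom1 (S' * S) S}
    {η : lay 1 F P ⨾ p ⟶ one P} {θ : lay 1 G S ⨾ k ⟶ one S} (hA : A = P.obj) (hD : D = S.obj)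
    (hF : Rep1 u F) (hp : Rep1 m p) (hG : Rep1 z G) (hk : Rep1 n k) (h : Rep2 x.hom η)
    (h' : Rep2 x'.hom θ) :
    Rep2 (leftUnitorTensor x x').hom (lu (u := F) (q := p) (z := G) (l := k) η θ) := by
  have e : 𝕀 ⊗ᵍ A ⊗ᵍ D = (1 * (P * S)).obj := by
    simp only [hA, hD, unit_tensor]; exact (Ob.obj_mul _ _).symm
  have e' := Ob.tensor_eq hA hD
  rw [lu_eq]
  refine .cast (.comp_eqToHom (.vI ?_ ?_) _)
  · exact .whI (.cst (P * S) _ e) (.chl hF hG hA hD) (hp.T hk)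
  · exact .whI (.cst_comp _ (.mid rfl rfl hA hD))
      (.transI (.tc (hF.right P hA) hp (hG.right S hD) hk) (.T₂ h h')) (.id (P * S) e')

theorem Rep2.rightUnitorTensor {u : 𝕀 ⟶ A'} {m : A ⊗ᵍ A' ⟶ A} {z : 𝕀 ⟶ D'} {n : D ⊗ᵍ D' ⟶ D}
    {x : A ◃ u ≫ m ≅ cst (A ⊗ᵍ 𝕀) A} {x' : D ◃ z ≫ n ≅ cst (D ⊗ᵍ 𝕀) D}
    {F : Hom1 1 P'} {p : Hom1 (P * P') P} {G : Hom1 1 S'} {k : Hom1 (S * S') S}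
    {η : lay P F 1 ⨾ p ⟶ one P} {θ : lay S G 1 ⨾ k ⟶ one S} (hA : A = P.obj) (hD : D = S.obj)
    (hF : Rep1 u F) (hp : Rep1 m p) (hG : Rep1 z G) (hk : Rep1 n k) (h : Rep2 x.hom η)
    (h' : Rep2 x'.hom θ) :
    Rep2 (rightUnitorTensor x x').hom (ru (u := F) (p := p) (z := G) (k := k) η θ) := by
  have e' := Ob.tensor_eq hA hD
  have e : (A ⊗ᵍ D) ⊗ᵍ 𝕀 = (P * S).obj := by rw [tensor_unit, e']
  rw [ru_eq]
  refine .cast (.comp_eqToHom (.vI ?_ ?_) _)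
  · exact .whI (.cst (P * S) _ e) (.chr hA hD hF hG) (hp.T hk)
  · exact .whI (.cst_comp _ (.mid hA hD rfl rfl))
      (.transI (.tc (hF.left P hA) hp (hG.left S hD) hk) (.T₂ h h')) (.id (P * S) e')

end

/-! ### Transfer of the coherence conditions. -/

/-- Cells of the strict model underlying the data of a `V`-bicategory. -/
structure StrictData (D : VBicategoryData.{w, v, u, u₁} V) where
  P : D.Obj → D.Obj → Ob V
  hP (c d : D.Obj) : D.Hom c d = (P c d).obj
  m (c d e : D.Obj) : Hom1 (P d e * P c d) (P c e)
  hm (c d e : D.Obj) : Rep1 (D.m c d e) (m c d e)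
  u (c : D.Obj) : Hom1 1 (P c c)
  hu (c : D.Obj) : Rep1 (D.u c) (u c)
  α (c d e f : D.Obj) :
    lay 1 (m d e f) (P c d) ⨾ m c d f ⟶ lay (P e f) (m c d e) 1 ⨾ m c e f
  hα (c d e f : D.Obj) : Rep2 (D.α c d e f).hom (α c d e f)
  l (c d : D.Obj) : lay 1 (u d) (P c d) ⨾ m c d d ⟶ one (P c d)
  hl (c d : D.Obj) : Rep2 (D.l c d).hom (l c d)
  r (c d : D.Obj) : lay (P c d) (u c) 1 ⨾ m c c d ⟶ one (P c d)
  hr (c d : D.Obj) : Rep2 (D.r c d).hom (r c d)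

namespace StrictData

section

variable {D : VBicategoryData.{w, v, u, u₁} V} (X : StrictData D)

/-- Identity coherence in the strict model. -/
def IdentityCoherence : Prop :=
  ∀ c d e : D.Obj,
    wh (lay (X.P d e) (X.u d) (X.P c d)) (X.α c d d e) (one _) ≫
        wh (one _) (ten (X.P d e) (X.l c d) 1) (X.m c d e) =
      wh (one _) (ten 1 (X.r d e) (X.P c d)) (X.m c d e)

/-- Associativity coherence in the strict model. -/
def AssociativityCoherence : Prop :=
  ∀ a b c d e : D.Obj,
    wh (one _) (ten 1 (X.α b c d e) (X.P a b)) (X.m a b e) ≫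
        wh (lay (X.P d e) (X.m b c d) (X.P a b)) (X.α a b d e) (one _) ≫
        wh (one _) (ten (X.P d e) (X.α a b c d) 1) (X.m a d e) =
      wh (lay 1 (X.m c d e) (X.P b c * X.P a b)) (X.α a b c e) (one _) ≫
        wh (one _) (sig (X.m c d e) (X.m a b c)).inv (X.m a c e) ≫
        wh (lay (X.P d e * X.P c d) (X.m a b c) 1) (X.α a c d e) (one _)

/-- Valid for every choice of counterparts in the model, so each `V`-bicategory can be given the
choice that suits it. -/
theorem isVBicategory_iff :
    IsVBicategory D ↔ X.IdentityCoherence ∧ X.AssociativityCoherence := by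
  have h : IsVBicategory D ↔ _ ∧ _ :=
    ⟨fun h => ⟨h.identity_coherence, h.associativity_coherence⟩, fun h => ⟨h.1, h.2⟩⟩
  refine h.trans (and_congr (forall₃_congr fun c d e => Rep2.heq_iff ?_ ?_)
    (forall₅_congr fun a b c d e => ?_))
  · exact .vcomp (.wh (.right _ (X.hP c d) (.left _ (X.hP d e) (X.hu d))) (X.hα c d d e)
        (.id _ (X.hP c e)))
      (.wh (.cst (X.P d e * X.P c d) _ (Ob.tensor_eq₃ (Q := 1) (X.hP d e) rfl (X.hP c d)))
        (.left _ (X.hP d e) (X.hl c d)) (X.hm c d e))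
  · exact .whiskerRight (.right _ (X.hP c d) (X.hr d e)) (X.hm c d e)
  have e₀ : ((D.Hom d e ⊗ᵍ D.Hom c d) ⊗ᵍ D.Hom b c) ⊗ᵍ D.Hom a b =
      (X.P d e * (X.P c d * (X.P b c * X.P a b))).obj := by
    simp only [X.hP, Ob.obj_mul, tensor_assoc]
  have e₁ := Ob.tensor_eq (X.hP d e) (X.hP c d)
  have e₂ := Ob.tensor_eq (X.hP b c) (X.hP a b)
  refine Rep2.heq_iff (.vcomp (.whiskerRight (.right _ (X.hP a b) (X.hα b c d e)) (X.hm a b e))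
    (.vcomp (.wh (.cst_comp _ (.right _ (X.hP a b) (.left _ (X.hP d e) (X.hm b c d))))
        (X.hα a b d e) (.id _ (X.hP a e)))
      (.wh (.cst (X.P d e * (X.P c d * (X.P b c * X.P a b))) _ e₀)
        (.left _ (X.hP d e) (X.hα a b c d)) (X.hm a d e)))) ?_
  refine .vcomp (.wh ?_ (X.hα a b c e) (.id _ (X.hP a e)))
    (.vcomp (.wh (.cst (X.P d e * (X.P c d * (X.P b c * X.P a b))) _ e₀)
        (.inv (.sig (X.hm c d e) (X.hm a b c))) (X.hm a c e))
      (.wh (.cst_comp _ (.left (X.P d e * X.P c d) e₁ (X.hm a b c))) (X.hα a c d e)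
        (.id _ (X.hP a e))))
  exact .right (X.P a b) (X.hP a b) (.right (X.P b c) (X.hP b c) (X.hm c d e))

end

/-- Cells of the strict model for an arbitrary `V`-bicategory. -/
noncomputable def of (D : VBicategoryData.{w, v, u, u₁} V) : StrictData D :=
  have h₀ (c d : D.Obj) : D.Hom c d = (Ob.of (D.Hom c d)).obj := (Ob.obj_of _).symm
  have h (c d e : D.Obj) := Rep1.mk' (D.m c d e)
    (Ob.tensor_eq (Ob.obj_of (D.Hom d e)).symm (Ob.obj_of (D.Hom c d)).symm)
    (Ob.obj_of (D.Hom c e)).symm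
  have h' (c : D.Obj) := Rep1.mk' (P := 1) (D.u c) rfl (Ob.obj_of (D.Hom c c)).symm
  have hα (c d e f : D.Obj) := rep_homOf
    (((h d e f).right _ (h₀ c d)).comp (h c d f))
    (.cst_comp _ (((h c d e).left _ (h₀ e f)).comp (h c e f))) (D.α c d e f).hom
  have hl (c d : D.Obj) := rep_homOf (((h' d).right _ (h₀ c d)).comp (h c d d))
    (.cst (Ob.of (D.Hom c d)) _ (by rw [unit_tensor, Ob.obj_of])) (D.l c d).hom
  have hr (c d : D.Obj) := rep_homOf (((h' c).left _ (h₀ c d)).comp (h c c d))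
    (.cst (Ob.of (D.Hom c d)) _ (by rw [tensor_unit, Ob.obj_of])) (D.r c d).hom
  { P := fun c d => Ob.of (D.Hom c d)
    hP := h₀
    m := fun c d e => _
    hm := h
    u := fun c => _
    hu := h'
    α := fun c d e f => _
    hα := hα
    l := fun c d => _
    hl := hl
    r := fun c d => _
    hr := hr }

section

variable [SemistrictBraided V] {B : VBicategoryData.{w, v, u, u₁} V}
  {C : VBicategoryData.{w, v, u, u₂} V}

/-- Cells of the strict model for a tensor product of `V`-bicategories. -/
noncomputable def tensor (X : StrictData B) (Y : StrictData C) : StrictData (B.tensor C) where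
  P x y := X.P x.1 y.1 * Y.P x.2 y.2
  hP _ _ := Ob.tensor_eq (X.hP _ _) (Y.hP _ _)
  m x y z := χ (X.P y.1 z.1) (Y.P y.2 z.2) (X.P x.1 y.1) (Y.P x.2 y.2) ⨾
    (T (X.m x.1 y.1 z.1) (Y.m x.2 y.2 z.2) :)
  hm _ _ _ := .compTensor (X.hP _ _) (X.hP _ _) (Y.hP _ _) (Y.hP _ _) (X.hm _ _ _) (Y.hm _ _ _)
  u x := T (X.u x.1) (Y.u x.2)
  hu _ := .unitTensor (X.hu _) (Y.hu _)
  α x y z t := al (X.α x.1 y.1 z.1 t.1) (Y.α x.2 y.2 z.2 t.2)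
  hα _ _ _ _ := .assocTensor (X.hP _ _) (X.hP _ _) (X.hP _ _) (Y.hP _ _) (Y.hP _ _) (Y.hP _ _)
    (X.hm _ _ _) (X.hm _ _ _) (X.hm _ _ _) (X.hm _ _ _) (Y.hm _ _ _) (Y.hm _ _ _) (Y.hm _ _ _)
    (Y.hm _ _ _) (X.hα _ _ _ _) (Y.hα _ _ _ _)
  l x y := lu (u := X.u y.1) (q := X.m x.1 y.1 y.1) (z := Y.u y.2) (l := Y.m x.2 y.2 y.2)
    (X.l x.1 y.1) (Y.l x.2 y.2)
  hl _ _ := .leftUnitorTensor (X.hP _ _) (Y.hP _ _) (X.hu _) (X.hm _ _ _) (Y.hu _) (Y.hm _ _ _)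
    (X.hl _ _) (Y.hl _ _)
  r x y := ru (u := X.u x.1) (p := X.m x.1 x.1 y.1) (z := Y.u x.2) (k := Y.m x.2 x.2 y.2)
    (X.r x.1 y.1) (Y.r x.2 y.2)
  hr _ _ := .rightUnitorTensor (X.hP _ _) (Y.hP _ _) (X.hu _) (X.hm _ _ _) (Y.hu _) (Y.hm _ _ _)
    (X.hr _ _) (Y.hr _ _)

theorem IdentityCoherence.tensor {X : StrictData B} {Y : StrictData C}
    (hX : X.IdentityCoherence) (hY : Y.IdentityCoherence) :
    (X.tensor Y).IdentityCoherence :=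
  fun c d e => al_triangle (hX c.1 d.1 e.1) (hY c.2 d.2 e.2)

theorem AssociativityCoherence.tensor {X : StrictData B} {Y : StrictData C}
    (hX : X.AssociativityCoherence) (hY : Y.AssociativityCoherence) :
    (X.tensor Y).AssociativityCoherence :=
  fun a b c d e => al_pentagon (hX a.1 b.1 c.1 d.1 e.1) (hY a.2 b.2 c.2 d.2 e.2)

end

end StrictData

end

end StrictModel

theorem mainTheorem2 {V : Type u} [Bicategory.{w, v} V] [Bicategory.Strict V] [GrayMonoid V]
    [BraidedGrayMonoid V] [SemistrictBraided V]
    (B : VBicategoryData.{w, v, u, u₁} V) (C : VBicategoryData.{w, v, u, u₂} V)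
    (hB : IsVBicategory B) (hC : IsVBicategory C) :
    IsVBicategory (B.tensor C) := by
  rw [(StrictData.of B).isVBicategory_iff] at hB
  rw [(StrictData.of C).isVBicategory_iff] at hC
  -- For `B ⊗ C` the counterparts are built from those of `B` and `C`, so that its associator is
  -- literally `al` and its unitors are `lu` and `ru`.
  rw [((StrictData.of B).tensor (StrictData.of C)).isVBicategory_iff]
  exact ⟨hB.1.tensor hC.1, hB.2.tensor hC.2⟩
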